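/- Let $\delta\in(0,1]$ and let $(X_i)_{i\in\mathbb Z}$ be a stationary sequence of real random variables with $\mathbb E X_0=0$ and $\mathbb E|X_0|^{2+\delta}<\infty$, adapted to a non-decreasing stationary filtration $(\mathcal F_i)_{i\in\mathbb Z}$ (that is, $\mathcal F_i=\sigma(Y_j:j\le i)$ for some process $(Y_i)_{i\in\mathbb Z}$ such that $(X_i,Y_i)_{i\in\mathbb Z}$ is stationary; this includes $X_i=X_0\circ T^i$, $\mathcal F_i=T^{-i}(\mathcal F_0)$ with $T$ bimeasurable, bijective and measure preserving and $\mathcal F_0\subseteq T^{-1}(\mathcal F_0)$). Put $S_n=X_1+\dots+X_n$. For $k\ge 1$ let $\tilde\gamma_{2,\delta}(k)=\max(\tilde a(k),\tilde b(k))$ with $$\tilde a(k)=\sup_{i\ge0}\mathbb E\bigl(|X_{-i}|^\delta\,|\mathbb E[X_0X_k\mid\mathcal F_0]-\mathbb E[X_0X_k]|\bigr),\qquad \tilde b(k)=\sup_{j\ge0}\mathbb E\bigl(|X_0|^\delta\,|\mathbb E[X_kX_{k+j}\mid\mathcal F_0]-\mathbb E[X_kX_{k+j}]|\bigr).$$ Writing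 $Z^{(0)}=Z-\mathbb E Z$, let $\alpha(\mathcal M,U)=\sup_{x}\|\mathbb E(\mathbf 1^{(0)}_{U\le x}\mid\mathcal M)\|_1$, $\alpha(\mathcal M,(U,V))=\sup_{x,y}\|\mathbb E(\mathbf 1^{(0)}_{U\le x}\mathbf 1^{(0)}_{V\le y}\mid\mathcal M)-\mathbb E(\mathbf 1^{(0)}_{U\le x}\mathbf 1^{(0)}_{V\le y})\|_1$, and $$\alpha_2(k)=\max\Bigl(\alpha(\mathcal F_0,X_k),\ \sup_{l\ge0}\alpha(\mathcal F_0,(X_k,X_{k+l}))\Bigr).$$ Let $\tau_1(k)=\bigl\|\sup\{P_{X_k|\mathcal F_0}(f)-P_{X_k}(f): f:\mathbb R\to\mathbb R \text{ 1-Lipschitz}\}\bigr\|_1$, let $\tau(\mathcal M,(U,V))=\frac12\bigl\|\sup\{P_{(U,V)|\mathcal M}(f)-P_{(U,V)}(f)\}\bigr\|_1$, the supremum being over $f:\mathbb R^2\to\mathbb R$ that are 1-Lipschitz for the norm $\frac12(|u|+|v|)$ (with regular conditional laws), and $$\tau_2(k)=\max\Bigl(\tau_1(k),\ \sup_{l\ge0}\tau(\mathcal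 F_0,(X_k,X_{k+l}))\Bigr).$$ Let $Q(u)=\inf\{t\ge0:\mathbb P(|X_0|>t)\le u\}$ and let $G_{|X_0|}$ be the (generalized) inverse of $x\mapsto\int_0^xQ(u)\,du$ on $[0,1]$. Assume that $(\tilde\gamma_{2,\delta}(k))_{k\ge1}$ is non-increasing with limit $0$, and that at least one of the following holds: (i) $\sum_{k\ge1}k\int_0^{\alpha_2(k)}Q^{2+\delta}(u)\,du<\infty$; (ii) $\sum_{k\ge1}k\int_0^{\tau_2(k)/2}Q^{1+\delta}(G_{|X_0|}(u))\,du<\infty$. Then the series $\sigma^2=\sum_{k\in\mathbb Z}\operatorname{cov}(X_0,X_k)$ converges absolutely, $\sigma^2\ge 0$, and, with $G$ a centered Gaussian random variable of variance $\sigma^2$ (degenerate if $\sigma^2=0$), $n^{-1/2}S_n$ converges in distribution to $G$, $$\zeta_{2+\delta}(P_{n^{-1/2}S_n},P_G)=O(n^{-\delta/2})\qquad\text{and}\qquad W_{2+\delta}(P_{n^{-1/2}S_n},P_G)=O(n^{-\delta/(4+2\delta)}).$$ Here $\zeta_{2+\delta}(\mu,\nu)=\sup|\int f\,d\mu-\int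 f\,d\nu|$ over all $f\in C^2(\mathbb R)$ with $f(0)=f'(0)=f''(0)=0$ and $|f''(x)-f''(y)|\le|x-y|^{\delta}$ for all $x,y$, and $W_p(\mu,\nu)=\inf(\mathbb E|X-Y|^p)^{1/p}$ over all couplings $(X,Y)$ of $\mu$ and $\nu$. -/

import Mathlib

open MeasureTheory ProbabilityTheory Filter Topology
open scoped ENNReal NNReal

universe u

noncomputable section

namespace CLTRate

variable {Ω : Type u} {mΩ : MeasurableSpace Ω}

/-- A process indexed by `ℤ` is (strictly) stationary: each coordinate is measurable and the law
of the whole process is invariant under the time shift. -/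
def IsStationary {S : Type*} [MeasurableSpace S] (μ : Measure Ω) (Z : ℤ → Ω → S) : Prop :=
  (∀ i, Measurable (Z i)) ∧
    μ.map (fun ω (i : ℤ) => Z (i + 1) ω) = μ.map (fun ω (i : ℤ) => Z i ω)

/-- The sequence `X` is stationary and adapted to the non-decreasing filtration `F`, and `F` is
stationary (jointly with `X`): `F i` is the σ-algebra generated by the past up to time `i` of a
process `Y` for which `(X i, Y i)` is stationary.
The usual setting `X i = X 0 ∘ T ^ i`, `F i = T ^ (-i) (F 0)` with `T` an invertible
measure-preserving map and `F 0 ⊆ T⁻¹ (F 0)` is the case `Y i = T ^ i : Ω → (Ω, F 0)`; the natural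
filtration of a stationary sequence is the case `Y = X`. -/
def IsStationaryAdapted (μ : Measure Ω) (X : ℤ → Ω → ℝ) (F : Filtration ℤ mΩ) : Prop :=
  Adapted F X ∧
    ∃ (E : Type u) (mE : MeasurableSpace E) (Y : ℤ → Ω → E),
      IsStationary μ (fun i ω => (X i ω, Y i ω)) ∧
      ∀ i, F i = ⨆ j ≤ i, MeasurableSpace.comap (Y j) mE

/-! ### Projective coefficients -/

/-- `sup_{i ≥ 0} 𝔼(|X_{-i}|^δ |𝔼[X_0 X_k | F_0] - 𝔼[X_0 X_k]|)`. -/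
def coeffA (μ : Measure Ω) (X : ℤ → Ω → ℝ) (F : Filtration ℤ mΩ) (δ : ℝ) (k : ℕ) : ℝ≥0∞ :=
  ⨆ i : ℕ, ∫⁻ ω, ‖X (-(i : ℤ)) ω‖ₑ ^ δ *
    ‖(μ[fun ω' => X 0 ω' * X k ω' | F 0]) ω - ∫ ω', X 0 ω' * X k ω' ∂μ‖ₑ ∂μ

/-- `sup_{j ≥ 0} 𝔼(|X_0|^δ |𝔼[X_k X_{k+j} | F_0] - 𝔼[X_k X_{k+j}]|)`. -/
def coeffB (μ : Measure Ω) (X : ℤ → Ω → ℝ) (F : Filtration ℤ mΩ) (δ : ℝ) (k : ℕ) : ℝ≥0∞ :=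
  ⨆ j : ℕ, ∫⁻ ω, ‖X 0 ω‖ₑ ^ δ *
    ‖(μ[fun ω' => X k ω' * X (k + j) ω' | F 0]) ω - ∫ ω', X k ω' * X (k + j) ω' ∂μ‖ₑ ∂μ

/-- The coefficient `γ̃_{2,δ}(k)`. -/
def gammaTwo (μ : Measure Ω) (X : ℤ → Ω → ℝ) (F : Filtration ℤ mΩ) (δ : ℝ) (k : ℕ) : ℝ≥0∞ :=
  max (coeffA μ X F δ k) (coeffB μ X F δ k)

/-! ### α-dependence coefficients -/

/-- The centered indicator `1_{U ≤ x} - P(U ≤ x)`. -/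
def centeredInd (μ : Measure Ω) (U : Ω → ℝ) (x : ℝ) (ω : Ω) : ℝ :=
  {ω' | U ω' ≤ x}.indicator (fun _ => (1 : ℝ)) ω - μ.real {ω' | U ω' ≤ x}

/-- `α(M, U) = sup_x ‖𝔼(1_{U ≤ x}^{(0)} | M)‖₁`. -/
def alphaSingle {Ω : Type u} (M : MeasurableSpace Ω) {mΩ : MeasurableSpace Ω} (μ : Measure Ω)
    (U : Ω → ℝ) : ℝ≥0∞ :=
  ⨆ x : ℝ, eLpNorm (μ[centeredInd μ U x | M]) 1 μ

/-- `α(M, (U, V)) = sup_{x,y} ‖𝔼(1_{U ≤ x}^{(0)} 1_{V ≤ y}^{(0)} | M) - 𝔼(⋯)‖₁`. -/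
def alphaPair {Ω : Type u} (M : MeasurableSpace Ω) {mΩ : MeasurableSpace Ω} (μ : Measure Ω)
    (U V : Ω → ℝ) : ℝ≥0∞ :=
  ⨆ (x : ℝ) (y : ℝ),
    eLpNorm (fun ω => (μ[fun ω' => centeredInd μ U x ω' * centeredInd μ V y ω' | M]) ω
      - ∫ ω', centeredInd μ U x ω' * centeredInd μ V y ω' ∂μ) 1 μ

/-- `α₂(k) = max (α(F_0, X_k), sup_{l ≥ 0} α(F_0, (X_k, X_{k+l})))`. -/
def alphaTwo (μ : Measure Ω) (X : ℤ → Ω → ℝ) (F : Filtration ℤ mΩ) (k : ℕ) : ℝ≥0∞ :=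
  max (alphaSingle (F 0) μ (X k)) (⨆ l : ℕ, alphaPair (F 0) μ (X k) (X (k + l)))

/-! ### τ-dependence coefficients -/

/-- A regular version of the conditional law of `Z` given the σ-algebra `M`. -/
def condLaw {S : Type*} [MeasurableSpace S] [StandardBorelSpace S] [Nonempty S]
    {Ω : Type u} (M : MeasurableSpace Ω) {mΩ : MeasurableSpace Ω} (μ : Measure Ω)
    [IsFiniteMeasure μ] (Z : Ω → S) (ω : Ω) : Measure S :=
  @condDistrib Ω Ω S _ _ _ mΩ M Z id μ _ ω

/-- `τ(M, U) = ‖sup {P_{U|M}(f) - P_U(f) : f 1-Lipschitz}‖₁`. -/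
def tauSingle {Ω : Type u} (M : MeasurableSpace Ω) {mΩ : MeasurableSpace Ω} (μ : Measure Ω)
    [IsFiniteMeasure μ] (U : Ω → ℝ) : ℝ≥0∞ :=
  ∫⁻ ω, ⨆ (f : ℝ → ℝ) (_ : ∀ x y, |f x - f y| ≤ |x - y|),
    ENNReal.ofReal (∫ x, f x ∂(condLaw M μ U ω) - ∫ x, f x ∂(μ.map U)) ∂μ

/-- `τ(M, (U, V)) = ½ ‖sup {P_{(U,V)|M}(f) - P_{(U,V)}(f) : f 1-Lipschitz}‖₁`, where `ℝ × ℝ`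
carries the norm `½ (|u| + |v|)`. -/
def tauPair {Ω : Type u} (M : MeasurableSpace Ω) {mΩ : MeasurableSpace Ω} (μ : Measure Ω)
    [IsFiniteMeasure μ] (U V : Ω → ℝ) : ℝ≥0∞ :=
  (∫⁻ ω, ⨆ (f : ℝ × ℝ → ℝ)
      (_ : ∀ p q, |f p - f q| ≤ (1 / 2) * (|p.1 - q.1| + |p.2 - q.2|)),
    ENNReal.ofReal (∫ p, f p ∂(condLaw M μ (fun ω' => (U ω', V ω')) ω)
      - ∫ p, f p ∂(μ.map (fun ω' => (U ω', V ω')))) ∂μ) / 2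

/-- `τ₂(k) = max (τ₁(k), sup_{l ≥ 0} τ(F_0, (X_k, X_{k+l})))`. -/
def tauTwo (μ : Measure Ω) [IsFiniteMeasure μ] (X : ℤ → Ω → ℝ) (F : Filtration ℤ mΩ) (k : ℕ) :
    ℝ≥0∞ :=
  max (tauSingle (F 0) μ (X k)) (⨆ l : ℕ, tauPair (F 0) μ (X k) (X (k + l)))

/-! ### Quantile functions and the two summability conditions -/

/-- The upper tail quantile function `Q_{|U|}(u) = inf {t ≥ 0 : P(|U| > t) ≤ u}`. -/
def tailQuantile (μ : Measure Ω) (U : Ω → ℝ) (u : ℝ) : ℝ≥0∞ :=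
  sInf {t : ℝ≥0∞ | μ {ω | t < ‖U ω‖ₑ} ≤ ENNReal.ofReal u}

/-- `G_{|U|}`: the (generalized) inverse of `x ↦ ∫_0^x Q_{|U|}(u) du`, `x ∈ [0,1]`. -/
def invIntQuantile (μ : Measure Ω) (U : Ω → ℝ) (v : ℝ) : ℝ :=
  sSup {x : ℝ | x ∈ Set.Icc (0 : ℝ) 1 ∧
    ∫⁻ u in Set.Ioc 0 x, tailQuantile μ U u ≤ ENNReal.ofReal v}

/-- `∑_{k ≥ 1} k ∫_0^{α₂(k)} Q_{|X_0|}^{2+δ}(u) du < ∞`. -/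
def AlphaCondition (μ : Measure Ω) (X : ℤ → Ω → ℝ) (F : Filtration ℤ mΩ) (δ : ℝ) : Prop :=
  ∑' k : ℕ, (k : ℝ≥0∞) *
    ∫⁻ u in {u : ℝ | 0 < u ∧ ENNReal.ofReal u ≤ alphaTwo μ X F k},
      tailQuantile μ (X 0) u ^ (2 + δ) < ∞

/-- `∑_{k ≥ 1} k ∫_0^{τ₂(k)/2} Q_{|X_0|}^{1+δ} ∘ G_{|X_0|}(u) du < ∞`. -/
def TauCondition (μ : Measure Ω) [IsFiniteMeasure μ] (X : ℤ → Ω → ℝ) (F : Filtration ℤ mΩ)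
    (δ : ℝ) : Prop :=
  ∑' k : ℕ, (k : ℝ≥0∞) *
    ∫⁻ u in {u : ℝ | 0 < u ∧ ENNReal.ofReal u ≤ tauTwo μ X F k / 2},
      tailQuantile μ (X 0) (invIntQuantile μ (X 0) u) ^ (1 + δ) < ∞

/-! ### Distances between laws on the line -/

/-- The greatest integer strictly less than `p`, for `p > 0`. -/
def zolOrder (p : ℝ) : ℕ := ⌈p⌉₊ - 1

/-- The class `Λ_p^0(ℝ)`: `l` times continuously differentiable functions all of whose derivatives
of order `0, …, l` vanish at `0` and whose `l`-th derivative is `(p - l)`-Hölder with constant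
`1`, where `l` is the greatest integer strictly less than `p`. -/
def ZolClass (p : ℝ) : Set (ℝ → ℝ) :=
  {f | ContDiff ℝ (zolOrder p) f ∧ (∀ i ≤ zolOrder p, iteratedDeriv i f 0 = 0) ∧
    ∀ x y, |iteratedDeriv (zolOrder p) f x - iteratedDeriv (zolOrder p) f y|
      ≤ |x - y| ^ (p - zolOrder p)}

/-- The Zolotarev distance of order `p`. -/
def zolotarev (p : ℝ) (ν₁ ν₂ : Measure ℝ) : ℝ≥0∞ :=
  ⨆ f ∈ ZolClass p, ENNReal.ofReal |∫ x, f x ∂ν₁ - ∫ x, f x ∂ν₂|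

/-- The Wasserstein distance of order `p`, as an infimum over couplings. -/
def wasserstein (p : ℝ) (ν₁ ν₂ : Measure ℝ) : ℝ≥0∞ :=
  ⨅ (π : Measure (ℝ × ℝ)) (_ : π.map Prod.fst = ν₁ ∧ π.map Prod.snd = ν₂),
    (∫⁻ z, ‖z.1 - z.2‖ₑ ^ p ∂π) ^ (1 / p)

/-- `n^{-1/2} S_n` with `S_n = X_1 + ⋯ + X_n`. -/
def normSum (X : ℤ → Ω → ℝ) (n : ℕ) (ω : Ω) : ℝ :=
  (Real.sqrt n)⁻¹ * ∑ i ∈ Finset.Icc 1 n, X (i : ℤ) ω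

/-- `∑_{k ∈ ℤ} cov(X_0, X_k)`. -/
def asympVar (μ : Measure Ω) (X : ℤ → Ω → ℝ) : ℝ :=
  ∑' k : ℤ, cov[X 0, X k; μ]

end CLTRate

end

/-! The rate comes from Lindeberg replacement in the smooth metric ζ_{2+δ}. This metric is
homogeneous of degree 2+δ, so rescaling by √n reduces the claim to |E g(S_n) - E g(N(0, nσ²))| ≤ C
n, uniformly over g whose second derivative vanishes at 0 and is δ-Hölder with constant one
(`DependenceBounds.exists_lindeberg_bound`). Gaussian increments are exchanged for the X_k one at a
time. The Gaussian part not yet exchanged is averaged into g, which stays in the same class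
(`HolderJet.gaussAvg`).

One exchange compares E g(S_{k+1}) - E g(S_k) with (σ²/2) E g''(S_k)
(`DependenceBounds.lindeberg_step`). Under dependence the term E g'(S_k) X_{k+1} of the Taylor
expansion does not vanish. It is telescoped along the past: each increment of g' is g''(S_l) X_{l+1}
plus a remainder of size |X_{l+1}|^{1+δ}, and X_{l+1} X_{k+1} is then replaced by its covariance
after telescoping g''(S_l) in turn. If θ_i bounds the dependence across a gap i+1, the errors are
sums of θ_i, of min(θ_i, θ_j) and of (i+1)θ_i, all controlled by the single series Σ (i+1)θ_i. The
covariances missing at step k form a tail of Σ θ_i, multiplied by E g''(S_k) = O(n); these tails sum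
over k to at most the same series. The total is O(n).

The θ_i come from truncation at a level M (`IsTransferable.exists_dependenceBounds`). If κ measures
the dependence of the truncated variables, every required bound is a multiple of M^{1+δ} κ +
E|X_0|^{2+δ} 1_{|X_0|>M}. Truncation is an average of half-line indicators over an interval of
length 2M, so κ is of order M α_2; it is also 1-Lipschitz, so κ is of order τ_2. The levels M =
Q(α_2) and M = Q(G(τ_2/2)) bound both terms by the integrals in the summability conditions
(`exists_truncation_level`).

On the line, W_{2+δ} to the power 2+δ is at most a constant times ζ_{2+δ}
(`wasserstein_le_zolotarev`). Between the two quantiles of the same order, the two distribution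
functions are strictly ordered. Two test functions, one growing only where the first distribution
function is larger and one only where the second is, therefore recover the cost of the comonotone
coupling (`exists_zolClass_increasing`). Convergence in distribution follows from the same coupling.
-/

namespace CLTRate

/-! ### Second order jets with Hölder remainder -/

/-- The functions `g₁`, `g₂` play the role of the first two derivatives of `g`, with `g₂` being
`δ`-Hölder; this is expressed through Taylor inequalities, which are stable under averaging. -/
structure HolderJet (δ : ℝ) (g g₁ g₂ : ℝ → ℝ) : Prop where
  zero : ∀ x h, |g (x + h) - g x - g₁ x * h - g₂ x * h ^ 2 / 2| ≤ |h| ^ (2 + δ)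
  one : ∀ x h, |g₁ (x + h) - g₁ x - g₂ x * h| ≤ |h| ^ (1 + δ)
  two : ∀ x h, |g₂ (x + h) - g₂ x| ≤ |h| ^ δ

theorem abs_le_mul_of_hasDerivAt {k k' : ℝ → ℝ} (hk : ∀ x, HasDerivAt k (k' x) x) (h0 : k 0 = 0)
    {h B : ℝ} (hB : ∀ x, |x| ≤ |h| → |k' x| ≤ B) : |k h| ≤ B * |h| := by
  have := Convex.norm_image_sub_le_of_norm_hasDerivWithin_le (f := k) (f' := k')
    (s := Set.uIcc 0 h) (x := 0) (y := h) (C := B) (fun x _ => (hk x).hasDerivWithinAt)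
    (fun x hx => by
      rw [Real.norm_eq_abs]
      apply hB
      have := Set.abs_sub_left_of_mem_uIcc hx
      simpa using this) (convex_uIcc 0 h) (by simp) (by simp)
  simpa [h0] using this

/-- Each Taylor remainder has as derivative in the increment the remainder of one order less. The
mean value inequality then gains one power of |h| and keeps the constant 1; the sharper factors
1/(1+δ) and 1/(2+δ) are not needed. -/
theorem HolderJet.of_hasDerivAt {δ : ℝ} (hδ0 : 0 < δ) {g g₁ g₂ : ℝ → ℝ}
    (h1 : ∀ x, HasDerivAt g (g₁ x) x) (h2 : ∀ x, HasDerivAt g₁ (g₂ x) x)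
    (h3 : ∀ x y, |g₂ x - g₂ y| ≤ |x - y| ^ δ) : HolderJet δ g g₁ g₂ := by
  have two : ∀ x h, |g₂ (x + h) - g₂ x| ≤ |h| ^ δ := fun x h => by simpa using h3 (x + h) x
  have one : ∀ x h, |g₁ (x + h) - g₁ x - g₂ x * h| ≤ |h| ^ (1 + δ) := by
    intro x h
    have := abs_le_mul_of_hasDerivAt (k := fun s => g₁ (x + s) - g₁ x - g₂ x * s)
      (k' := fun s => g₂ (x + s) - g₂ x) (h := h) (B := |h| ^ δ)
      (fun s => by
        have ha : HasDerivAt (fun s => g₁ (x + s)) (g₂ (x + s)) s :=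
          (h2 (x + s)).comp_const_add x s
        exact ((ha.sub_const (g₁ x)).sub ((hasDerivAt_id s).const_mul (g₂ x))).congr_deriv
          (by ring))
      (by simp) (fun s hs => (two x s).trans (Real.rpow_le_rpow (abs_nonneg _) hs hδ0.le))
    rw [add_comm 1 δ, Real.rpow_add_one' (abs_nonneg _) (by linarith)]
    exact this
  refine ⟨fun x h => ?_, one, two⟩
  have := abs_le_mul_of_hasDerivAt (k := fun s => g (x + s) - g x - g₁ x * s - g₂ x * s ^ 2 / 2)
      (k' := fun s => g₁ (x + s) - g₁ x - g₂ x * s) (h := h) (B := |h| ^ (1 + δ))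
      (fun s => by
        have ha : HasDerivAt (fun s => g (x + s)) (g₁ (x + s)) s :=
          (h1 (x + s)).comp_const_add x s
        have hb := ((ha.sub_const (g x)).sub ((hasDerivAt_id s).const_mul (g₁ x))).sub
          (((hasDerivAt_pow 2 s).const_mul (g₂ x)).div_const 2)
        exact hb.congr_deriv (by push_cast; ring))
      (by simp) (fun s hs => (one x s).trans
        (Real.rpow_le_rpow (abs_nonneg _) hs (by linarith)))
  rw [show 2 + δ = (1 + δ) + 1 by ring, Real.rpow_add_one' (abs_nonneg _) (by linarith)]
  exact this

theorem zolOrder_two_add {δ : ℝ} (hδ0 : 0 < δ) (hδ1 : δ ≤ 1) : zolOrder (2 + δ) = 2 := by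
  have : ⌈2 + δ⌉₊ = 3 := by
    rw [Nat.ceil_eq_iff (by norm_num)]
    constructor <;> norm_num <;> linarith
  simp [zolOrder, this]

theorem holderJet_of_mem_zolClass {δ : ℝ} (hδ0 : 0 < δ) (hδ1 : δ ≤ 1) {f : ℝ → ℝ}
    (hf : f ∈ ZolClass (2 + δ)) :
    HolderJet δ f (deriv f) (deriv (deriv f)) ∧ f 0 = 0 ∧ deriv f 0 = 0 ∧
      deriv (deriv f) 0 = 0 := by
  obtain ⟨hc, h0, hH⟩ := hf
  rw [zolOrder_two_add hδ0 hδ1] at *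
  have hi1 : iteratedDeriv 1 f = deriv f := iteratedDeriv_one
  have hi2 : iteratedDeriv 2 f = deriv (deriv f) := by
    rw [iteratedDeriv_succ, iteratedDeriv_one]
  have hd1 : Differentiable ℝ f := hc.differentiable (by norm_num)
  have hc1 : ContDiff ℝ 1 (deriv f) :=
    (contDiff_succ_iff_deriv (n := 1)|>.1 (by simpa [one_add_one_eq_two] using hc)).2.2
  have hd2 : Differentiable ℝ (deriv f) := hc1.differentiable (by norm_num)
  refine ⟨HolderJet.of_hasDerivAt hδ0 (fun x => (hd1 x).hasDerivAt)
    (fun x => (hd2 x).hasDerivAt) fun x y => ?_, ?_, ?_, ?_⟩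
  · have := hH x y
    rw [hi2] at this
    simpa using this
  · simpa using h0 0 (by norm_num)
  · simpa [hi1] using h0 1 (by norm_num)
  · simpa [hi2] using h0 2 le_rfl

theorem mem_zolClass_of_hasDerivAt {δ : ℝ} (hδ0 : 0 < δ) (hδ1 : δ ≤ 1) {g g₁ g₂ : ℝ → ℝ}
    (h1 : ∀ x, HasDerivAt g (g₁ x) x) (h2 : ∀ x, HasDerivAt g₁ (g₂ x) x)
    (h3 : ∀ x y, |g₂ x - g₂ y| ≤ |x - y| ^ δ) (hg : g 0 = 0) (hg1 : g₁ 0 = 0) (hg2 : g₂ 0 = 0) :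
    g ∈ ZolClass (2 + δ) := by
  have e1 : deriv g = g₁ := funext fun x => (h1 x).deriv
  have e2 : deriv g₁ = g₂ := funext fun x => (h2 x).deriv
  have hi2 : iteratedDeriv 2 g = g₂ := by
    rw [iteratedDeriv_succ, iteratedDeriv_one, e1, e2]
  have hcont : Continuous g₂ := by
    rw [continuous_iff_continuousAt]
    intro x
    rw [ContinuousAt, tendsto_iff_norm_sub_tendsto_zero]
    refine squeeze_zero (fun _ => norm_nonneg _) (fun y => h3 y x) ?_
    have : Continuous fun y : ℝ => |y - x| ^ δ :=
      (by fun_prop : Continuous fun y : ℝ => |y - x|).rpow_const fun _ => Or.inr hδ0.le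
    simpa [Real.zero_rpow hδ0.ne'] using this.tendsto x
  unfold ZolClass
  rw [Set.mem_ofPred_eq, zolOrder_two_add hδ0 hδ1]
  refine ⟨?_, ?_, ?_⟩
  · have hc1 : ContDiff ℝ 1 g₁ := by
      rw [show (1 : WithTop ℕ∞) = 0 + 1 by simp, contDiff_succ_iff_deriv]
      refine ⟨fun x => (h2 x).differentiableAt, by simp, ?_⟩
      rw [e2]
      exact contDiff_zero.2 hcont
    have : ContDiff ℝ (1 + 1) g := by
      rw [contDiff_succ_iff_deriv]
      refine ⟨fun x => (h1 x).differentiableAt, by simp, ?_⟩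
      rwa [e1]
    simpa [one_add_one_eq_two] using this
  · intro i hi
    interval_cases i
    · simpa using hg
    · simpa [iteratedDeriv_one, e1] using hg1
    · simpa [hi2] using hg2
  · intro x y
    rw [hi2]
    simpa using h3 x y

theorem HolderJet.abs_le {δ : ℝ} {g g₁ g₂ : ℝ → ℝ} (hg : HolderJet δ g g₁ g₂) (x : ℝ) :
    |g x| ≤ |g 0| + |g₁ 0| * |x| + |g₂ 0| * |x| ^ 2 / 2 + |x| ^ (2 + δ) := by
  have h := hg.zero 0 x
  rw [zero_add] at h
  have e : g x = g 0 + g₁ 0 * x + g₂ 0 * x ^ 2 / 2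
      + (g x - g 0 - g₁ 0 * x - g₂ 0 * x ^ 2 / 2) := by ring
  calc |g x| = _ := congrArg abs e
    _ ≤ |g 0| + |g₁ 0 * x| + |g₂ 0 * x ^ 2 / 2| + _ := by
        refine (abs_add_le _ _).trans (add_le_add ((abs_add_le _ _).trans
          (add_le_add (abs_add_le _ _) le_rfl)) h)
    _ = _ := by
        rw [abs_mul, abs_div, abs_mul, abs_pow]
        simp

theorem HolderJet.abs_one_le {δ : ℝ} {g g₁ g₂ : ℝ → ℝ} (hg : HolderJet δ g g₁ g₂) (x : ℝ) :
    |g₁ x| ≤ |g₁ 0| + |g₂ 0| * |x| + |x| ^ (1 + δ) := by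
  have h := hg.one 0 x
  rw [zero_add] at h
  have e : g₁ x = g₁ 0 + g₂ 0 * x + (g₁ x - g₁ 0 - g₂ 0 * x) := by ring
  calc |g₁ x| = _ := congrArg abs e
    _ ≤ |g₁ 0| + |g₂ 0 * x| + _ :=
        (abs_add_le _ _).trans (add_le_add (abs_add_le _ _) h)
    _ = _ := by rw [abs_mul]

theorem HolderJet.abs_two_le {δ : ℝ} {g g₁ g₂ : ℝ → ℝ} (hg : HolderJet δ g g₁ g₂) (x : ℝ) :
    |g₂ x| ≤ |g₂ 0| + |x| ^ δ := by
  have h := hg.two 0 x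
  rw [zero_add] at h
  have e : g₂ x = g₂ 0 + (g₂ x - g₂ 0) := by ring
  calc |g₂ x| = _ := congrArg abs e
    _ ≤ _ := (abs_add_le _ _).trans (add_le_add le_rfl h)

theorem continuous_of_increment_bound {g : ℝ → ℝ} {B : ℝ → ℝ → ℝ}
    (h : ∀ x y, |g (x + y) - g x| ≤ B x y) (hB : ∀ x, Tendsto (B x) (𝓝 0) (𝓝 0)) :
    Continuous g := by
  rw [continuous_iff_continuousAt]
  intro x
  rw [ContinuousAt, tendsto_iff_norm_sub_tendsto_zero]
  have h2 : Tendsto (fun y => B x (y - x)) (𝓝 x) (𝓝 0) := by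
    refine (hB x).comp ?_
    have : Continuous fun y : ℝ => y - x := by fun_prop
    simpa using this.tendsto x
  refine squeeze_zero (fun _ => norm_nonneg _) (fun y => ?_) h2
  simpa using h x (y - x)

theorem tendsto_abs_rpow_zero {p : ℝ} (hp : 0 < p) :
    Tendsto (fun h : ℝ => |h| ^ p) (𝓝 0) (𝓝 0) := by
  have : Continuous fun h : ℝ => |h| ^ p :=
    continuous_abs.rpow_const fun _ => Or.inr hp.le
  simpa [Real.zero_rpow hp.ne'] using this.tendsto 0

theorem HolderJet.continuous_two {δ : ℝ} (hδ0 : 0 < δ) {g g₁ g₂ : ℝ → ℝ}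
    (hg : HolderJet δ g g₁ g₂) : Continuous g₂ :=
  continuous_of_increment_bound hg.two fun _ => tendsto_abs_rpow_zero hδ0

theorem HolderJet.continuous_one {δ : ℝ} (hδ0 : 0 < δ) {g g₁ g₂ : ℝ → ℝ}
    (hg : HolderJet δ g g₁ g₂) : Continuous g₁ := by
  refine continuous_of_increment_bound (B := fun x h => |h| ^ (1 + δ) + |g₂ x| * |h|)
    (fun x h => ?_) fun x => ?_
  · have e : g₁ (x + h) - g₁ x = (g₁ (x + h) - g₁ x - g₂ x * h) + g₂ x * h := by ring
    rw [e, ← abs_mul]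
    exact (abs_add_le _ _).trans (add_le_add (hg.one x h) le_rfl)
  · have h2 : Tendsto (fun h : ℝ => |g₂ x| * |h|) (𝓝 0) (𝓝 0) := by
      have : Continuous fun h : ℝ => |g₂ x| * |h| := by fun_prop
      simpa using this.tendsto 0
    simpa using (tendsto_abs_rpow_zero (by linarith : 0 < 1 + δ)).add h2

theorem HolderJet.continuous {δ : ℝ} (hδ0 : 0 < δ) {g g₁ g₂ : ℝ → ℝ}
    (hg : HolderJet δ g g₁ g₂) : Continuous g := by
  refine continuous_of_increment_bound
    (B := fun x h => |h| ^ (2 + δ) + (|g₁ x| * |h| + |g₂ x| * |h| ^ 2 / 2))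
    (fun x h => ?_) fun x => ?_
  · have e : g (x + h) - g x = (g (x + h) - g x - g₁ x * h - g₂ x * h ^ 2 / 2)
      + (g₁ x * h + g₂ x * h ^ 2 / 2) := by ring
    have e2 : |g₂ x| * |h| ^ 2 / 2 = |g₂ x * h ^ 2 / 2| := by
      rw [abs_div, abs_mul, abs_pow]; simp
    rw [e, ← abs_mul, e2]
    exact (abs_add_le _ _).trans (add_le_add (hg.zero x h) (abs_add_le _ _))
  · have h2 : Tendsto (fun h : ℝ => |g₁ x| * |h| + |g₂ x| * |h| ^ 2 / 2) (𝓝 0) (𝓝 0) := by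
      have : Continuous fun h : ℝ => |g₁ x| * |h| + |g₂ x| * |h| ^ 2 / 2 := by fun_prop
      simpa using this.tendsto 0
    simpa using (tendsto_abs_rpow_zero (by linarith : 0 < 2 + δ)).add h2

theorem integrable_abs_rpow {α : Type*} {m : MeasurableSpace α} {μ : Measure α}
    [IsProbabilityMeasure μ] {Z : α → ℝ} {p q : ℝ} (hq0 : 0 ≤ q) (hqp : q ≤ p)
    (hZ : MemLp Z (ENNReal.ofReal p) μ) : Integrable (fun ω => |Z ω| ^ q) μ := by
  rcases hq0.eq_or_lt with rfl | hq
  · simp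
  have h1 : MemLp Z (ENNReal.ofReal q) μ :=
    hZ.mono_exponent (ENNReal.ofReal_le_ofReal hqp)
  have := h1.integrable_norm_rpow (by simpa using hq) (by simp)
  simpa [ENNReal.toReal_ofReal hq0] using this

theorem HolderJet.integrable_comp {δ : ℝ} (hδ0 : 0 < δ) {g g₁ g₂ : ℝ → ℝ}
    (hg : HolderJet δ g g₁ g₂) {α : Type*} {m : MeasurableSpace α} {μ : Measure α}
    [IsProbabilityMeasure μ] {Z : α → ℝ} (hZ : MemLp Z (ENNReal.ofReal (2 + δ)) μ) :
    Integrable (fun ω => g (Z ω)) μ := by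
  have i1 := integrable_abs_rpow (q := 1) zero_le_one (by linarith) hZ
  have i2 := integrable_abs_rpow (q := 2) zero_le_two (by linarith) hZ
  have i3 := integrable_abs_rpow (q := 2 + δ) (by linarith) le_rfl hZ
  simp only [Real.rpow_one, Real.rpow_two] at i1 i2
  refine Integrable.mono' ((((integrable_const |g 0|).add (i1.const_mul |g₁ 0|)).add
    ((i2.const_mul |g₂ 0|).div_const 2)).add i3)
    ((hg.continuous hδ0).comp_aestronglyMeasurable hZ.1) (.of_forall fun ω => ?_)
  exact hg.abs_le (Z ω)

theorem HolderJet.integrable_two_comp {δ : ℝ} (hδ0 : 0 < δ) {g g₁ g₂ : ℝ → ℝ}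
    (hg : HolderJet δ g g₁ g₂) {α : Type*} {m : MeasurableSpace α} {μ : Measure α}
    [IsProbabilityMeasure μ] {Z : α → ℝ} (hZ : MemLp Z (ENNReal.ofReal (2 + δ)) μ) :
    Integrable (fun ω => g₂ (Z ω)) μ := by
  have i3 := integrable_abs_rpow (q := δ) hδ0.le (by linarith) hZ
  refine Integrable.mono' ((integrable_const |g₂ 0|).add i3)
    ((hg.continuous_two hδ0).comp_aestronglyMeasurable hZ.1) (.of_forall fun ω => ?_)
  exact hg.abs_two_le (Z ω)

theorem HolderJet.integrable_one_comp {δ : ℝ} (hδ0 : 0 < δ) {g g₁ g₂ : ℝ → ℝ}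
    (hg : HolderJet δ g g₁ g₂) {α : Type*} {m : MeasurableSpace α} {μ : Measure α}
    [IsProbabilityMeasure μ] {Z : α → ℝ} (hZ : MemLp Z (ENNReal.ofReal (2 + δ)) μ) :
    Integrable (fun ω => g₁ (Z ω)) μ := by
  have i1 := integrable_abs_rpow (q := 1) zero_le_one (by linarith) hZ
  have i3 := integrable_abs_rpow (q := 1 + δ) (by linarith) (by linarith) hZ
  simp only [Real.rpow_one] at i1
  refine Integrable.mono' (((integrable_const |g₁ 0|).add (i1.const_mul |g₂ 0|)).add i3)
    ((hg.continuous_one hδ0).comp_aestronglyMeasurable hZ.1) (.of_forall fun ω => ?_)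
  exact hg.abs_one_le (Z ω)

/-! ### Test functions adapted to an open set -/

/-- The last point of the complement of `U` at the left of `t`. -/
noncomputable def leftEnd (U : Set ℝ) (t : ℝ) : ℝ := sSup {s | s ∉ U ∧ s ≤ t}

/-- The first point of the complement of `U` at the right of `t`. -/
noncomputable def rightEnd (U : Set ℝ) (t : ℝ) : ℝ := sInf {s | s ∉ U ∧ t ≤ s}

/-- A smooth substitute for the distance to the complement of `U`: on a component `(a, b)` of `U`
it is `(t - a) (b - t) / (b - a)`. -/
noncomputable def gapDist (U : Set ℝ) (t : ℝ) : ℝ :=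
  (t - leftEnd U t) * (rightEnd U t - t) / (rightEnd U t - leftEnd U t)

/-- The slope of `gapDist`. -/
noncomputable def gapSlope (U : Set ℝ) (t : ℝ) : ℝ :=
  (leftEnd U t + rightEnd U t - 2 * t) / (rightEnd U t - leftEnd U t)

section Gap

variable {U : Set ℝ} {R : ℝ}

theorem leftEnd_mem (hU : IsOpen U) (hR : U ⊆ Set.Ioo (-R) R) (t : ℝ) :
    leftEnd U t ∉ U ∧ leftEnd U t ≤ t := by
  have hcl : IsClosed {s | s ∉ U ∧ s ≤ t} := hU.isClosed_compl.inter isClosed_Iic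
  refine hcl.csSup_mem ⟨min t (-R), fun h => ?_, min_le_left _ _⟩ ⟨t, fun s hs => hs.2⟩
  exact absurd (hR h).1 (not_lt.2 (min_le_right _ _))

theorem rightEnd_mem (hU : IsOpen U) (hR : U ⊆ Set.Ioo (-R) R) (t : ℝ) :
    rightEnd U t ∉ U ∧ t ≤ rightEnd U t := by
  have hcl : IsClosed {s | s ∉ U ∧ t ≤ s} := hU.isClosed_compl.inter isClosed_Ici
  refine hcl.csInf_mem ⟨max t R, fun h => ?_, le_max_left _ _⟩ ⟨t, fun s hs => hs.2⟩
  exact absurd (hR h).2 (not_lt.2 (le_max_right _ _))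

theorem le_leftEnd {s t : ℝ} (hs : s ∉ U) (hst : s ≤ t) : s ≤ leftEnd U t :=
  le_csSup ⟨t, fun _ h => h.2⟩ ⟨hs, hst⟩

theorem rightEnd_le {s t : ℝ} (hs : s ∉ U) (hst : t ≤ s) : rightEnd U t ≤ s :=
  csInf_le ⟨t, fun _ h => h.2⟩ ⟨hs, hst⟩

theorem leftEnd_le_of_Ioo (hU : IsOpen U) (hR : U ⊆ Set.Ioo (-R) R) {x y t : ℝ}
    (h : Set.Ioo x y ⊆ U) (ht : t ∈ Set.Ioo x y) : leftEnd U t ≤ x := by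
  by_contra! hc
  have := leftEnd_mem hU hR t
  exact this.1 (h ⟨hc, this.2.trans_lt ht.2⟩)

theorem le_rightEnd_of_Ioo (hU : IsOpen U) (hR : U ⊆ Set.Ioo (-R) R) {x y t : ℝ}
    (h : Set.Ioo x y ⊆ U) (ht : t ∈ Set.Ioo x y) : y ≤ rightEnd U t := by
  by_contra! hc
  have := rightEnd_mem hU hR t
  exact this.1 (h ⟨ht.1.trans_le this.2, hc⟩)

theorem Ioo_ends_subset (U : Set ℝ) (t : ℝ) :
    ∀ s, s ∈ Set.Ioo (leftEnd U t) (rightEnd U t) → s ∈ U := by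
  intro s hs
  by_contra hn
  rcases le_total s t with h | h
  · exact absurd (le_leftEnd hn h) (not_le.2 hs.1)
  · exact absurd (rightEnd_le hn h) (not_le.2 hs.2)

theorem ends_of_mem (hU : IsOpen U) (hR : U ⊆ Set.Ioo (-R) R) {t : ℝ} (ht : t ∈ U) :
    leftEnd U t < t ∧ t < rightEnd U t := by
  have h1 := leftEnd_mem hU hR t
  have h2 := rightEnd_mem hU hR t
  refine ⟨lt_of_le_of_ne h1.2 fun h => h1.1 ?_, lt_of_le_of_ne h2.2 fun h => h2.1 ?_⟩
  · rwa [h]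
  · rwa [← h]

theorem ends_eq (hU : IsOpen U) (hR : U ⊆ Set.Ioo (-R) R) {s t : ℝ}
    (hs : s ∈ Set.Ioo (leftEnd U t) (rightEnd U t)) :
    leftEnd U s = leftEnd U t ∧ rightEnd U s = rightEnd U t := by
  have hsub := Ioo_ends_subset U t
  exact ⟨le_antisymm (leftEnd_le_of_Ioo hU hR hsub hs)
    (le_leftEnd (leftEnd_mem hU hR t).1 hs.1.le),
    le_antisymm (rightEnd_le (rightEnd_mem hU hR t).1 hs.2.le)
    (le_rightEnd_of_Ioo hU hR hsub hs)⟩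

theorem gapDist_of_notMem (hU : IsOpen U) (hR : U ⊆ Set.Ioo (-R) R) {t : ℝ} (ht : t ∉ U) :
    gapDist U t = 0 := by
  have : leftEnd U t = t := le_antisymm (leftEnd_mem hU hR t).2 (le_leftEnd ht le_rfl)
  simp [gapDist, this]

theorem gapDist_nonneg (hU : IsOpen U) (hR : U ⊆ Set.Ioo (-R) R) (t : ℝ) : 0 ≤ gapDist U t := by
  have h1 := (leftEnd_mem hU hR t).2
  have h2 := (rightEnd_mem hU hR t).2
  exact div_nonneg (mul_nonneg (by linarith) (by linarith)) (by linarith)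

/-- On a component (a, b), each of (t - a)/(b - a) and (b - t)/(b - a) is at most 1, so the value is
at most the distance to either end; any point off U lies beyond one of them. -/
theorem gapDist_le_abs (hU : IsOpen U) (hR : U ⊆ Set.Ioo (-R) R) {s t : ℝ} (hs : s ∉ U) :
    gapDist U t ≤ |t - s| := by
  by_cases ht : t ∈ U
  swap
  · rw [gapDist_of_notMem hU hR ht]; positivity
  obtain ⟨h1, h2⟩ := ends_of_mem hU hR ht
  have hpos : 0 < rightEnd U t - leftEnd U t := by linarith
  rw [gapDist, div_le_iff₀ hpos]
  rcases le_total s t with h | h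
  · have := le_leftEnd hs h
    rw [abs_of_nonneg (by linarith)]
    exact mul_le_mul (by linarith) (by linarith) (by linarith) (by linarith)
  · have := rightEnd_le hs h
    rw [abs_of_nonpos (by linarith), mul_comm (t - _)]
    exact mul_le_mul (by linarith) (by linarith) (by linarith) (by linarith)

/-- For p, q ≥ 2d one has pq/(p + q) ≥ min(p, q)/2 ≥ d, with p and q the distances from t to the
ends of its component. -/
theorem le_gapDist (hU : IsOpen U) (hR : U ⊆ Set.Ioo (-R) R) {x y t d : ℝ} (hd : 0 ≤ d)
    (h : Set.Ioo x y ⊆ U) (ht : t ∈ Set.Ioo x y) (hx : 2 * d ≤ t - x) (hy : 2 * d ≤ y - t) :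
    d ≤ gapDist U t := by
  have h1 := leftEnd_le_of_Ioo hU hR h ht
  have h2 := le_rightEnd_of_Ioo hU hR h ht
  have hpos : 0 < rightEnd U t - leftEnd U t := by linarith [ht.1, ht.2]
  rw [gapDist, le_div_iff₀ hpos]
  nlinarith

theorem abs_gapSlope_le (hU : IsOpen U) (hR : U ⊆ Set.Ioo (-R) R) (t : ℝ) :
    |gapSlope U t| ≤ 1 := by
  have h1 := (leftEnd_mem hU hR t).2
  have h2 := (rightEnd_mem hU hR t).2
  rw [gapSlope, abs_div, abs_of_nonneg (by linarith : 0 ≤ rightEnd U t - leftEnd U t)]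
  refine div_le_one_of_le₀ (abs_le.2 ⟨by linarith, by linarith⟩) (by linarith)

theorem abs_rpow_sub_rpow_le {x y δ : ℝ} (hx : 0 ≤ x) (hy : 0 ≤ y) (hδ0 : 0 ≤ δ) (hδ1 : δ ≤ 1) :
    |x ^ δ - y ^ δ| ≤ |x - y| ^ δ := by
  wlog h : y ≤ x generalizing x y
  · rw [abs_sub_comm, abs_sub_comm x]
    exact this hy hx (le_of_not_ge h)
  have := Real.rpow_add_le_add_rpow (sub_nonneg.2 h) hy hδ0 hδ1
  rw [sub_add_cancel] at this
  rw [abs_of_nonneg (sub_nonneg.2 (Real.rpow_le_rpow hy h hδ0)), abs_of_nonneg (sub_nonneg.2 h)]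
  linarith

/-- Inside U the ends of the component are locally constant and the formula can be differentiated.
At a point t off U, `gapDist` at t + h is at most |h|, so its power 1 + δ is o(h). -/
theorem hasDerivAt_gapDist_rpow (hU : IsOpen U) (hR : U ⊆ Set.Ioo (-R) R) {δ : ℝ} (hδ0 : 0 < δ)
    (t : ℝ) : HasDerivAt (fun s => gapDist U s ^ (1 + δ))
      ((1 + δ) * gapDist U t ^ δ * gapSlope U t) t := by
  by_cases ht : t ∈ U
  · obtain ⟨h1, h2⟩ := ends_of_mem hU hR ht
    have hpos : rightEnd U t - leftEnd U t ≠ 0 := by linarith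
    have hd : HasDerivAt (fun s => (s - leftEnd U t) * (rightEnd U t - s)
        / (rightEnd U t - leftEnd U t)) (gapSlope U t) t := by
      have := (((hasDerivAt_id t).sub_const (leftEnd U t)).mul
        ((hasDerivAt_id t).const_sub (rightEnd U t))).div_const (rightEnd U t - leftEnd U t)
      refine this.congr_deriv ?_
      simp only [gapSlope, id]
      ring
    have hd2 := hd.rpow_const (p := 1 + δ) (Or.inr (by linarith))
    have heq : (fun s => gapDist U s ^ (1 + δ)) =ᶠ[𝓝 t]
        fun s => ((s - leftEnd U t) * (rightEnd U t - s)
        / (rightEnd U t - leftEnd U t)) ^ (1 + δ) := by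
      filter_upwards [Ioo_mem_nhds h1 h2] with s hs
      obtain ⟨e1, e2⟩ := ends_eq hU hR hs
      rw [gapDist, e1, e2]
    refine (hd2.congr_of_eventuallyEq heq).congr_deriv ?_
    rw [gapDist]
    simp only [add_sub_cancel_left]
    ring
  · rw [gapDist_of_notMem hU hR ht, Real.zero_rpow hδ0.ne', mul_zero, zero_mul,
      hasDerivAt_iff_isLittleO_nhds_zero]
    rw [gapDist_of_notMem hU hR ht, Real.zero_rpow (by linarith)]
    simp only [smul_zero, sub_zero]
    refine Asymptotics.isLittleO_iff.2 fun c hc => ?_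
    have := (tendsto_abs_rpow_zero hδ0).eventually (gt_mem_nhds hc)
    filter_upwards [this] with h hh
    have hle : gapDist U (t + h) ≤ |h| := by simpa using gapDist_le_abs hU hR (t := t + h) ht
    have h0 := gapDist_nonneg hU hR (t + h)
    rw [Real.norm_of_nonneg (Real.rpow_nonneg h0 _), Real.norm_eq_abs]
    calc gapDist U (t + h) ^ (1 + δ) ≤ |h| ^ (1 + δ) :=
          Real.rpow_le_rpow h0 hle (by linarith)
      _ = |h| ^ δ * |h| := by
          rw [add_comm, Real.rpow_add_one' (abs_nonneg _) (by linarith)]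
      _ ≤ c * |h| := by gcongr

/-- If a point off U separates s and t, each term is at most 2|s - t|^δ. Otherwise both lie in one
component, of length L ≥ |s - t|: the power of `gapDist` varies by at most |s - t|^δ, and the slope
by 2|s - t|/L, which is multiplied by at most L^δ. Together this is 3(1 + δ)|s - t|^δ, whence the 6.
-/
theorem gapSlope_holder (hU : IsOpen U) (hR : U ⊆ Set.Ioo (-R) R) {δ : ℝ} (hδ0 : 0 < δ)
    (hδ1 : δ ≤ 1) (s t : ℝ) :
    |(1 + δ) * gapDist U s ^ δ * gapSlope U s - (1 + δ) * gapDist U t ^ δ * gapSlope U t|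
      ≤ 6 * |s - t| ^ δ := by
  have key : ∀ e, e ∉ U → ∀ r, |(1 + δ) * gapDist U r ^ δ * gapSlope U r| ≤ 2 * |r - e| ^ δ := by
    intro e he r
    have h0 := gapDist_nonneg hU hR r
    rw [abs_mul, abs_of_nonneg (by positivity)]
    calc (1 + δ) * gapDist U r ^ δ * |gapSlope U r|
        ≤ (1 + δ) * gapDist U r ^ δ * 1 := by
          gcongr
          exact abs_gapSlope_le hU hR r
      _ ≤ 2 * |r - e| ^ δ := by
          rw [mul_one]
          gcongr
          · linarith
          · exact gapDist_le_abs hU hR he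
  wlog hst : s ≤ t generalizing s t
  · rw [abs_sub_comm, abs_sub_comm s]
    exact this t s (le_of_not_ge hst)
  by_cases hE : ∃ e, e ∉ U ∧ s ≤ e ∧ e ≤ t
  · obtain ⟨e, he, h1, h2⟩ := hE
    have k1 := key e he s
    have k2 := key e he t
    have m1 : |s - e| ^ δ ≤ |s - t| ^ δ := by
      refine Real.rpow_le_rpow (abs_nonneg _) ?_ hδ0.le
      rw [abs_of_nonpos (by linarith), abs_of_nonpos (by linarith)]; linarith
    have m2 : |t - e| ^ δ ≤ |s - t| ^ δ := by
      refine Real.rpow_le_rpow (abs_nonneg _) ?_ hδ0.le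
      rw [abs_of_nonneg (by linarith), abs_of_nonpos (by linarith)]; linarith
    have := abs_sub ((1 + δ) * gapDist U s ^ δ * gapSlope U s)
      ((1 + δ) * gapDist U t ^ δ * gapSlope U t)
    have hn : 0 ≤ |s - t| ^ δ := by positivity
    linarith
  · push Not at hE
    have hs : s ∈ U := by
      by_contra h
      exact absurd (hE s h le_rfl) (not_lt.2 hst)
    obtain ⟨a1, b1⟩ := ends_of_mem hU hR hs
    have hb : t < rightEnd U s := hE _ (rightEnd_mem hU hR s).1 b1.le
    obtain ⟨e1, e2⟩ := ends_eq hU hR (s := t) (t := s) ⟨a1.trans_le hst, hb⟩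
    have hDs := gapDist_nonneg hU hR s
    have hDt := gapDist_nonneg hU hR t
    have hDL : gapDist U t ≤ rightEnd U s - leftEnd U s := by
      refine (gapDist_le_abs hU hR (leftEnd_mem hU hR s).1).trans ?_
      rw [abs_of_nonneg (by linarith)]; linarith
    set L := rightEnd U s - leftEnd U s with hL
    have hLpos : 0 < L := by linarith
    have hdd : |gapDist U s - gapDist U t| ≤ |s - t| := by
      have : gapDist U s - gapDist U t
          = (s - t) * ((leftEnd U s + rightEnd U s - s - t) / L) := by
        rw [gapDist, gapDist, e1, e2, ← hL]
        field_simp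
        ring
      rw [this, abs_mul]
      refine mul_le_of_le_one_right (abs_nonneg _) ?_
      rw [abs_div, abs_of_pos hLpos]
      exact div_le_one_of_le₀ (abs_le.2 ⟨by linarith, by linarith⟩) hLpos.le
    have hss : |gapSlope U s - gapSlope U t| ≤ 2 * (|s - t| / L) := by
      have : gapSlope U s - gapSlope U t = 2 * ((t - s) / L) := by
        rw [gapSlope, gapSlope, e1, e2, ← hL]
        field_simp
        ring
      rw [this, abs_mul, abs_div, abs_of_pos hLpos, abs_sub_comm t s]
      simp
    have hr1 : |s - t| / L ≤ 1 := by
      refine div_le_one_of_le₀ ?_ hLpos.le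
      rw [abs_of_nonpos (by linarith)]; linarith
    have hr : |s - t| / L ≤ (|s - t| / L) ^ δ := by
      refine Real.self_le_rpow_of_le_one (by positivity) hr1 hδ1
    have hfin : gapDist U t ^ δ * |gapSlope U s - gapSlope U t| ≤ 2 * |s - t| ^ δ := by
      calc gapDist U t ^ δ * |gapSlope U s - gapSlope U t|
          ≤ L ^ δ * (2 * (|s - t| / L) ^ δ) := by
            gcongr
            linarith
        _ = 2 * |s - t| ^ δ := by
            rw [Real.div_rpow (abs_nonneg _) hLpos.le]
            have : L ^ δ ≠ 0 := by positivity
            field_simp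
    have hfin2 : |gapDist U s ^ δ - gapDist U t ^ δ| * |gapSlope U s| ≤ |s - t| ^ δ := by
      calc _ ≤ |gapDist U s ^ δ - gapDist U t ^ δ| * 1 := by
            gcongr
            exact abs_gapSlope_le hU hR s
        _ ≤ |gapDist U s - gapDist U t| ^ δ := by
            rw [mul_one]
            exact abs_rpow_sub_rpow_le hDs hDt hδ0.le hδ1
        _ ≤ |s - t| ^ δ := by gcongr
    have e : (1 + δ) * gapDist U s ^ δ * gapSlope U s - (1 + δ) * gapDist U t ^ δ * gapSlope U t
        = (1 + δ) * ((gapDist U s ^ δ - gapDist U t ^ δ) * gapSlope U s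
          + gapDist U t ^ δ * (gapSlope U s - gapSlope U t)) := by ring
    rw [e, abs_mul, abs_of_nonneg (by linarith)]
    calc _ ≤ 2 * (|s - t| ^ δ + 2 * |s - t| ^ δ) := by
          gcongr
          · linarith
          · refine (abs_add_le _ _).trans (add_le_add ?_ ?_)
            · rw [abs_mul]; exact hfin2
            · rw [abs_mul, abs_of_nonneg (Real.rpow_nonneg hDt _)]; exact hfin
      _ = 6 * |s - t| ^ δ := by ring

/-- For a bounded open set `U` avoiding `0` there is a Zolotarev test function which is constant
off `U` and increases at least like a multiple of `(y - x) ^ (2 + δ)` on each interval of `U`. -/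
theorem exists_zolClass_increasing (hU : IsOpen U) (hR : U ⊆ Set.Ioo (-R) R) (h0 : (0 : ℝ) ∉ U)
    {δ : ℝ} (hδ0 : 0 < δ) (hδ1 : δ ≤ 1) :
    ∃ f ∈ ZolClass (2 + δ), Monotone f ∧
      (∀ x y, x ≤ y → (∀ z ∈ Set.Ioo x y, z ∉ U) → f y = f x) ∧
      ∀ x y, x ≤ y → Set.Ioo x y ⊆ U → (y - x) ^ (2 + δ) / 1000 ≤ f y - f x := by
  set φ : ℝ → ℝ := fun t => gapDist U t ^ (1 + δ) with hφ
  have hφd := hasDerivAt_gapDist_rpow hU hR hδ0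
  have hφc : Continuous φ := continuous_iff_continuousAt.2 fun t => (hφd t).continuousAt
  -- The factor 6 is the Hölder constant of φ', so f'' is δ-Hölder with constant 1. Starting the
  -- integral at 0, a point off U, makes f, f' and f'' vanish there.
  set f : ℝ → ℝ := fun t => (∫ s in (0 : ℝ)..t, φ s) / 6 with hf
  have hfd : ∀ t, HasDerivAt f (φ t / 6) t := fun t =>
    (intervalIntegral.integral_hasDerivAt_right (hφc.intervalIntegrable _ _)
      hφc.aestronglyMeasurable.stronglyMeasurableAtFilter hφc.continuousAt).div_const 6
  have hφ0 : ∀ t, 0 ≤ φ t := fun t => Real.rpow_nonneg (gapDist_nonneg hU hR t) _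
  have hdiff : Differentiable ℝ f := fun t => (hfd t).differentiableAt
  have hder : ∀ t, deriv f t = φ t / 6 := fun t => (hfd t).deriv
  have hmono : Monotone f := monotone_of_deriv_nonneg hdiff fun t => by
    rw [hder]; exact div_nonneg (hφ0 t) (by norm_num)
  refine ⟨f, ?_, hmono, ?_, ?_⟩
  · refine mem_zolClass_of_hasDerivAt hδ0 hδ1 hfd (fun x => (hφd x).div_const 6)
      (fun x y => ?_) ?_ ?_ ?_
    · rw [← sub_div, abs_div, abs_of_pos (by norm_num : (0 : ℝ) < 6), div_le_iff₀ (by norm_num),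
        mul_comm (|x - y| ^ δ)]
      exact gapSlope_holder hU hR hδ0 hδ1 x y
    · simp [hf]
    · simp [hφ, gapDist_of_notMem hU hR h0, Real.zero_rpow (by linarith : 1 + δ ≠ 0)]
    · simp [gapDist_of_notMem hU hR h0, Real.zero_rpow hδ0.ne']
  · intro x y hxy hz
    have := (convex_Icc x y).image_sub_le_mul_sub_of_deriv_le (f := f) (C := 0)
      hdiff.continuous.continuousOn hdiff.differentiableOn
      (fun z hz' => by
        rw [interior_Icc] at hz'
        rw [hder, hφ]
        simp [gapDist_of_notMem hU hR (hz z hz'), Real.zero_rpow (by linarith : 1 + δ ≠ 0)])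
      x (Set.left_mem_Icc.2 hxy) y (Set.right_mem_Icc.2 hxy) hxy
    linarith [hmono hxy]
  · intro x y hxy hsub
    set h := y - x with hh
    have hh0 : 0 ≤ h := by linarith
    have hm : x + h / 4 ≤ y - h / 4 := by linarith
    -- On the middle half of (x, y) the ends are at distance at least h/4 = 2(h/8), so `gapDist` is
    -- at least h/8. The increase there is at least (h/8)^{1+δ}/6 · h/2 ≥ h^{2+δ}/768, since 8^{1+δ}
    -- ≤ 64.
    have := (convex_Icc (x + h / 4) (y - h / 4)).mul_sub_le_image_sub_of_le_deriv (f := f)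
      (C := (h / 8) ^ (1 + δ) / 6)
      hdiff.continuous.continuousOn hdiff.differentiableOn
      (fun z hz' => by
        rw [interior_Icc] at hz'
        rw [hder]
        gcongr
        refine Real.rpow_le_rpow (by positivity) ?_ (by linarith)
        have hz1 := hz'.1
        have hz2 := hz'.2
        refine le_gapDist hU hR (by positivity) hsub ⟨by linarith, by linarith⟩ ?_ ?_
        · linarith
        · linarith)
      _ (Set.left_mem_Icc.2 hm) _ (Set.right_mem_Icc.2 hm) hm
    have m1 := hmono (by linarith : x ≤ x + h / 4)
    have m2 := hmono (by linarith : y - h / 4 ≤ y)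
    refine le_trans ?_ (this.trans (by linarith))
    have e1 : y - h / 4 - (x + h / 4) = h / 2 := by rw [hh]; ring
    have e2 : h ^ (2 + δ) = h ^ (1 + δ) * h := by
      rw [show 2 + δ = (1 + δ) + 1 by ring, Real.rpow_add_one' hh0 (by linarith)]
    have e3 : h ^ (1 + δ) / 64 ≤ (h / 8) ^ (1 + δ) := by
      rw [Real.div_rpow hh0 (by norm_num)]
      have : (8 : ℝ) ^ (1 + δ) ≤ 64 := by
        calc (8 : ℝ) ^ (1 + δ) ≤ 8 ^ (2 : ℝ) :=
              Real.rpow_le_rpow_of_exponent_le (by norm_num) (by linarith)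
          _ = 64 := by norm_num
      gcongr
    rw [e1, e2]
    have hp : 0 ≤ h ^ (1 + δ) := by positivity
    nlinarith [mul_le_mul_of_nonneg_right e3 hh0, mul_nonneg hp hh0]

end Gap

/-! ### The quantile coupling and the comparison of `W_{2+δ}` with `ζ_{2+δ}` -/

/-- The quantile function of a law on the line. -/
noncomputable def quantile (ν : Measure ℝ) (u : ℝ) : ℝ := sInf {x | u ≤ cdf ν x}

/-- Right continuity of the distribution function makes the infimum attained. The restriction to 0 <
u < 1 makes the set bounded below and nonempty. -/
theorem quantile_le_iff (ν : Measure ℝ) {u : ℝ} (hu : u ∈ Set.Ioo (0 : ℝ) 1)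
    (x : ℝ) : quantile ν u ≤ x ↔ u ≤ cdf ν x := by
  have hbdd : BddBelow {x | u ≤ cdf ν x} := by
    obtain ⟨a, ha⟩ := ((tendsto_cdf_atBot ν).eventually (gt_mem_nhds hu.1)).exists
    refine ⟨a, fun y hy => ?_⟩
    by_contra! hlt
    exact absurd (hy.trans (monotone_cdf ν hlt.le)) (not_le.2 ha)
  have hne : {x | u ≤ cdf ν x}.Nonempty :=
    (((tendsto_cdf_atTop ν).eventually (lt_mem_nhds hu.2)).mono fun _ h => h.le).exists
  refine ⟨fun h => ?_, fun h => csInf_le hbdd h⟩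
  refine le_trans ?_ (monotone_cdf ν h)
  have hc : Tendsto (cdf ν) (𝓝[>] (quantile ν u)) (𝓝 (cdf ν (quantile ν u))) :=
    ((cdf ν).right_continuous _).mono_left (nhdsWithin_mono _ Set.Ioi_subset_Ici_self)
  refine ge_of_tendsto hc ?_
  filter_upwards [self_mem_nhdsWithin] with y hy
  obtain ⟨z, hz, hzy⟩ := exists_lt_of_csInf_lt hne hy
  exact le_trans hz (monotone_cdf ν hzy.le)

theorem aemeasurable_quantile (ν : Measure ℝ) :
    AEMeasurable (quantile ν) (volume.restrict (Set.Ioo (0 : ℝ) 1)) := by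
  refine aemeasurable_restrict_of_monotoneOn measurableSet_Ioo fun u hu v hv huv => ?_
  rw [quantile_le_iff ν hu]
  exact huv.trans ((quantile_le_iff ν hv _).1 le_rfl)

theorem map_quantile (ν : Measure ℝ) [IsProbabilityMeasure ν] :
    (volume.restrict (Set.Ioo (0 : ℝ) 1)).map (quantile ν) = ν := by
  have : IsFiniteMeasure ((volume.restrict (Set.Ioo (0 : ℝ) 1)).map (quantile ν)) := by
    infer_instance
  refine Measure.ext_of_Iic _ _ fun x => ?_
  rw [Measure.map_apply_of_aemeasurable (aemeasurable_quantile ν) measurableSet_Iic,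
    Measure.restrict_apply' measurableSet_Ioo]
  have h1 : quantile ν ⁻¹' Set.Iic x ∩ Set.Ioo (0 : ℝ) 1
      = Set.Iic (cdf ν x) ∩ Set.Ioo (0 : ℝ) 1 := by
    ext u
    simp only [Set.mem_inter_iff, Set.mem_preimage, Set.mem_Iic]
    exact ⟨fun h => ⟨(quantile_le_iff ν h.2 x).1 h.1, h.2⟩,
      fun h => ⟨(quantile_le_iff ν h.2 x).2 h.1, h.2⟩⟩
  have h2 : volume (Set.Iic (cdf ν x) ∩ Set.Ioo (0 : ℝ) 1)
      = volume (Set.Iic (cdf ν x) ∩ Set.Ioc (0 : ℝ) 1) :=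
    measure_congr ((ae_eq_refl _).inter Ioo_ae_eq_Ioc)
  have h3 : Set.Iic (cdf ν x) ∩ Set.Ioc (0 : ℝ) 1 = Set.Ioc 0 (cdf ν x) := by
    ext u
    simp only [Set.mem_inter_iff, Set.mem_Iic, Set.mem_Ioc]
    have := cdf_le_one ν x
    constructor
    · rintro ⟨a, b, c⟩; exact ⟨b, a⟩
    · rintro ⟨a, b⟩; exact ⟨b, a, b.trans this⟩
  rw [h1, h2, h3, Real.volume_Ioc, sub_zero, ofReal_cdf]

/-- The comonotone coupling. -/
noncomputable def quantileCoupling (ν₁ ν₂ : Measure ℝ) : Measure (ℝ × ℝ) :=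
  (volume.restrict (Set.Ioo (0 : ℝ) 1)).map fun u => (quantile ν₁ u, quantile ν₂ u)

theorem map_fst_quantileCoupling (ν₁ ν₂ : Measure ℝ) [IsProbabilityMeasure ν₁] :
    (quantileCoupling ν₁ ν₂).map Prod.fst = ν₁ := by
  rw [quantileCoupling, AEMeasurable.map_map_of_aemeasurable measurable_fst.aemeasurable
    ((aemeasurable_quantile ν₁).prodMk (aemeasurable_quantile ν₂))]
  exact map_quantile ν₁

theorem map_snd_quantileCoupling (ν₁ ν₂ : Measure ℝ) [IsProbabilityMeasure ν₂] :
    (quantileCoupling ν₁ ν₂).map Prod.snd = ν₂ := by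
  rw [quantileCoupling, AEMeasurable.map_map_of_aemeasurable measurable_snd.aemeasurable
    ((aemeasurable_quantile ν₁).prodMk (aemeasurable_quantile ν₂))]
  exact map_quantile ν₂

/-- A point t strictly between the two quantiles satisfies F₂(t) < u ≤ F₁(t). The open set on the
right does not depend on u, so one test function serves all u at once. -/
theorem Ioo_quantile_subset (ν₁ ν₂ : Measure ℝ) {u : ℝ} (hu : u ∈ Set.Ioo (0 : ℝ) 1) :
    Set.Ioo (quantile ν₁ u) (quantile ν₂ u) ⊆ interior {t | cdf ν₂ t < cdf ν₁ t} := by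
  refine interior_maximal (fun t ht => ?_) isOpen_Ioo
  have h1 := (quantile_le_iff ν₁ hu t).1 ht.1.le
  have h2 : ¬ u ≤ cdf ν₂ t := fun h => absurd ((quantile_le_iff ν₂ hu t).2 h) (not_le.2 ht.2)
  exact (not_le.1 h2).trans_le h1

/-- Handles intervals across the origin, which has to be removed from U because test functions
vanish there to second order. The longer of the two pieces has at least half the length, and 2^p ≤
8. -/
theorem rpow_sub_le_of_split {f : ℝ → ℝ} {p x y c : ℝ} (hp0 : 0 ≤ p) (hp : p ≤ 3) (hc : 0 ≤ c)
    (hf : Monotone f) (hx : x ≤ 0) (hy : 0 ≤ y) (h1 : c * (0 - x) ^ p ≤ f 0 - f x)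
    (h2 : c * (y - 0) ^ p ≤ f y - f 0) : c * (y - x) ^ p ≤ 8 * (f y - f x) := by
  have key : ∀ m, 0 ≤ m → y - x ≤ 2 * m → (y - x) ^ p ≤ 8 * m ^ p := by
    intro m hm hle
    calc (y - x) ^ p ≤ (2 * m) ^ p := Real.rpow_le_rpow (by linarith) hle hp0
      _ = 2 ^ p * m ^ p := Real.mul_rpow (by norm_num) hm
      _ ≤ 2 ^ (3 : ℝ) * m ^ p := by
          gcongr
          norm_num
      _ = 8 * m ^ p := by norm_num
  have m1 := hf hx
  have m2 := hf hy
  rcases le_total (0 - x) (y - 0) with h | h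
  · have := mul_le_mul_of_nonneg_left (key (y - 0) (by linarith) (by linarith)) hc
    linarith
  · have := mul_le_mul_of_nonneg_left (key (0 - x) (by linarith) (by linarith)) hc
    linarith

/-- If `(x, y)` minus the origin lies in `U`, the test function attached to `U` increases enough
on `(x, y)`. -/
theorem rpow_le_of_Ioo_subset {U : Set ℝ} {f : ℝ → ℝ} {p : ℝ} (hp0 : 0 ≤ p) (hp : p ≤ 3)
    (hf : Monotone f) (hU : ∀ x y, x ≤ y → Set.Ioo x y ⊆ U → (y - x) ^ p / 1000 ≤ f y - f x)
    {x y : ℝ} (hxy : x ≤ y) (h : Set.Ioo x y \ {0} ⊆ U) :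
    (y - x) ^ p ≤ 8000 * (f y - f x) := by
  have hmono := hf hxy
  by_cases h0 : (0 : ℝ) ∈ Set.Ioo x y
  · have h1 := hU x 0 h0.1.le fun z hz => h ⟨⟨hz.1, hz.2.trans h0.2⟩, hz.2.ne⟩
    have h2 := hU 0 y h0.2.le fun z hz => h ⟨⟨h0.1.trans hz.1, hz.2⟩, hz.1.ne'⟩
    have := rpow_sub_le_of_split (c := 1 / 1000) hp0 hp (by norm_num) hf h0.1.le h0.2.le
      (by linarith) (by linarith)
    linarith
  · have := hU x y hxy fun z hz => h ⟨hz, fun hz0 => h0 (by rwa [← Set.mem_singleton_iff.1 hz0])⟩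
    linarith

/-- Restricting to a box keeps U and V bounded, so that test functions exist; these depend on R, but
the constant does not, which later allows R to tend to infinity. -/
theorem lintegral_box_quantileCoupling_le {δ : ℝ} (hδ0 : 0 < δ) (hδ1 : δ ≤ 1)
    (ν₁ ν₂ : Measure ℝ) [IsProbabilityMeasure ν₁] [IsProbabilityMeasure ν₂]
    (h₁ : MemLp id (ENNReal.ofReal (2 + δ)) ν₁) (h₂ : MemLp id (ENNReal.ofReal (2 + δ)) ν₂)
    (R : ℝ) :
    ∫⁻ z in {z : ℝ × ℝ | -R < z.1 ∧ z.1 < R ∧ -R < z.2 ∧ z.2 < R},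
      ‖z.1 - z.2‖ₑ ^ (2 + δ) ∂(quantileCoupling ν₁ ν₂) ≤ 16000 * zolotarev (2 + δ) ν₁ ν₂ := by
  set π := quantileCoupling ν₁ ν₂ with hπ
  set S := {z : ℝ × ℝ | -R < z.1 ∧ z.1 < R ∧ -R < z.2 ∧ z.2 < R} with hS
  set U := (interior {t | cdf ν₂ t < cdf ν₁ t} ∩ Set.Ioo (-R) R) \ {0} with hU
  set V := (interior {t | cdf ν₁ t < cdf ν₂ t} ∩ Set.Ioo (-R) R) \ {0} with hV
  have hUo : IsOpen U := (isOpen_interior.inter isOpen_Ioo).sdiff isClosed_singleton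
  have hVo : IsOpen V := (isOpen_interior.inter isOpen_Ioo).sdiff isClosed_singleton
  obtain ⟨f, hfZ, hfm, hfc, hfi⟩ := exists_zolClass_increasing hUo (R := R)
    (fun x hx => hx.1.2) (by simp [hU]) hδ0 hδ1
  obtain ⟨g, hgZ, hgm, hgc, hgi⟩ := exists_zolClass_increasing hVo (R := R)
    (fun x hx => hx.1.2) (by simp [hV]) hδ0 hδ1
  have hfst : π.map Prod.fst = ν₁ := map_fst_quantileCoupling ν₁ ν₂
  have hsnd : π.map Prod.snd = ν₂ := map_snd_quantileCoupling ν₁ ν₂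
  have hprob : IsProbabilityMeasure π := by
    constructor
    rw [← Set.preimage_univ (f := Prod.fst), ← Measure.map_apply measurable_fst .univ, hfst,
      measure_univ]
  have hL1 : MemLp (Prod.fst : ℝ × ℝ → ℝ) (ENNReal.ofReal (2 + δ)) π := by
    rw [← hfst] at h₁
    exact (memLp_map_measure_iff measurable_id.aestronglyMeasurable
      measurable_fst.aemeasurable).1 h₁
  have hL2 : MemLp (Prod.snd : ℝ × ℝ → ℝ) (ENNReal.ofReal (2 + δ)) π := by
    rw [← hsnd] at h₂
    exact (memLp_map_measure_iff measurable_id.aestronglyMeasurable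
      measurable_snd.aemeasurable).1 h₂
  have hfj := (holderJet_of_mem_zolClass hδ0 hδ1 hfZ).1
  have hgj := (holderJet_of_mem_zolClass hδ0 hδ1 hgZ).1
  have if1 := hfj.integrable_comp hδ0 hL1
  have if2 := hfj.integrable_comp hδ0 hL2
  have ig1 := hgj.integrable_comp hδ0 hL1
  have ig2 := hgj.integrable_comp hδ0 hL2
  -- Under the coupling, one bracket vanishes and the other is nonnegative, according to the order
  -- of the two quantiles. So k dominates the cost in the box up to 8000, while its integral depends
  -- only on the marginals and is at most twice ζ_{2+δ}.
  set k : ℝ × ℝ → ℝ := fun z => (f z.2 - f z.1) + (g z.1 - g z.2) with hk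
  have hkint : Integrable k π := (if2.sub if1).add (ig1.sub ig2)
  have hdisj : ∀ t ∈ {t | cdf ν₂ t < cdf ν₁ t}, t ∉ V := fun t ht hv => by
    have h := interior_subset hv.1.1
    simp only [Set.mem_ofPred_eq] at h ht
    linarith
  have hdisj2 : ∀ t ∈ {t | cdf ν₁ t < cdf ν₂ t}, t ∉ U := fun t ht hv => by
    have h := interior_subset hv.1.1
    simp only [Set.mem_ofPred_eq] at h ht
    linarith
  have hae : ∀ᵐ z ∂π, 0 ≤ k z ∧ (z ∈ S → |z.1 - z.2| ^ (2 + δ) ≤ 8000 * k z) := by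
    have hkm : Measurable k := by
      have c1 := hfj.continuous hδ0
      have c2 := hgj.continuous hδ0
      have : Continuous k := by fun_prop
      exact this.measurable
    have hSm : MeasurableSet S := by
      refine (measurableSet_lt measurable_const measurable_fst).inter
        ((measurableSet_lt measurable_fst measurable_const).inter
        ((measurableSet_lt measurable_const measurable_snd).inter
        (measurableSet_lt measurable_snd measurable_const)))
    rw [hπ, quantileCoupling, ae_map_iff
      ((aemeasurable_quantile ν₁).prodMk (aemeasurable_quantile ν₂))]
    · filter_upwards [ae_restrict_mem measurableSet_Ioo] with u hu
      simp only [hk, hS, Set.mem_ofPred_eq]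
      set x := quantile ν₁ u
      set y := quantile ν₂ u
      rcases le_total x y with hxy | hxy
      · have hsub : Set.Ioo x y ⊆ interior {t | cdf ν₂ t < cdf ν₁ t} :=
          Ioo_quantile_subset ν₁ ν₂ hu
        have hg0 : g y = g x := hgc x y hxy fun z hz => hdisj z (interior_subset (hsub hz))
        rw [hg0, sub_self, add_zero]
        refine ⟨sub_nonneg.2 (hfm hxy), fun hs => ?_⟩
        rw [abs_sub_comm, abs_of_nonneg (sub_nonneg.2 hxy)]
        refine rpow_le_of_Ioo_subset (by linarith) (by linarith) hfm hfi hxy fun z hz => ?_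
        exact ⟨⟨hsub hz.1, hs.1.trans hz.1.1, hz.1.2.trans hs.2.2.2⟩, hz.2⟩
      · have hsub : Set.Ioo y x ⊆ interior {t | cdf ν₁ t < cdf ν₂ t} :=
          Ioo_quantile_subset ν₂ ν₁ hu
        have hf0 : f x = f y := hfc y x hxy fun z hz => hdisj2 z (interior_subset (hsub hz))
        rw [hf0, sub_self, zero_add]
        refine ⟨sub_nonneg.2 (hgm hxy), fun hs => ?_⟩
        rw [abs_of_nonneg (sub_nonneg.2 hxy)]
        refine rpow_le_of_Ioo_subset (by linarith) (by linarith) hgm hgi hxy fun z hz => ?_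
        exact ⟨⟨hsub hz.1, hs.2.2.1.trans hz.1.1, hz.1.2.trans hs.2.1⟩, hz.2⟩
    · have hE : MeasurableSet {z : ℝ × ℝ | |z.1 - z.2| ^ (2 + δ) ≤ 8000 * k z} :=
        measurableSet_le (by fun_prop) (hkm.const_mul _)
      have : {z : ℝ × ℝ | 0 ≤ k z ∧ (z ∈ S → |z.1 - z.2| ^ (2 + δ) ≤ 8000 * k z)}
          = {z | 0 ≤ k z} ∩ (Sᶜ ∪ {z | |z.1 - z.2| ^ (2 + δ) ≤ 8000 * k z}) := by
        ext z
        simp only [Set.mem_ofPred_eq, Set.mem_union, Set.mem_compl_iff, Set.mem_inter_iff]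
        tauto
      rw [this]
      exact (measurableSet_le measurable_const hkm).inter (hSm.compl.union hE)
  have hki : ∫ z, k z ∂π = (∫ x, f x ∂ν₂ - ∫ x, f x ∂ν₁) + (∫ x, g x ∂ν₁ - ∫ x, g x ∂ν₂) := by
    have e1 : ∀ {φ : ℝ → ℝ}, Continuous φ → ∫ x, φ x ∂ν₁ = ∫ z, φ z.1 ∂π := fun {φ} hφ => by
      conv_lhs => rw [← hfst]
      rw [integral_map measurable_fst.aemeasurable hφ.aestronglyMeasurable]
    have e2 : ∀ {φ : ℝ → ℝ}, Continuous φ → ∫ x, φ x ∂ν₂ = ∫ z, φ z.2 ∂π := fun {φ} hφ => by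
      conv_lhs => rw [← hsnd]
      rw [integral_map measurable_snd.aemeasurable hφ.aestronglyMeasurable]
    rw [e1 (hfj.continuous hδ0), e2 (hfj.continuous hδ0), e1 (hgj.continuous hδ0),
      e2 (hgj.continuous hδ0), ← integral_sub if2 if1, ← integral_sub ig1 ig2]
    exact integral_add (if2.sub if1) (ig1.sub ig2)
  have hz : ∀ {φ : ℝ → ℝ}, φ ∈ ZolClass (2 + δ) →
      ENNReal.ofReal |∫ x, φ x ∂ν₁ - ∫ x, φ x ∂ν₂| ≤ zolotarev (2 + δ) ν₁ ν₂ :=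
    fun {φ} hφ => le_iSup₂ (f := fun f (_ : f ∈ ZolClass (2 + δ)) =>
      ENNReal.ofReal |∫ x, f x ∂ν₁ - ∫ x, f x ∂ν₂|) φ hφ
  have hSm : MeasurableSet S := by
    refine (measurableSet_lt measurable_const measurable_fst).inter
      ((measurableSet_lt measurable_fst measurable_const).inter
      ((measurableSet_lt measurable_const measurable_snd).inter
      (measurableSet_lt measurable_snd measurable_const)))
  calc ∫⁻ z in S, ‖z.1 - z.2‖ₑ ^ (2 + δ) ∂π
      ≤ ∫⁻ z in S, ENNReal.ofReal (8000 * k z) ∂π := by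
        refine lintegral_mono_ae ?_
        rw [ae_restrict_iff' hSm]
        filter_upwards [hae] with z hz hzS
        rw [← ofReal_norm, ENNReal.ofReal_rpow_of_nonneg (norm_nonneg _) (by linarith)]
        exact ENNReal.ofReal_le_ofReal (hz.2 hzS)
    _ ≤ ∫⁻ z, ENNReal.ofReal (8000 * k z) ∂π := setLIntegral_le_lintegral _ _
    _ = ENNReal.ofReal (8000 * ∫ z, k z ∂π) := by
        rw [← integral_const_mul, ofReal_integral_eq_lintegral_ofReal (hkint.const_mul _)]
        filter_upwards [hae] with z hz
        have := hz.1
        simp only [Pi.zero_apply]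
        positivity
    _ ≤ ENNReal.ofReal (8000 * (|∫ x, f x ∂ν₁ - ∫ x, f x ∂ν₂|
          + |∫ x, g x ∂ν₁ - ∫ x, g x ∂ν₂|)) := by
        refine ENNReal.ofReal_le_ofReal ?_
        rw [hki]
        have a1 := neg_abs_le (∫ x, f x ∂ν₁ - ∫ x, f x ∂ν₂)
        have a2 := le_abs_self (∫ x, g x ∂ν₁ - ∫ x, g x ∂ν₂)
        linarith
    _ ≤ 8000 * (zolotarev (2 + δ) ν₁ ν₂ + zolotarev (2 + δ) ν₁ ν₂) := by
        rw [ENNReal.ofReal_mul (by norm_num), ENNReal.ofReal_add (abs_nonneg _) (abs_nonneg _)]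
        gcongr
        · simp
        · exact hz hfZ
        · exact hz hgZ
    _ = 16000 * zolotarev (2 + δ) ν₁ ν₂ := by
        rw [← two_mul, ← mul_assoc]
        norm_num

theorem lintegral_quantileCoupling_le {δ : ℝ} (hδ0 : 0 < δ) (hδ1 : δ ≤ 1)
    (ν₁ ν₂ : Measure ℝ) [IsProbabilityMeasure ν₁] [IsProbabilityMeasure ν₂]
    (h₁ : MemLp id (ENNReal.ofReal (2 + δ)) ν₁) (h₂ : MemLp id (ENNReal.ofReal (2 + δ)) ν₂) :
    ∫⁻ z, ‖z.1 - z.2‖ₑ ^ (2 + δ) ∂(quantileCoupling ν₁ ν₂)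
      ≤ 16000 * zolotarev (2 + δ) ν₁ ν₂ := by
  set S : ℕ → Set (ℝ × ℝ) :=
    fun n => {z : ℝ × ℝ | -(n : ℝ) < z.1 ∧ z.1 < n ∧ -(n : ℝ) < z.2 ∧ z.2 < n} with hS
  have hun : ⋃ n, S n = Set.univ := by
    refine Set.eq_univ_of_forall fun z => Set.mem_iUnion.2 ?_
    obtain ⟨n, hn⟩ := exists_nat_gt (max |z.1| |z.2|)
    have h1 := abs_lt.1 ((le_max_left _ _).trans_lt hn)
    have h2 := abs_lt.1 ((le_max_right _ _).trans_lt hn)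
    exact ⟨n, h1.1, h1.2, h2.1, h2.2⟩
  have hmono : Monotone S := fun m n hmn z hz => by
    have : (m : ℝ) ≤ n := by exact_mod_cast hmn
    obtain ⟨a, b, c, d⟩ := hz
    exact ⟨by linarith, by linarith, by linarith, by linarith⟩
  rw [← setLIntegral_univ, ← hun, setLIntegral_iUnion_of_directed _ hmono.directed_le]
  exact iSup_le fun n => lintegral_box_quantileCoupling_le hδ0 hδ1 ν₁ ν₂ h₁ h₂ n

/-- The `W_{2+δ}` distance to the power `2 + δ` is dominated by the Zolotarev distance. -/
theorem wasserstein_le_zolotarev {δ : ℝ} (hδ0 : 0 < δ) (hδ1 : δ ≤ 1)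
    (ν₁ ν₂ : Measure ℝ) [IsProbabilityMeasure ν₁] [IsProbabilityMeasure ν₂]
    (h₁ : MemLp id (ENNReal.ofReal (2 + δ)) ν₁) (h₂ : MemLp id (ENNReal.ofReal (2 + δ)) ν₂) :
    wasserstein (2 + δ) ν₁ ν₂ ≤ (16000 * zolotarev (2 + δ) ν₁ ν₂) ^ (1 / (2 + δ)) := by
  refine (iInf₂_le (quantileCoupling ν₁ ν₂)
    ⟨map_fst_quantileCoupling ν₁ ν₂, map_snd_quantileCoupling ν₁ ν₂⟩).trans ?_
  exact ENNReal.rpow_le_rpow (lintegral_quantileCoupling_le hδ0 hδ1 ν₁ ν₂ h₁ h₂) (by positivity)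

/-- A bound for the integral of a Lipschitz function against two laws. -/
theorem abs_integral_sub_le_zolotarev {δ : ℝ} (hδ0 : 0 < δ) (hδ1 : δ ≤ 1)
    (ν₁ ν₂ : Measure ℝ) [IsProbabilityMeasure ν₁] [IsProbabilityMeasure ν₂]
    (h₁ : MemLp id (ENNReal.ofReal (2 + δ)) ν₁) (h₂ : MemLp id (ENNReal.ofReal (2 + δ)) ν₂)
    {f : ℝ → ℝ} {L : ℝ≥0} (hf : LipschitzWith L f) :
    ENNReal.ofReal |∫ x, f x ∂ν₁ - ∫ x, f x ∂ν₂|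
      ≤ L * (16000 * zolotarev (2 + δ) ν₁ ν₂) ^ (1 / (2 + δ)) := by
  set π := quantileCoupling ν₁ ν₂ with hπ
  have hfst : π.map Prod.fst = ν₁ := map_fst_quantileCoupling ν₁ ν₂
  have hsnd : π.map Prod.snd = ν₂ := map_snd_quantileCoupling ν₁ ν₂
  have hprob : IsProbabilityMeasure π := by
    constructor
    rw [← Set.preimage_univ (f := Prod.fst), ← Measure.map_apply measurable_fst .univ, hfst,
      measure_univ]
  have hone : (1 : ℝ≥0∞) ≤ ENNReal.ofReal (2 + δ) := by
    rw [← ENNReal.ofReal_one]; exact ENNReal.ofReal_le_ofReal (by linarith)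
  have hfi : ∀ ν : Measure ℝ, IsProbabilityMeasure ν → MemLp id (ENNReal.ofReal (2 + δ)) ν →
      Integrable f ν := by
    intro ν _ hν
    have h1 : Integrable (fun x : ℝ => x) ν := hν.integrable hone
    refine Integrable.mono' ((integrable_const |f 0|).add (h1.abs.const_mul (L : ℝ)))
      hf.continuous.aestronglyMeasurable (.of_forall fun x => ?_)
    have := hf.dist_le_mul x 0
    rw [Real.dist_eq, Real.dist_eq, sub_zero] at this
    have h3 := abs_sub_abs_le_abs_sub (f x) (f 0)
    simp only [Pi.add_apply, Real.norm_eq_abs]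
    linarith
  have i1 : Integrable (fun z : ℝ × ℝ => f z.1) π := by
    have := hfi ν₁ inferInstance h₁
    rw [← hfst] at this
    exact (integrable_map_measure hf.continuous.aestronglyMeasurable
      measurable_fst.aemeasurable).1 this
  have i2 : Integrable (fun z : ℝ × ℝ => f z.2) π := by
    have := hfi ν₂ inferInstance h₂
    rw [← hsnd] at this
    exact (integrable_map_measure hf.continuous.aestronglyMeasurable
      measurable_snd.aemeasurable).1 this
  have e1 : ∫ x, f x ∂ν₁ = ∫ z, f z.1 ∂π := by
    conv_lhs => rw [← hfst]
    rw [integral_map measurable_fst.aemeasurable hf.continuous.aestronglyMeasurable]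
  have e2 : ∫ x, f x ∂ν₂ = ∫ z, f z.2 ∂π := by
    conv_lhs => rw [← hsnd]
    rw [integral_map measurable_snd.aemeasurable hf.continuous.aestronglyMeasurable]
  rw [e1, e2, ← integral_sub i1 i2, ← Real.norm_eq_abs, ofReal_norm]
  have hp1 : (1 : ℝ) ≤ 2 + δ := by linarith
  calc ‖∫ z, (f z.1 - f z.2) ∂π‖ₑ ≤ ∫⁻ z, ‖f z.1 - f z.2‖ₑ ∂π := enorm_integral_le_lintegral_enorm _
    _ ≤ ∫⁻ z, L * ‖z.1 - z.2‖ₑ ∂π := by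
        refine lintegral_mono fun z => ?_
        rw [← edist_eq_enorm_sub, ← edist_eq_enorm_sub]
        exact hf z.1 z.2
    _ = L * ∫⁻ z, ‖z.1 - z.2‖ₑ ∂π := lintegral_const_mul _ (by fun_prop)
    _ ≤ L * (∫⁻ z, ‖z.1 - z.2‖ₑ ^ (2 + δ) ∂π) ^ (1 / (2 + δ)) := by
        gcongr
        have := eLpNorm_le_eLpNorm_of_exponent_le (μ := π) (f := fun z : ℝ × ℝ => z.1 - z.2)
          hone (by fun_prop : Measurable fun z : ℝ × ℝ => z.1 - z.2).aestronglyMeasurable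
        rw [eLpNorm_one_eq_lintegral_enorm, eLpNorm_eq_lintegral_rpow_enorm_toReal
          (by simp; linarith) (by simp), ENNReal.toReal_ofReal (by linarith)] at this
        exact this
    _ ≤ L * (16000 * zolotarev (2 + δ) ν₁ ν₂) ^ (1 / (2 + δ)) := by
        gcongr
        exact lintegral_quantileCoupling_le hδ0 hδ1 ν₁ ν₂ h₁ h₂

/-! ### Gaussian averages of jets -/

/-- The average of `g` under a centered Gaussian perturbation of variance `v`. -/
noncomputable def gaussAvg (g : ℝ → ℝ) (v : ℝ≥0) (x : ℝ) : ℝ := ∫ y, g (x + y) ∂(gaussianReal 0 v)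

theorem memLp_const_add_gaussian {p : ℝ} (v : ℝ≥0) (x : ℝ) :
    MemLp (fun y : ℝ => x + y) (ENNReal.ofReal p) (gaussianReal 0 v) :=
  (memLp_const x).add (memLp_id_gaussianReal' _ (by simp))

theorem gaussAvg_zero (g : ℝ → ℝ) : gaussAvg g 0 = g := by
  ext x
  simp [gaussAvg, gaussianReal_zero_var]

theorem abs_integral_le_of_abs_le {α : Type*} {m : MeasurableSpace α} {μ : Measure α}
    [IsProbabilityMeasure μ] {f : α → ℝ} {C : ℝ} (h : ∀ x, |f x| ≤ C) : |∫ x, f x ∂μ| ≤ C := by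
  have := norm_integral_le_of_norm_le_const (μ := μ) (f := f) (C := C) (.of_forall h)
  simpa using this

theorem integral_sub_sub {α : Type*} {m : MeasurableSpace α} {μ : Measure α} {a b c : α → ℝ}
    (ha : Integrable a μ) (hb : Integrable b μ) (hc : Integrable c μ) :
    ∫ x, (a x - b x - c x) ∂μ = ∫ x, a x ∂μ - ∫ x, b x ∂μ - ∫ x, c x ∂μ := by
  have hab : Integrable (fun x => a x - b x) μ := ha.sub hb
  rw [integral_sub hab hc, integral_sub ha hb]

theorem integral_sub_sub_sub {α : Type*} {m : MeasurableSpace α} {μ : Measure α}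
    {a b c d : α → ℝ} (ha : Integrable a μ) (hb : Integrable b μ) (hc : Integrable c μ)
    (hd : Integrable d μ) :
    ∫ x, (a x - b x - c x - d x) ∂μ
      = ∫ x, a x ∂μ - ∫ x, b x ∂μ - ∫ x, c x ∂μ - ∫ x, d x ∂μ := by
  have hab : Integrable (fun x => a x - b x) μ := ha.sub hb
  rw [integral_sub_sub hab hc hd, integral_sub ha hb]

/-- The Taylor inequalities are linear in the jet, with bounds independent of the base point, so
they can be integrated in the base point without differentiating under the integral. -/
theorem HolderJet.gaussAvg {δ : ℝ} (hδ0 : 0 < δ) {g g₁ g₂ : ℝ → ℝ} (hg : HolderJet δ g g₁ g₂)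
    (v : ℝ≥0) : HolderJet δ (gaussAvg g v) (gaussAvg g₁ v) (gaussAvg g₂ v) := by
  have i0 : ∀ x, Integrable (fun y => g (x + y)) (gaussianReal 0 v) := fun x =>
    hg.integrable_comp hδ0 (memLp_const_add_gaussian v x)
  have i1 : ∀ x, Integrable (fun y => g₁ (x + y)) (gaussianReal 0 v) := fun x =>
    hg.integrable_one_comp hδ0 (memLp_const_add_gaussian v x)
  have i2 : ∀ x, Integrable (fun y => g₂ (x + y)) (gaussianReal 0 v) := fun x =>
    hg.integrable_two_comp hδ0 (memLp_const_add_gaussian v x)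
  refine ⟨fun x h => ?_, fun x h => ?_, fun x h => ?_⟩
  · have e : CLTRate.gaussAvg g v (x + h) - CLTRate.gaussAvg g v x - CLTRate.gaussAvg g₁ v x * h
        - CLTRate.gaussAvg g₂ v x * h ^ 2 / 2
        = ∫ y, (g (x + y + h) - g (x + y) - g₁ (x + y) * h - g₂ (x + y) * h ^ 2 / 2)
          ∂(gaussianReal 0 v) := by
      have i0' : Integrable (fun y => g (x + y + h)) (gaussianReal 0 v) := by
        simpa only [add_right_comm] using i0 (x + h)
      rw [integral_sub_sub_sub i0' (i0 x) ((i1 x).mul_const h)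
          (((i2 x).mul_const _).div_const 2), integral_mul_const, integral_div, integral_mul_const]
      simp only [CLTRate.gaussAvg, add_right_comm]
    rw [e]
    exact abs_integral_le_of_abs_le fun y => hg.zero (x + y) h
  · have e : CLTRate.gaussAvg g₁ v (x + h) - CLTRate.gaussAvg g₁ v x - CLTRate.gaussAvg g₂ v x * h
        = ∫ y, (g₁ (x + y + h) - g₁ (x + y) - g₂ (x + y) * h) ∂(gaussianReal 0 v) := by
      have i1' : Integrable (fun y => g₁ (x + y + h)) (gaussianReal 0 v) := by
        simpa only [add_right_comm] using i1 (x + h)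
      rw [integral_sub_sub i1' (i1 x) ((i2 x).mul_const h), integral_mul_const]
      simp only [CLTRate.gaussAvg, add_right_comm]
    rw [e]
    exact abs_integral_le_of_abs_le fun y => hg.one (x + y) h
  · have e : CLTRate.gaussAvg g₂ v (x + h) - CLTRate.gaussAvg g₂ v x
        = ∫ y, (g₂ (x + y + h) - g₂ (x + y)) ∂(gaussianReal 0 v) := by
      have i2' : Integrable (fun y => g₂ (x + y + h)) (gaussianReal 0 v) := by
        simpa only [add_right_comm] using i2 (x + h)
      rw [integral_sub i2' (i2 x)]
      simp only [CLTRate.gaussAvg, add_right_comm]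
    rw [e]
    exact abs_integral_le_of_abs_le fun y => hg.two (x + y) h

theorem gaussAvg_gaussAvg {δ : ℝ} (hδ0 : 0 < δ) {g g₁ g₂ : ℝ → ℝ} (hg : HolderJet δ g g₁ g₂)
    (v w : ℝ≥0) : gaussAvg (gaussAvg g w) v = gaussAvg g (v + w) := by
  ext x
  have hconv := gaussianReal_conv_gaussianReal (m₁ := 0) (m₂ := 0) (v₁ := v) (v₂ := w)
  rw [add_zero] at hconv
  simp only [gaussAvg]
  rw [← hconv, integral_conv (f := fun y => g (x + y))]
  · simp only [add_assoc]
  · rw [hconv]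
    exact hg.integrable_comp hδ0 (memLp_const_add_gaussian (v + w) x)

theorem integral_sq_gaussianReal (v : ℝ≥0) : ∫ y, y ^ 2 ∂(gaussianReal 0 v) = v := by
  have h := variance_fun_id_gaussianReal (μ := 0) (v := v)
  rw [variance_eq_integral measurable_id'.aemeasurable] at h
  simpa using h

/-- The Gaussian half of one replacement: the linear term is centered, the quadratic one contributes
v/2, and the remainder is a Gaussian moment independent of g and x. -/
theorem abs_gaussAvg_sub_le {δ : ℝ} (hδ0 : 0 < δ) {g g₁ g₂ : ℝ → ℝ} (hg : HolderJet δ g g₁ g₂)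
    (v : ℝ≥0) (x : ℝ) :
    |gaussAvg g v x - g x - v / 2 * g₂ x| ≤ ∫ y, |y| ^ (2 + δ) ∂(gaussianReal 0 v) := by
  have hL : MemLp (fun y : ℝ => y) (ENNReal.ofReal (2 + δ)) (gaussianReal 0 v) :=
    memLp_id_gaussianReal' _ (by simp)
  have i0 : Integrable (fun y => g (x + y)) (gaussianReal 0 v) :=
    hg.integrable_comp hδ0 (memLp_const_add_gaussian v x)
  have i1 : Integrable (fun y : ℝ => y) (gaussianReal 0 v) :=
    (memLp_id_gaussianReal' 1 (by simp)).integrable le_rfl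
  have i2 : Integrable (fun y : ℝ => y ^ 2) (gaussianReal 0 v) :=
    (memLp_id_gaussianReal' 2 (by simp)).integrable_sq
  have e : gaussAvg g v x - g x - v / 2 * g₂ x
      = ∫ y, (g (x + y) - g x - g₁ x * y - g₂ x * y ^ 2 / 2) ∂(gaussianReal 0 v) := by
    rw [integral_sub_sub_sub i0 (integrable_const _) (i1.const_mul _)
      ((i2.const_mul _).div_const 2), integral_div, integral_const_mul, integral_const_mul,
      integral_sq_gaussianReal, integral_id_gaussianReal]
    simp only [integral_const, gaussAvg]
    simp
    ring
  rw [e]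
  refine abs_integral_le_integral_abs.trans (integral_mono_of_nonneg
    (.of_forall fun _ => abs_nonneg _) (integrable_abs_rpow (by linarith) le_rfl hL)
    (.of_forall fun y => hg.zero x y))

theorem abs_rpow_le_one_add_sq {δ : ℝ} (hδ0 : 0 < δ) (hδ1 : δ ≤ 1) (x : ℝ) :
    |x| ^ δ ≤ 1 + x ^ 2 := by
  rcases le_total |x| 1 with h | h
  · have := Real.rpow_le_one (abs_nonneg x) h hδ0.le
    nlinarith [sq_nonneg x]
  · have : |x| ^ δ ≤ |x| ^ (2 : ℝ) := Real.rpow_le_rpow_of_exponent_le h (by linarith)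
    rw [Real.rpow_two, sq_abs] at this
    linarith

theorem abs_gaussAvg_two_zero_le {δ : ℝ} (hδ0 : 0 < δ) (hδ1 : δ ≤ 1) {g g₁ g₂ : ℝ → ℝ}
    (hg : HolderJet δ g g₁ g₂) (h0 : g₂ 0 = 0) (v : ℝ≥0) : |gaussAvg g₂ v 0| ≤ 1 + v := by
  have i2 : Integrable (fun y : ℝ => y ^ 2) (gaussianReal 0 v) :=
    (memLp_id_gaussianReal' 2 (by simp)).integrable_sq
  have h1 : ∫ y : ℝ, (1 + y ^ 2) ∂(gaussianReal 0 v) = 1 + (v : ℝ) := by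
    rw [integral_add (integrable_const _) i2, integral_sq_gaussianReal]
    simp
  rw [← h1, gaussAvg]
  refine abs_integral_le_integral_abs.trans (integral_mono_of_nonneg
    (.of_forall fun _ => abs_nonneg _) ((integrable_const _).add i2)
    (.of_forall fun y => ?_))
  have := hg.abs_two_le (0 + y)
  rw [h0, abs_zero, zero_add, zero_add] at this
  simpa using this.trans (abs_rpow_le_one_add_sq hδ0 hδ1 y)

/-! ### Dependence bounds and the Lindeberg method -/

/-- The bounds on the dependence structure of an adapted sequence which enter the Lindeberg
method. The number `θ k` controls the dependence across a time gap `k + 1`, and `c k` is the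
covariance at lag `k`. -/
structure DependenceBounds {Ω : Type*} {mΩ : MeasurableSpace Ω} (μ : Measure Ω)
    (X : ℤ → Ω → ℝ) (F : Filtration ℤ mΩ) (δ B : ℝ) (c θ : ℕ → ℝ) : Prop where
  adapted : ∀ i, Measurable[F i] (X i)
  memLp : ∀ i, MemLp (X i) (ENNReal.ofReal (2 + δ)) μ
  moment : ∀ i, ∫ ω, |X i ω| ^ (2 + δ) ∂μ ≤ B
  mean : ∀ i, ∫ ω, X i ω ∂μ = 0
  cov : ∀ (m n : ℤ) (k : ℕ), n = m + k → ∫ ω, X m ω * X n ω ∂μ = c k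
  one : ∀ (m n : ℤ) (k : ℕ) (R : Ω → ℝ), n = m + k + 1 → Measurable[F m] R →
    (∀ ω, |R ω| ≤ |X m ω| ^ (1 + δ)) → |∫ ω, R ω * X n ω ∂μ| ≤ θ k
  past : ∀ (a m n : ℤ) (k : ℕ) (R : Ω → ℝ), a ≤ m → n = m + k + 1 → Measurable[F m] R →
    (∀ ω, |R ω| ≤ |X a ω| ^ δ) → |∫ ω, R ω * (X m ω * X n ω - c (k + 1)) ∂μ| ≤ θ k
  future : ∀ (m n q : ℤ) (k j : ℕ) (R : Ω → ℝ), n = m + k + 1 → q = n + j → Measurable[F m] R →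
    (∀ ω, |R ω| ≤ |X m ω| ^ δ) → |∫ ω, R ω * (X n ω * X q ω - c j) ∂μ| ≤ θ k
  cov_le : ∀ k, |c (k + 1)| ≤ θ k
  summable : Summable fun k : ℕ => ((k : ℝ) + 1) * θ k

/-- The partial sums `X_1 + ⋯ + X_n`. -/
def partialSum {Ω : Type*} (X : ℤ → Ω → ℝ) (n : ℕ) (ω : Ω) : ℝ :=
  ∑ i ∈ Finset.range n, X ((i : ℤ) + 1) ω

theorem partialSum_zero {Ω : Type*} (X : ℤ → Ω → ℝ) (ω : Ω) : partialSum X 0 ω = 0 := by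
  simp [partialSum]

theorem partialSum_succ {Ω : Type*} (X : ℤ → Ω → ℝ) (n : ℕ) (ω : Ω) :
    partialSum X (n + 1) ω = partialSum X n ω + X ((n : ℤ) + 1) ω := by
  simp [partialSum, Finset.sum_range_succ]

/-! ### Moment inequalities and integrability of the terms of the expansion -/

section RealBounds

variable {δ : ℝ}

theorem rpow_mul_le_add {a b p q : ℝ} (ha : 0 ≤ a) (hb : 0 ≤ b) (hp : 0 ≤ p) (hq : 0 ≤ q) :
    a ^ p * b ^ q ≤ a ^ (p + q) + b ^ (p + q) := by
  rcases le_total a b with h | h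
  · calc a ^ p * b ^ q ≤ b ^ p * b ^ q := by gcongr
      _ = b ^ (p + q) := (Real.rpow_add_of_nonneg hb hp hq).symm
      _ ≤ _ := le_add_of_nonneg_left (by positivity)
  · calc a ^ p * b ^ q ≤ a ^ p * a ^ q := by gcongr
      _ = a ^ (p + q) := (Real.rpow_add_of_nonneg ha hp hq).symm
      _ ≤ _ := le_add_of_nonneg_right (by positivity)

theorem rpow_mul_mul_le_add (hδ0 : 0 < δ) {a b d : ℝ} (ha : 0 ≤ a) (hb : 0 ≤ b) (hd : 0 ≤ d) :
    a ^ δ * (b * d) ≤ a ^ (2 + δ) + b ^ (2 + δ) + d ^ (2 + δ) := by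
  have key : ∀ m, 0 ≤ m → a ≤ m → b ≤ m → d ≤ m → a ^ δ * (b * d) ≤ m ^ (2 + δ) := by
    intro m hm h1 h2 h3
    calc a ^ δ * (b * d) ≤ m ^ δ * (m * m) := by gcongr
      _ = m ^ (2 + δ) := by
          rw [← sq, ← Real.rpow_natCast, ← Real.rpow_add_of_nonneg hm hδ0.le (by norm_num)]
          congr 1
          push_cast
          ring
  have pa : 0 ≤ a ^ (2 + δ) := by positivity
  have pb : 0 ≤ b ^ (2 + δ) := by positivity
  have pd : 0 ≤ d ^ (2 + δ) := by positivity
  rcases le_total a b with h1 | h1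
  · rcases le_total b d with h2 | h2
    · linarith [key d hd (h1.trans h2) h2 le_rfl]
    · linarith [key b hb h1 le_rfl h2]
  · rcases le_total a d with h2 | h2
    · linarith [key d hd h2 (h1.trans h2) le_rfl]
    · linarith [key a ha le_rfl h1 h2]

end RealBounds

section Integrability

variable {Ω : Type*} {mΩ : MeasurableSpace Ω} {μ : Measure Ω} [IsProbabilityMeasure μ] {δ : ℝ}

theorem integrable_mul_of_memLp (hδ0 : 0 < δ) {U V : Ω → ℝ}
    (hU : MemLp U (ENNReal.ofReal (2 + δ)) μ) (hV : MemLp V (ENNReal.ofReal (2 + δ)) μ) :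
    Integrable (fun ω => U ω * V ω) μ := by
  have h2 : (2 : ℝ≥0∞) ≤ ENNReal.ofReal (2 + δ) := by
    rw [show (2 : ℝ≥0∞) = ENNReal.ofReal 2 by simp]
    exact ENNReal.ofReal_le_ofReal (by linarith)
  exact (hU.mono_exponent h2).integrable_mul (hV.mono_exponent h2)

theorem integrable_of_memLp (hδ0 : 0 < δ) {U : Ω → ℝ}
    (hU : MemLp U (ENNReal.ofReal (2 + δ)) μ) : Integrable U μ := by
  have h1 : (1 : ℝ≥0∞) ≤ ENNReal.ofReal (2 + δ) := by
    rw [← ENNReal.ofReal_one]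
    exact ENNReal.ofReal_le_ofReal (by linarith)
  exact hU.integrable h1

theorem integrable_mul_of_abs_le_rpow (hδ0 : 0 < δ) {R Z U : Ω → ℝ} (hR : AEStronglyMeasurable R μ)
    (hZ : MemLp Z (ENNReal.ofReal (2 + δ)) μ) (hRZ : ∀ ω, |R ω| ≤ |Z ω| ^ (1 + δ))
    (hU : MemLp U (ENNReal.ofReal (2 + δ)) μ) : Integrable (fun ω => R ω * U ω) μ := by
  refine Integrable.mono' ((integrable_abs_rpow (by linarith) le_rfl hZ).add
    (integrable_abs_rpow (by linarith) le_rfl hU)) (hR.mul hU.1) (.of_forall fun ω => ?_)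
  rw [Real.norm_eq_abs, abs_mul]
  have h1 : |R ω| * |U ω| ≤ |Z ω| ^ (1 + δ) * |U ω| ^ (1 : ℝ) := by
    rw [Real.rpow_one]
    gcongr
    exact hRZ ω
  have h2 := rpow_mul_le_add (abs_nonneg (Z ω)) (abs_nonneg (U ω)) (by linarith : 0 ≤ 1 + δ)
    zero_le_one
  rw [show 1 + δ + 1 = 2 + δ by ring] at h2
  exact h1.trans h2

theorem integrable_mul_mul_of_abs_le_rpow (hδ0 : 0 < δ) {R Z U V : Ω → ℝ}
    (hR : AEStronglyMeasurable R μ)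
    (hZ : MemLp Z (ENNReal.ofReal (2 + δ)) μ) (hRZ : ∀ ω, |R ω| ≤ |Z ω| ^ δ)
    (hU : MemLp U (ENNReal.ofReal (2 + δ)) μ) (hV : MemLp V (ENNReal.ofReal (2 + δ)) μ) :
    Integrable (fun ω => R ω * (U ω * V ω)) μ := by
  refine Integrable.mono' (((integrable_abs_rpow (by linarith) le_rfl hZ).add
    (integrable_abs_rpow (by linarith) le_rfl hU)).add
    (integrable_abs_rpow (by linarith) le_rfl hV)) (hR.mul (hU.1.mul hV.1))
    (.of_forall fun ω => ?_)
  rw [Real.norm_eq_abs, abs_mul, abs_mul]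
  have h1 : |R ω| * (|U ω| * |V ω|) ≤ |Z ω| ^ δ * (|U ω| * |V ω|) := by
    gcongr
    exact hRZ ω
  exact h1.trans (rpow_mul_mul_le_add hδ0 (abs_nonneg _) (abs_nonneg _) (abs_nonneg _))

theorem HolderJet.integrable_one_mul (hδ0 : 0 < δ) {g g₁ g₂ : ℝ → ℝ} (hg : HolderJet δ g g₁ g₂)
    {Z U : Ω → ℝ} (hZ : MemLp Z (ENNReal.ofReal (2 + δ)) μ)
    (hU : MemLp U (ENNReal.ofReal (2 + δ)) μ) : Integrable (fun ω => g₁ (Z ω) * U ω) μ := by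
  have hm : AEStronglyMeasurable (fun ω => g₁ (Z ω)) μ :=
    (hg.continuous_one hδ0).comp_aestronglyMeasurable hZ.1
  have hR : AEStronglyMeasurable (fun ω => g₁ (Z ω) - g₁ 0 - g₂ 0 * Z ω) μ :=
    (hm.sub aestronglyMeasurable_const).sub (hZ.1.const_mul _)
  have i1 := integrable_mul_of_abs_le_rpow hδ0 hR hZ (fun ω => by
    simpa using hg.one 0 (Z ω)) hU
  have i2 := (integrable_of_memLp hδ0 hU).const_mul (g₁ 0)
  have i3 := (integrable_mul_of_memLp hδ0 hZ hU).const_mul (g₂ 0)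
  refine ((i1.add i2).add i3).congr (.of_forall fun ω => ?_)
  simp only [Pi.add_apply]
  ring

theorem HolderJet.integrable_two_mul_mul (hδ0 : 0 < δ) {g g₁ g₂ : ℝ → ℝ}
    (hg : HolderJet δ g g₁ g₂) {Z U V : Ω → ℝ} (hZ : MemLp Z (ENNReal.ofReal (2 + δ)) μ)
    (hU : MemLp U (ENNReal.ofReal (2 + δ)) μ) (hV : MemLp V (ENNReal.ofReal (2 + δ)) μ) :
    Integrable (fun ω => g₂ (Z ω) * (U ω * V ω)) μ := by
  have hm : AEStronglyMeasurable (fun ω => g₂ (Z ω)) μ :=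
    (hg.continuous_two hδ0).comp_aestronglyMeasurable hZ.1
  have i1 := integrable_mul_mul_of_abs_le_rpow hδ0 (hm.sub aestronglyMeasurable_const) hZ
    (fun ω => by simpa using hg.two 0 (Z ω)) hU hV
  have i2 := (integrable_mul_of_memLp hδ0 hU hV).const_mul (g₂ 0)
  refine (i1.add i2).congr (.of_forall fun ω => ?_)
  simp only [Pi.add_apply, Pi.sub_apply]
  ring

end Integrability

/-! ### Sums controlled by the weighted series Σ (k+1) θ k -/

section Series

variable {θ : ℕ → ℝ}

theorem summable_of_weighted (h0 : ∀ k, 0 ≤ θ k) (hs : Summable fun k : ℕ => ((k : ℝ) + 1) * θ k) :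
    Summable θ :=
  Summable.of_nonneg_of_le h0 (fun k => by nlinarith [h0 k, (Nat.cast_nonneg k : (0 : ℝ) ≤ k)]) hs

theorem sum_range_le_weighted (h0 : ∀ k, 0 ≤ θ k)
    (hs : Summable fun k : ℕ => ((k : ℝ) + 1) * θ k) (n : ℕ) :
    ∑ k ∈ Finset.range n, ((k : ℝ) + 1) * θ k ≤ ∑' k : ℕ, ((k : ℝ) + 1) * θ k :=
  hs.sum_le_tsum _ fun k _ => mul_nonneg (by positivity) (h0 k)

theorem sum_range_le_weighted' (h0 : ∀ k, 0 ≤ θ k)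
    (hs : Summable fun k : ℕ => ((k : ℝ) + 1) * θ k) (n : ℕ) :
    ∑ k ∈ Finset.range n, θ k ≤ ∑' k : ℕ, ((k : ℝ) + 1) * θ k :=
  (Finset.sum_le_sum fun k _ => by
    nlinarith [h0 k, (Nat.cast_nonneg k : (0 : ℝ) ≤ k)]).trans (sum_range_le_weighted h0 hs n)

/-- The minimum is at most the value at the larger index, and an index i is the larger one for at
most i + 1 partners. No monotonicity of θ is involved. -/
theorem sum_min_le_weighted (h0 : ∀ k, 0 ≤ θ k)
    (hs : Summable fun k : ℕ => ((k : ℝ) + 1) * θ k) (n : ℕ) :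
    ∑ i ∈ Finset.range n, ∑ j ∈ Finset.range n, min (θ i) (θ j)
      ≤ 2 * ∑' k : ℕ, ((k : ℝ) + 1) * θ k := by
  have hle : ∀ i j, min (θ i) (θ j) ≤ (if j ≤ i then θ i else 0) + (if i ≤ j then θ j else 0) := by
    intro i j
    rcases le_total j i with h | h
    · rw [if_pos h]
      split_ifs
      · exact (min_le_left _ _).trans (le_add_of_nonneg_right (h0 j))
      · simp
    · rw [if_pos h]
      split_ifs
      · exact (min_le_left _ _).trans (le_add_of_nonneg_right (h0 j))
      · simp
  have hA : ∑ i ∈ Finset.range n, ∑ j ∈ Finset.range n, (if j ≤ i then θ i else 0)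
      ≤ ∑' k : ℕ, ((k : ℝ) + 1) * θ k := by
    refine le_trans (Finset.sum_le_sum fun i _ => ?_) (sum_range_le_weighted h0 hs n)
    rw [← Finset.sum_filter, Finset.sum_const, nsmul_eq_mul]
    have hc : (Finset.filter (fun j => j ≤ i) (Finset.range n)).card ≤ i + 1 := by
      calc _ ≤ (Finset.range (i + 1)).card := Finset.card_le_card fun j hj => by
            simp only [Finset.mem_filter, Finset.mem_range] at hj ⊢
            omega
        _ = i + 1 := Finset.card_range _
    have : ((Finset.filter (fun j => j ≤ i) (Finset.range n)).card : ℝ) ≤ (i : ℝ) + 1 := by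
      exact_mod_cast hc
    exact mul_le_mul_of_nonneg_right this (h0 i)
  have hB : ∑ i ∈ Finset.range n, ∑ j ∈ Finset.range n, (if i ≤ j then θ j else 0)
      ≤ ∑' k : ℕ, ((k : ℝ) + 1) * θ k := by
    rw [Finset.sum_comm]
    exact hA
  calc _ ≤ ∑ i ∈ Finset.range n, ∑ j ∈ Finset.range n,
        ((if j ≤ i then θ i else 0) + (if i ≤ j then θ j else 0)) :=
        Finset.sum_le_sum fun i _ => Finset.sum_le_sum fun j _ => hle i j
    _ ≤ _ := by
        simp only [Finset.sum_add_distrib]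
        linarith

/-- The value θ m occurs in the tails starting at 0, …, m, hence at most m + 1 times. The proof is
the corresponding exact summation by parts. -/
theorem sum_tails_le_weighted (h0 : ∀ k, 0 ≤ θ k)
    (hs : Summable fun k : ℕ => ((k : ℝ) + 1) * θ k) (n : ℕ) :
    ∑ k ∈ Finset.range n, ∑' i, θ (i + k) ≤ ∑' k : ℕ, ((k : ℝ) + 1) * θ k := by
  have hsum := summable_of_weighted h0 hs
  have hk : ∀ k, Summable fun i => θ (i + k) := fun k => (summable_nat_add_iff k).2 hsum
  have heq : ∑ k ∈ Finset.range n, ∑' i, θ (i + k)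
      = ∑ k ∈ Finset.range n, ((k : ℝ) + 1) * θ k + n * ∑' i, θ (i + n) := by
    induction n with
    | zero => simp
    | succ n ih =>
      rw [Finset.sum_range_succ, Finset.sum_range_succ, ih]
      have : ∑' i, θ (i + n) = θ n + ∑' i, θ (i + (n + 1)) := by
        rw [(hk n).tsum_eq_zero_add]
        simp only [zero_add]
        congr 1
        refine tsum_congr fun i => ?_
        congr 1
        ring
      rw [this]
      push_cast
      ring
  rw [heq, ← hs.sum_add_tsum_nat_add n, ← tsum_mul_left]
  gcongr with i
  · exact (hk n).mul_left _
  · exact (summable_nat_add_iff n).2 hs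
  · exact h0 _
  · push_cast
    linarith [(Nat.cast_nonneg i : (0 : ℝ) ≤ i)]

end Series

/-! ### Expansion of one Lindeberg step under dependence -/

namespace DependenceBounds

variable {Ω : Type*} {mΩ : MeasurableSpace Ω} {μ : Measure Ω}
  {X : ℤ → Ω → ℝ} {F : Filtration ℤ mΩ} {δ B : ℝ} {c θ : ℕ → ℝ}

theorem theta_nonneg (H : DependenceBounds μ X F δ B c θ) (k : ℕ) : 0 ≤ θ k :=
  (abs_nonneg _).trans (H.cov_le k)

theorem measurable_partialSum (H : DependenceBounds μ X F δ B c θ) (n : ℕ) (m : ℤ)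
    (hm : (n : ℤ) ≤ m) : Measurable[F m] (partialSum X n) := by
  unfold partialSum
  refine Finset.measurable_fun_sum _ fun i hi => ?_
  have : (i : ℤ) + 1 ≤ m := by
    have := Finset.mem_range.1 hi
    omega
  exact (H.adapted _).mono (F.mono this) le_rfl

theorem memLp_partialSum (H : DependenceBounds μ X F δ B c θ) (n : ℕ) :
    MemLp (partialSum X n) (ENNReal.ofReal (2 + δ)) μ :=
  memLp_finsetSum _ fun _ _ => H.memLp _

variable [IsProbabilityMeasure μ]

theorem integral_rpow_le (H : DependenceBounds μ X F δ B c θ) (hδ0 : 0 < δ) (i : ℤ) :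
    ∫ ω, |X i ω| ^ δ ∂μ ≤ 1 + B := by
  have i1 := integrable_abs_rpow (q := 2 + δ) (by linarith) le_rfl (H.memLp i)
  calc ∫ ω, |X i ω| ^ δ ∂μ ≤ ∫ ω, (1 + |X i ω| ^ (2 + δ)) ∂μ := by
        refine integral_mono (integrable_abs_rpow hδ0.le (by linarith) (H.memLp i))
          ((integrable_const _).add i1) fun ω => ?_
        rcases le_total |X i ω| 1 with h | h
        · have := Real.rpow_le_one (abs_nonneg (X i ω)) h hδ0.le
          have : 0 ≤ |X i ω| ^ (2 + δ) := by positivity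
          simp only
          linarith
        · have : |X i ω| ^ δ ≤ |X i ω| ^ (2 + δ) :=
            Real.rpow_le_rpow_of_exponent_le h (by linarith)
          simp only
          linarith
    _ = 1 + ∫ ω, |X i ω| ^ (2 + δ) ∂μ := by
        rw [integral_add (integrable_const _) i1]
        simp
    _ ≤ 1 + B := by linarith [H.moment i]

section Jet

variable {g g₁ g₂ : ℝ → ℝ}

/-- The Taylor remainder of g₁ along one step is known at time l + 1 and bounded by |X_{l+1}|^{1+δ};
the other factor lies i + 1 units of time later. -/
theorem abs_integral_increment_le (H : DependenceBounds μ X F δ B c θ) (hδ0 : 0 < δ)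
    (hg : HolderJet δ g g₁ g₂) (l i : ℕ) :
    |∫ ω, (g₁ (partialSum X (l + 1) ω) - g₁ (partialSum X l ω)
      - g₂ (partialSum X l ω) * X ((l : ℤ) + 1) ω) * X (((l + i + 1 : ℕ) : ℤ) + 1) ω ∂μ| ≤ θ i := by
  refine H.one ((l : ℤ) + 1) _ i _ (by push_cast; ring) ?_ fun ω => ?_
  · have h1 := (hg.continuous_one hδ0).measurable
    have h2 := (hg.continuous_two hδ0).measurable
    have s1 := H.measurable_partialSum (l + 1) ((l : ℤ) + 1) (by push_cast; rfl)
    have s2 := H.measurable_partialSum l ((l : ℤ) + 1) (by linarith)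
    exact ((h1.comp s1).sub (h1.comp s2)).sub ((h2.comp s2).mul (H.adapted _))
  · rw [partialSum_succ]
    exact hg.one _ _

theorem measurable_two_increment (H : DependenceBounds μ X F δ B c θ) (hδ0 : 0 < δ)
    (hg : HolderJet δ g g₁ g₂) (r : ℕ) (m : ℤ) (hm : (r : ℤ) + 1 ≤ m) :
    Measurable[F m] fun ω => g₂ (partialSum X (r + 1) ω) - g₂ (partialSum X r ω) := by
  have h2 := (hg.continuous_two hδ0).measurable
  have s1 := H.measurable_partialSum (r + 1) m (by push_cast; exact hm)
  have s2 := H.measurable_partialSum r m (by linarith)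
  exact (h2.comp s1).sub (h2.comp s2)

/-- Telescoping `g₂ (S_l)` against a centered integrable variable. -/
theorem abs_integral_two_mul_le_sum (H : DependenceBounds μ X F δ B c θ) (hδ0 : 0 < δ)
    (hg : HolderJet δ g g₁ g₂) (l : ℕ) (m n : ℤ) (κ : ℝ) (hκ : ∫ ω, X m ω * X n ω ∂μ = κ)
    (b : ℕ → ℝ)
    (hb : ∀ r j, l = r + j + 1 →
      |∫ ω, (g₂ (partialSum X (r + 1) ω) - g₂ (partialSum X r ω)) * (X m ω * X n ω - κ) ∂μ|
        ≤ b j) :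
    |∫ ω, g₂ (partialSum X l ω) * (X m ω * X n ω - κ) ∂μ| ≤ ∑ j ∈ Finset.range l, b j := by
  have hInt : ∀ r, Integrable (fun ω => g₂ (partialSum X r ω) * (X m ω * X n ω - κ)) μ := by
    intro r
    have a1 := hg.integrable_two_mul_mul hδ0 (H.memLp_partialSum r) (H.memLp m) (H.memLp n)
    have a2 := (hg.integrable_two_comp hδ0 (H.memLp_partialSum r)).mul_const κ
    refine (a1.sub a2).congr (.of_forall fun ω => ?_)
    simp only [Pi.sub_apply]
    ring
  -- The telescoping ends at S_0 = 0, where g₂ is the constant g₂ 0 and the product is centered.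
  have hz : ∫ ω, g₂ (partialSum X 0 ω) * (X m ω * X n ω - κ) ∂μ = 0 := by
    simp only [partialSum_zero]
    rw [integral_const_mul, integral_sub (integrable_mul_of_memLp hδ0 (H.memLp m) (H.memLp n))
      (integrable_const _), hκ]
    simp
  have htel := Finset.sum_range_sub'
    (fun j => ∫ ω, g₂ (partialSum X (l - j) ω) * (X m ω * X n ω - κ) ∂μ) l
  simp only [tsub_self, tsub_zero, hz] at htel
  rw [← htel]
  refine (Finset.abs_sum_le_sum_abs _ _).trans (Finset.sum_le_sum fun j hj => ?_)
  obtain ⟨r, hr⟩ : ∃ r, l = r + j + 1 := ⟨l - j - 1, by have := Finset.mem_range.1 hj; omega⟩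
  have e1 : l - j = r + 1 := by omega
  have e2 : l - (j + 1) = r := by omega
  rw [e1, e2, ← integral_sub (hInt _) (hInt _)]
  simp only [← sub_mul]
  exact hb r j hr

/-- Two gaps are available: i between the factors X_{l+1} and X_{l+i+2}, used through `past`, and j
between the increment of g₂ and the product, used through `future`. Keeping the smaller bound makes
the double sum over i and j finite under a weight of order one only. -/
theorem abs_integral_two_mul_cov_le (H : DependenceBounds μ X F δ B c θ) (hδ0 : 0 < δ)
    (hg : HolderJet δ g g₁ g₂) (l i : ℕ) :
    |∫ ω, g₂ (partialSum X l ω) * (X ((l : ℤ) + 1) ω * X (((l + i + 1 : ℕ) : ℤ) + 1) ω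
      - c (i + 1)) ∂μ| ≤ ∑ j ∈ Finset.range l, min (θ i) (θ j) := by
  refine H.abs_integral_two_mul_le_sum hδ0 hg l _ _ _
    (H.cov _ _ (i + 1) (by push_cast; ring)) _ fun r j hr => le_min ?_ ?_
  · refine H.past ((r : ℤ) + 1) _ _ i _ (by omega) (by push_cast; ring)
      (H.measurable_two_increment hδ0 hg r _ (by omega)) fun ω => ?_
    rw [partialSum_succ]
    exact hg.two _ _
  · refine H.future ((r : ℤ) + 1) _ _ j (i + 1) _ (by subst hr; push_cast; ring)
      (by push_cast; ring) (H.measurable_two_increment hδ0 hg r _ le_rfl) fun ω => ?_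
    rw [partialSum_succ]
    exact hg.two _ _

theorem abs_integral_two_mul_var_le (H : DependenceBounds μ X F δ B c θ) (hδ0 : 0 < δ)
    (hg : HolderJet δ g g₁ g₂) (l : ℕ) :
    |∫ ω, g₂ (partialSum X l ω) * (X ((l : ℤ) + 1) ω * X ((l : ℤ) + 1) ω
      - c 0) ∂μ| ≤ ∑ j ∈ Finset.range l, θ j := by
  refine H.abs_integral_two_mul_le_sum hδ0 hg l _ _ _
    (H.cov _ _ 0 (by simp)) _ fun r j hr => ?_
  refine H.future ((r : ℤ) + 1) _ _ j 0 _ (by subst hr; push_cast; ring)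
      (by push_cast; ring) (H.measurable_two_increment hδ0 hg r _ le_rfl) fun ω => ?_
  rw [partialSum_succ]
  exact hg.two _ _

/-- Each step moves g₂ by at most |X|^δ, whose expectation is at most 1 + B. The growth in a is paid
for by the covariance at lag a, which is where the weight i + 1 comes from. -/
theorem abs_integral_two_sub_le (H : DependenceBounds μ X F δ B c θ) (hδ0 : 0 < δ)
    (hg : HolderJet δ g g₁ g₂) (l a : ℕ) :
    |∫ ω, g₂ (partialSum X l ω) ∂μ - ∫ ω, g₂ (partialSum X (l + a) ω) ∂μ| ≤ a * (1 + B) := by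
  induction a with
  | zero => simp
  | succ a ih =>
    have hi := fun r => hg.integrable_two_comp hδ0 (H.memLp_partialSum r)
    have h1 : |∫ ω, g₂ (partialSum X (l + a) ω) ∂μ - ∫ ω, g₂ (partialSum X (l + (a + 1)) ω) ∂μ|
        ≤ 1 + B := by
      rw [← integral_sub (hi _) (hi _)]
      refine abs_integral_le_integral_abs.trans (le_trans (integral_mono_of_nonneg
        (.of_forall fun _ => abs_nonneg _)
        (integrable_abs_rpow hδ0.le (by linarith) (H.memLp (((l + a : ℕ) : ℤ) + 1)))
        (.of_forall fun ω => ?_)) (H.integral_rpow_le hδ0 (((l + a : ℕ) : ℤ) + 1)))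
      simp only
      rw [← add_assoc, partialSum_succ, abs_sub_comm]
      exact hg.two _ _
    have := abs_sub_le (∫ ω, g₂ (partialSum X l ω) ∂μ) (∫ ω, g₂ (partialSum X (l + a) ω) ∂μ)
      (∫ ω, g₂ (partialSum X (l + (a + 1)) ω) ∂μ)
    push_cast
    linarith

/-- The first order term of the expansion, up to remainders which are summable in the lag. -/
theorem integral_one_mul_expansion (H : DependenceBounds μ X F δ B c θ) (hδ0 : 0 < δ)
    (hg : HolderJet δ g g₁ g₂) (k : ℕ) :
    |∫ ω, g₁ (partialSum X k ω) * X ((k : ℤ) + 1) ω ∂μ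
      - (∑ i ∈ Finset.range k, c (i + 1)) * ∫ ω, g₂ (partialSum X k ω) ∂μ|
      ≤ (3 + (1 + B)) * ∑' i : ℕ, ((i : ℝ) + 1) * θ i := by
  set T := ∑' i : ℕ, ((i : ℝ) + 1) * θ i with hT
  have hθ := H.theta_nonneg
  have hInt : ∀ l, Integrable (fun ω => g₁ (partialSum X l ω) * X ((k : ℤ) + 1) ω) μ :=
    fun l => hg.integrable_one_mul hδ0 (H.memLp_partialSum l) (H.memLp _)
  have hz : ∫ ω, g₁ (partialSum X 0 ω) * X ((k : ℤ) + 1) ω ∂μ = 0 := by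
    simp only [partialSum_zero]
    rw [integral_const_mul, H.mean, mul_zero]
  have htel := Finset.sum_range_sub'
    (fun j => ∫ ω, g₁ (partialSum X (k - j) ω) * X ((k : ℤ) + 1) ω ∂μ) k
  simp only [tsub_self, tsub_zero, hz] at htel
  rw [← htel, Finset.sum_mul, ← Finset.sum_sub_distrib]
  have hterm : ∀ i ∈ Finset.range k,
      |(∫ ω, g₁ (partialSum X (k - i) ω) * X ((k : ℤ) + 1) ω ∂μ
        - ∫ ω, g₁ (partialSum X (k - (i + 1)) ω) * X ((k : ℤ) + 1) ω ∂μ)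
        - c (i + 1) * ∫ ω, g₂ (partialSum X k ω) ∂μ|
      ≤ θ i + ∑ j ∈ Finset.range k, min (θ i) (θ j) + ((i : ℝ) + 1) * θ i * (1 + B) := by
    intro i hi
    obtain ⟨l, hl⟩ : ∃ l, k = l + i + 1 := ⟨k - i - 1, by have := Finset.mem_range.1 hi; omega⟩
    have e1 : k - i = l + 1 := by omega
    have e2 : k - (i + 1) = l := by omega
    rw [e1, e2]
    have b1 := H.abs_integral_increment_le hδ0 hg l i
    have b2 := H.abs_integral_two_mul_cov_le hδ0 hg l i
    have b3 := H.abs_integral_two_sub_le hδ0 hg l (i + 1)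
    rw [← add_assoc] at b3
    rw [← hl] at b1 b2 b3
    have i2 := hg.integrable_two_mul_mul hδ0 (H.memLp_partialSum l) (H.memLp ((l : ℤ) + 1))
      (H.memLp ((k : ℤ) + 1))
    have i3 := hg.integrable_two_comp hδ0 (H.memLp_partialSum l)
    have E1 : ∫ ω, (g₁ (partialSum X (l + 1) ω) - g₁ (partialSum X l ω)
        - g₂ (partialSum X l ω) * X ((l : ℤ) + 1) ω) * X ((k : ℤ) + 1) ω ∂μ
        = ∫ ω, g₁ (partialSum X (l + 1) ω) * X ((k : ℤ) + 1) ω ∂μ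
          - ∫ ω, g₁ (partialSum X l ω) * X ((k : ℤ) + 1) ω ∂μ
          - ∫ ω, g₂ (partialSum X l ω) * (X ((l : ℤ) + 1) ω * X ((k : ℤ) + 1) ω) ∂μ := by
      rw [← integral_sub_sub (hInt (l + 1)) (hInt l) i2]
      refine integral_congr_ae (.of_forall fun ω => ?_)
      simp only
      ring
    have E2 : ∫ ω, g₂ (partialSum X l ω) * (X ((l : ℤ) + 1) ω * X ((k : ℤ) + 1) ω - c (i + 1)) ∂μ
        = ∫ ω, g₂ (partialSum X l ω) * (X ((l : ℤ) + 1) ω * X ((k : ℤ) + 1) ω) ∂μ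
          - c (i + 1) * ∫ ω, g₂ (partialSum X l ω) ∂μ := by
      rw [← integral_const_mul, ← integral_sub i2 (i3.const_mul _)]
      refine integral_congr_ae (.of_forall fun ω => ?_)
      simp only
      ring
    rw [E1] at b1
    rw [E2] at b2
    have hmono : ∑ j ∈ Finset.range l, min (θ i) (θ j) ≤ ∑ j ∈ Finset.range k, min (θ i) (θ j) :=
      Finset.sum_le_sum_of_subset_of_nonneg (Finset.range_mono (by omega))
        fun j _ _ => le_min (hθ i) (hθ j)
    have b4 : |c (i + 1) * (∫ ω, g₂ (partialSum X l ω) ∂μ - ∫ ω, g₂ (partialSum X k ω) ∂μ)|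
        ≤ ((i : ℝ) + 1) * θ i * (1 + B) := by
      rw [abs_mul]
      calc _ ≤ θ i * (((i + 1 : ℕ) : ℝ) * (1 + B)) :=
            mul_le_mul (H.cov_le i) b3 (abs_nonneg _) (hθ i)
        _ = _ := by push_cast; ring
    set A1 := ∫ ω, g₁ (partialSum X (l + 1) ω) * X ((k : ℤ) + 1) ω ∂μ
    set A2 := ∫ ω, g₁ (partialSum X l ω) * X ((k : ℤ) + 1) ω ∂μ
    set A3 := ∫ ω, g₂ (partialSum X l ω) * (X ((l : ℤ) + 1) ω * X ((k : ℤ) + 1) ω) ∂μ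
    set A4 := ∫ ω, g₂ (partialSum X l ω) ∂μ
    set A5 := ∫ ω, g₂ (partialSum X k ω) ∂μ
    -- The three errors are the Taylor remainder of g₁, the decorrelation of g₂(S_l) from the
    -- product, and the shift of g₂ from S_l to S_k. Summed over i they contribute 1, 2 and 1 + B
    -- times the weighted series.
    have e : A1 - A2 - c (i + 1) * A5 = (A1 - A2 - A3) + (A3 - c (i + 1) * A4)
        + c (i + 1) * (A4 - A5) := by ring
    rw [e]
    refine (abs_add_three _ _ _).trans ?_
    linarith
  refine (Finset.abs_sum_le_sum_abs _ _).trans ((Finset.sum_le_sum hterm).trans ?_)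
  simp only [Finset.sum_add_distrib]
  have s1 := sum_range_le_weighted' hθ H.summable k
  have s2 := sum_min_le_weighted hθ H.summable k
  have s3 := sum_range_le_weighted hθ H.summable k
  have hB : 0 ≤ 1 + B :=
    (integral_nonneg fun ω => by positivity).trans (H.integral_rpow_le hδ0 0)
  rw [← Finset.sum_mul]
  have s4 := mul_le_mul_of_nonneg_right s3 hB
  rw [← hT] at s1 s2 s4
  linarith

/-- The asymptotic variance written through the covariances. -/
noncomputable def _root_.CLTRate.seriesVar (c : ℕ → ℝ) : ℝ := c 0 + 2 * ∑' i, c (i + 1)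

theorem summable_cov (H : DependenceBounds μ X F δ B c θ) : Summable fun i => c (i + 1) :=
  Summable.of_norm_bounded (summable_of_weighted H.theta_nonneg H.summable) fun i => H.cov_le i

theorem abs_sum_cov_sub_le (H : DependenceBounds μ X F δ B c θ) (k : ℕ) :
    |∑ i ∈ Finset.range k, c (i + 1) - ∑' i, c (i + 1)| ≤ ∑' i, θ (i + k) := by
  have hs := H.summable_cov
  rw [← hs.sum_add_tsum_nat_add k, sub_add_cancel_left, abs_neg]
  have hθs : Summable fun i => θ (i + k) :=
    (summable_nat_add_iff k).2 (summable_of_weighted H.theta_nonneg H.summable)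
  exact tsum_of_norm_bounded (f := fun i => c (i + k + 1)) hθs.hasSum fun i => H.cov_le (i + k)

/-- One step of the Lindeberg replacement. -/
theorem lindeberg_step (H : DependenceBounds μ X F δ B c θ) (hδ0 : 0 < δ)
    (hg : HolderJet δ g g₁ g₂) (k : ℕ) :
    |∫ ω, g (partialSum X (k + 1) ω) ∂μ - ∫ ω, g (partialSum X k ω) ∂μ
      - seriesVar c / 2 * ∫ ω, g₂ (partialSum X k ω) ∂μ|
      ≤ B + (4 + (1 + B)) * ∑' i : ℕ, ((i : ℝ) + 1) * θ i
        + (∑' i, θ (i + k)) * |∫ ω, g₂ (partialSum X k ω) ∂μ| := by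
  have b1 := H.integral_one_mul_expansion hδ0 hg k
  have b2 := H.abs_integral_two_mul_var_le hδ0 hg k
  have b3 := H.abs_sum_cov_sub_le k
  have b4 := sum_range_le_weighted' H.theta_nonneg H.summable k
  have T0 : 0 ≤ ∑ j ∈ Finset.range k, θ j := Finset.sum_nonneg fun j _ => H.theta_nonneg j
  set T := ∑' i : ℕ, ((i : ℝ) + 1) * θ i
  set Y := X ((k : ℤ) + 1)
  have iS := hg.integrable_comp hδ0 (H.memLp_partialSum (k + 1))
  have i0 := hg.integrable_comp hδ0 (H.memLp_partialSum k)
  have i1 : Integrable (fun ω => g₁ (partialSum X k ω) * Y ω) μ :=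
    hg.integrable_one_mul hδ0 (H.memLp_partialSum k) (H.memLp _)
  have i2 : Integrable (fun ω => g₂ (partialSum X k ω) * (Y ω * Y ω)) μ :=
    hg.integrable_two_mul_mul hδ0 (H.memLp_partialSum k) (H.memLp _) (H.memLp _)
  have i3 := hg.integrable_two_comp hδ0 (H.memLp_partialSum k)
  have b0 : |∫ ω, g (partialSum X (k + 1) ω) ∂μ - ∫ ω, g (partialSum X k ω) ∂μ
      - ∫ ω, g₁ (partialSum X k ω) * Y ω ∂μ
      - ∫ ω, g₂ (partialSum X k ω) * (Y ω * Y ω) / 2 ∂μ| ≤ B := by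
    rw [← integral_sub_sub_sub iS i0 i1 (i2.div_const 2)]
    refine abs_integral_le_integral_abs.trans (le_trans (integral_mono_of_nonneg
      (.of_forall fun _ => abs_nonneg _)
      (integrable_abs_rpow (by linarith) le_rfl (H.memLp ((k : ℤ) + 1)))
      (.of_forall fun ω => ?_)) (H.moment ((k : ℤ) + 1)))
    simp only
    rw [partialSum_succ, ← sq]
    exact hg.zero _ _
  rw [integral_div] at b0
  have E2 : ∫ ω, g₂ (partialSum X k ω) * (Y ω * Y ω - c 0) ∂μ
      = ∫ ω, g₂ (partialSum X k ω) * (Y ω * Y ω) ∂μ - c 0 * ∫ ω, g₂ (partialSum X k ω) ∂μ := by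
    rw [← integral_const_mul, ← integral_sub i2 (i3.const_mul _)]
    refine integral_congr_ae (.of_forall fun ω => ?_)
    simp only
    ring
  rw [E2] at b2
  set A0 := ∫ ω, g (partialSum X (k + 1) ω) ∂μ
  set A1 := ∫ ω, g (partialSum X k ω) ∂μ
  set A2 := ∫ ω, g₁ (partialSum X k ω) * Y ω ∂μ
  set A3 := ∫ ω, g₂ (partialSum X k ω) * (Y ω * Y ω) ∂μ
  set A4 := ∫ ω, g₂ (partialSum X k ω) ∂μ
  set P := ∑ i ∈ Finset.range k, c (i + 1)
  set Q := ∑' i, c (i + 1)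
  set t := ∑' i, θ (i + k)
  -- The last term completes the partial sum of covariances to the full series. It is the only one
  -- not bounded uniformly in g, hence kept as a tail times |A4|.
  have e : A0 - A1 - seriesVar c / 2 * A4 = (A0 - A1 - A2 - A3 / 2) + (A2 - P * A4)
      + (A3 - c 0 * A4) / 2 + (P - Q) * A4 := by
    simp only [seriesVar, Q]
    ring
  have b5 : |(P - Q) * A4| ≤ t * |A4| := by
    rw [abs_mul]
    exact mul_le_mul_of_nonneg_right b3 (abs_nonneg _)
  have b6 : |(A3 - c 0 * A4) / 2| ≤ T := by
    rw [abs_div, abs_two]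
    linarith [abs_nonneg (A3 - c 0 * A4)]
  rw [e]
  refine (abs_add_le _ _).trans ?_
  have := abs_add_three (A0 - A1 - A2 - A3 / 2) (A2 - P * A4) ((A3 - c 0 * A4) / 2)
  linarith

end Jet

/-! ### The variance of the partial sums -/

theorem integral_partialSum_mul (H : DependenceBounds μ X F δ B c θ) (hδ0 : 0 < δ) (k : ℕ) :
    ∫ ω, partialSum X k ω * X ((k : ℤ) + 1) ω ∂μ = ∑ i ∈ Finset.range k, c (i + 1) := by
  have h1 : ∀ ω, partialSum X k ω * X ((k : ℤ) + 1) ω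
      = ∑ i ∈ Finset.range k, X ((i : ℤ) + 1) ω * X ((k : ℤ) + 1) ω := fun ω => by
    rw [partialSum, Finset.sum_mul]
  simp only [h1]
  rw [integral_finsetSum _ fun i _ => integrable_mul_of_memLp hδ0 (H.memLp _) (H.memLp _),
    ← Finset.sum_range_reflect]
  refine Finset.sum_congr rfl fun i hi => ?_
  have := Finset.mem_range.1 hi
  exact H.cov _ _ (i + 1) (by omega)

theorem integral_partialSum_sq_succ (H : DependenceBounds μ X F δ B c θ) (hδ0 : 0 < δ) (k : ℕ) :
    ∫ ω, partialSum X (k + 1) ω ^ 2 ∂μ = ∫ ω, partialSum X k ω ^ 2 ∂μ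
      + (c 0 + 2 * ∑ i ∈ Finset.range k, c (i + 1)) := by
  have i1 : Integrable (fun ω => partialSum X k ω ^ 2) μ := by
    simpa only [sq] using integrable_mul_of_memLp hδ0 (H.memLp_partialSum k) (H.memLp_partialSum k)
  have i2 := integrable_mul_of_memLp hδ0 (H.memLp_partialSum k) (H.memLp ((k : ℤ) + 1))
  have i3 := integrable_mul_of_memLp hδ0 (H.memLp ((k : ℤ) + 1)) (H.memLp ((k : ℤ) + 1))
  have h3 := H.cov ((k : ℤ) + 1) ((k : ℤ) + 1) 0 (by simp)
  rw [← H.integral_partialSum_mul hδ0 k, ← h3, ← integral_const_mul, ← integral_add i3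
    (i2.const_mul 2)]
  have i4 : Integrable (fun ω => X ((k : ℤ) + 1) ω * X ((k : ℤ) + 1) ω
    + 2 * (partialSum X k ω * X ((k : ℤ) + 1) ω)) μ := i3.add (i2.const_mul 2)
  rw [← integral_add i1 i4]
  refine integral_congr_ae (.of_forall fun ω => ?_)
  simp only [partialSum_succ]
  ring

theorem integral_partialSum_sq_le (H : DependenceBounds μ X F δ B c θ) (hδ0 : 0 < δ) (k : ℕ) :
    ∫ ω, partialSum X k ω ^ 2 ∂μ ≤ k * (c 0 + 2 * ∑' i : ℕ, ((i : ℝ) + 1) * θ i) := by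
  induction k with
  | zero => simp [partialSum_zero]
  | succ k ih =>
    rw [H.integral_partialSum_sq_succ hδ0]
    have h1 : ∑ i ∈ Finset.range k, c (i + 1) ≤ ∑' i : ℕ, ((i : ℝ) + 1) * θ i :=
      (Finset.sum_le_sum fun i _ => (le_abs_self _).trans (H.cov_le i)).trans
        (sum_range_le_weighted' H.theta_nonneg H.summable k)
    push_cast
    linarith

/-- The k-th increment of E S² differs from σ² by at most twice a tail of Σ θ, and the tails have a
bounded sum. A negative σ² would then make E S_n² negative for large n. -/
theorem integral_partialSum_sq_le_seriesVar (H : DependenceBounds μ X F δ B c θ) (hδ0 : 0 < δ)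
    (n : ℕ) : ∫ ω, partialSum X n ω ^ 2 ∂μ
      ≤ n * seriesVar c + 2 * ∑' i : ℕ, ((i : ℝ) + 1) * θ i := by
  have h : ∫ ω, partialSum X n ω ^ 2 ∂μ
      ≤ n * seriesVar c + 2 * ∑ k ∈ Finset.range n, ∑' i, θ (i + k) := by
    induction n with
    | zero => simp [partialSum_zero]
    | succ k ih =>
      rw [H.integral_partialSum_sq_succ hδ0, Finset.sum_range_succ]
      have := (abs_le.1 (H.abs_sum_cov_sub_le k)).2
      push_cast
      simp only [seriesVar] at ih ⊢
      linarith
  linarith [sum_tails_le_weighted H.theta_nonneg H.summable n]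

theorem seriesVar_nonneg (H : DependenceBounds μ X F δ B c θ) (hδ0 : 0 < δ) :
    0 ≤ seriesVar c := by
  by_contra! hneg
  obtain ⟨n, hn⟩ := exists_nat_gt ((2 * ∑' i : ℕ, ((i : ℝ) + 1) * θ i) / (-seriesVar c))
  rw [div_lt_iff₀ (by linarith)] at hn
  have h1 := H.integral_partialSum_sq_le_seriesVar hδ0 n
  have h2 : 0 ≤ ∫ ω, partialSum X n ω ^ 2 ∂μ := integral_nonneg fun ω => sq_nonneg _
  linarith

/-- The Lindeberg method: comparison of the partial sum with the Gaussian law. -/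
theorem exists_lindeberg_bound (H : DependenceBounds μ X F δ B c θ) (hδ0 : 0 < δ)
    (hδ1 : δ ≤ 1) : ∃ C : ℝ, ∀ (n : ℕ) (g g₁ g₂ : ℝ → ℝ), 1 ≤ n → HolderJet δ g g₁ g₂ → g₂ 0 = 0 →
      |∫ ω, g (partialSum X n ω) ∂μ
        - ∫ x, g x ∂(gaussianReal 0 (n * (seriesVar c).toNNReal))| ≤ C * n := by
  set v := (seriesVar c).toNNReal with hv
  have hvr : (v : ℝ) = seriesVar c := Real.coe_toNNReal _ (H.seriesVar_nonneg hδ0)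
  set T := ∑' i : ℕ, ((i : ℝ) + 1) * θ i with hT
  have hT0 : 0 ≤ T := tsum_nonneg fun i => mul_nonneg (by positivity) (H.theta_nonneg i)
  set Bv := ∫ y, |y| ^ (2 + δ) ∂(gaussianReal 0 v) with hBv
  set D := (v : ℝ) + (c 0 + 2 * T) with hD
  refine ⟨B + (4 + (1 + B)) * T + Bv + T * (2 + D), fun n g g₁ g₂ hn hg h0 => ?_⟩
  have hc0 : 0 ≤ c 0 := by
    rw [← H.cov 0 0 0 (by simp)]
    exact integral_nonneg fun ω => mul_self_nonneg _
  have hn1 : (1 : ℝ) ≤ n := by exact_mod_cast hn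
  -- The interpolation: k genuine increments, and n - k Gaussian increments of variance v
  -- represented by the average. Its ends are the two expectations to be compared.
  set a : ℕ → ℝ := fun k => ∫ ω, gaussAvg g (((n - k : ℕ) : ℝ≥0) * v) (partialSum X k ω) ∂μ with ha
  have han : a n = ∫ ω, g (partialSum X n ω) ∂μ := by
    simp [ha, gaussAvg_zero]
  have ha0 : a 0 = ∫ x, g x ∂(gaussianReal 0 (n * v)) := by
    simp [ha, partialSum_zero, gaussAvg]
  have hstep : ∀ k ∈ Finset.range n, |a (k + 1) - a k|
      ≤ (B + (4 + (1 + B)) * T + Bv) + (∑' i, θ (i + k)) * (2 + n * D) := by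
    intro k hk
    have hk' := Finset.mem_range.1 hk
    set w : ℝ≥0 := ((n - (k + 1) : ℕ) : ℝ≥0) * v with hw
    -- One Gaussian increment is peeled off. Both a (k + 1) and a k are then compared with the
    -- average of variance w evaluated at S_k, and the terms σ²/2 · E g₂ cancel.
    have hwv : ((n - k : ℕ) : ℝ≥0) * v = v + w := by
      have : n - k = n - (k + 1) + 1 := by omega
      rw [this, hw]
      push_cast
      ring
    have hj := hg.gaussAvg hδ0 w
    have s1 := H.lindeberg_step hδ0 hj k
    have iG := (hj.gaussAvg hδ0 v).integrable_comp hδ0 (H.memLp_partialSum k)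
    have i0 := hj.integrable_comp hδ0 (H.memLp_partialSum k)
    have i2 := hj.integrable_two_comp hδ0 (H.memLp_partialSum k)
    have s2 : |∫ ω, gaussAvg (gaussAvg g w) v (partialSum X k ω) ∂μ
        - ∫ ω, gaussAvg g w (partialSum X k ω) ∂μ
        - seriesVar c / 2 * ∫ ω, gaussAvg g₂ w (partialSum X k ω) ∂μ| ≤ Bv := by
      rw [← integral_const_mul, ← integral_sub_sub iG i0 (i2.const_mul _), ← hvr]
      exact abs_integral_le_of_abs_le fun ω => abs_gaussAvg_sub_le hδ0 hj v _
    rw [gaussAvg_gaussAvg hδ0 hg v w, ← hwv] at s2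
    -- Linear growth in n is affordable, since this quantity multiplies the tails of Σ θ, whose sum
    -- over k is at most T. The crude bound |x|^δ ≤ 1 + x² and the variance bounds therefore
    -- suffice.
    have s3 : |∫ ω, gaussAvg g₂ w (partialSum X k ω) ∂μ| ≤ 2 + n * D := by
      have q1 : Integrable (fun ω => partialSum X k ω ^ 2) μ := by
        simpa only [sq] using
          integrable_mul_of_memLp hδ0 (H.memLp_partialSum k) (H.memLp_partialSum k)
      have q2 := abs_gaussAvg_two_zero_le hδ0 hδ1 hg h0 w
      have q3 := H.integral_partialSum_sq_le hδ0 k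
      rw [← hT] at q3
      have q4 : |∫ ω, gaussAvg g₂ w (partialSum X k ω) ∂μ|
          ≤ ∫ ω, ((1 + (w : ℝ)) + (1 + partialSum X k ω ^ 2)) ∂μ := by
        refine abs_integral_le_integral_abs.trans (integral_mono_of_nonneg
          (.of_forall fun _ => abs_nonneg _)
          ((integrable_const _).add ((integrable_const _).add q1)) (.of_forall fun ω => ?_))
        exact (hj.abs_two_le _).trans (add_le_add q2 (abs_rpow_le_one_add_sq hδ0 hδ1 _))
      have q5 : ∫ ω, ((1 + (w : ℝ)) + (1 + partialSum X k ω ^ 2)) ∂μ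
          = (1 + w) + (1 + ∫ ω, partialSum X k ω ^ 2 ∂μ) := by
        have : Integrable (fun ω => 1 + partialSum X k ω ^ 2) μ := (integrable_const _).add q1
        rw [integral_add (integrable_const _) this, integral_add (integrable_const _) q1]
        simp
      have q6 : (w : ℝ) ≤ n * v := by
        have : ((n - (k + 1) : ℕ) : ℝ) ≤ n := by exact_mod_cast Nat.sub_le _ _
        rw [hw, NNReal.coe_mul, NNReal.coe_natCast]
        exact mul_le_mul_of_nonneg_right this v.2
      have q7 : (k : ℝ) * (c 0 + 2 * T) ≤ n * (c 0 + 2 * T) := by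
        gcongr
      rw [q5] at q4
      rw [hD, mul_add]
      linarith
    have ht : 0 ≤ ∑' i, θ (i + k) := tsum_nonneg fun i => H.theta_nonneg _
    have s4 := mul_le_mul_of_nonneg_left s3 ht
    simp only [ha]
    rw [← hT] at s1
    rw [abs_le] at s1 s2 ⊢
    constructor <;> linarith [s1.1, s1.2, s2.1, s2.2]
  rw [← han, ← ha0, ← Finset.sum_range_sub a n]
  refine (Finset.abs_sum_le_sum_abs _ _).trans ((Finset.sum_le_sum hstep).trans ?_)
  rw [Finset.sum_add_distrib, ← Finset.sum_mul]
  have ht := sum_tails_le_weighted H.theta_nonneg H.summable n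
  rw [← hT] at ht
  have hD0 : 0 ≤ D := by positivity
  have hfin : (∑ k ∈ Finset.range n, ∑' i, θ (i + k)) * (2 + n * D) ≤ T * (2 + D) * n := by
    calc _ ≤ T * (2 + n * D) := mul_le_mul_of_nonneg_right ht (by positivity)
      _ ≤ T * ((2 + D) * n) := by
          gcongr
          nlinarith
      _ = _ := by ring
  simp only [Finset.sum_const, Finset.card_range, nsmul_eq_mul]
  linarith

end DependenceBounds

/-! ### From the Lindeberg bound to the distances -/

/-- Homogeneity of degree 2 + δ: with s = √n the factor s^{2+δ} = n^{1+δ/2} turns a bound C n for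
S_n into C n^{-δ/2} for the normalized sum. -/
theorem HolderJet.rescale {δ s : ℝ} (hδ0 : 0 < δ) (hs : 0 < s) {g g₁ g₂ : ℝ → ℝ}
    (hg : HolderJet δ g g₁ g₂) :
    HolderJet δ (fun x => s ^ (2 + δ) * g (x / s)) (fun x => s ^ (1 + δ) * g₁ (x / s))
      (fun x => s ^ δ * g₂ (x / s)) := by
  have e1 : s ^ (1 + δ) = s ^ δ * s := by
    rw [add_comm, Real.rpow_add_one' hs.le (by linarith)]
  have e2 : s ^ (2 + δ) = s ^ δ * s * s := by
    rw [show 2 + δ = (1 + δ) + 1 by ring, Real.rpow_add_one' hs.le (by linarith), e1]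
  have hpow : ∀ (p h : ℝ), s ^ p * |h / s| ^ p = |h| ^ p := fun p h => by
    rw [abs_div, abs_of_pos hs, Real.div_rpow (abs_nonneg _) hs.le]
    have : s ^ p ≠ 0 := by positivity
    field_simp
  refine ⟨fun x h => ?_, fun x h => ?_, fun x h => ?_⟩
  · have := mul_le_mul_of_nonneg_left (hg.zero (x / s) (h / s)) (by positivity : 0 ≤ s ^ (2 + δ))
    rw [hpow] at this
    refine le_trans (le_of_eq ?_) this
    rw [← abs_of_pos (by positivity : 0 < s ^ (2 + δ)), ← abs_mul,
      abs_of_pos (by positivity : 0 < s ^ (2 + δ)), add_div]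
    congr 1
    rw [e2, e1]
    field_simp
  · have := mul_le_mul_of_nonneg_left (hg.one (x / s) (h / s)) (by positivity : 0 ≤ s ^ (1 + δ))
    rw [hpow] at this
    refine le_trans (le_of_eq ?_) this
    rw [← abs_of_pos (by positivity : 0 < s ^ (1 + δ)), ← abs_mul,
      abs_of_pos (by positivity : 0 < s ^ (1 + δ)), add_div]
    congr 1
    rw [e1]
    field_simp
  · have := mul_le_mul_of_nonneg_left (hg.two (x / s) (h / s)) (by positivity : 0 ≤ s ^ δ)
    rw [hpow] at this
    refine le_trans (le_of_eq ?_) this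
    rw [← abs_of_pos (by positivity : 0 < s ^ δ), ← abs_mul,
      abs_of_pos (by positivity : 0 < s ^ δ), add_div]
    congr 1
    ring

theorem normSum_eq {Ω : Type*} (X : ℤ → Ω → ℝ) (n : ℕ) (ω : Ω) :
    normSum X n ω = partialSum X n ω / Real.sqrt n := by
  rw [normSum, partialSum, div_eq_inv_mul]
  congr 1
  rw [Finset.sum_bij (fun i _ => i - 1) (t := Finset.range n)
    (g := fun i => X ((i : ℤ) + 1) ω)]
  · intro a ha
    have := Finset.mem_Icc.1 ha
    rw [Finset.mem_range]
    omega
  · intro a ha b hb hab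
    have h1 := Finset.mem_Icc.1 ha
    have h2 := Finset.mem_Icc.1 hb
    omega
  · intro b hb
    have := Finset.mem_range.1 hb
    exact ⟨b + 1, Finset.mem_Icc.2 ⟨by omega, by omega⟩, by simp⟩
  · intro a ha
    have := Finset.mem_Icc.1 ha
    congr 1
    push_cast [this.1]
    ring

theorem integral_gaussianReal_rescale (v : ℝ≥0) {n : ℕ} {f : ℝ → ℝ} (hf : Continuous f) :
    ∫ x, f x ∂(gaussianReal 0 (n * v)) = ∫ x, f (Real.sqrt n * x) ∂(gaussianReal 0 v) := by
  have h := gaussianReal_map_const_mul (μ := 0) (v := v) (Real.sqrt n)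
  have hs : (⟨Real.sqrt n ^ 2, sq_nonneg _⟩ : ℝ≥0) = n := by
    ext
    simp
  rw [mul_zero] at h
  have h' : gaussianReal 0 (n * v) = (gaussianReal 0 v).map (Real.sqrt n * ·) := by
    rw [h]
    congr 2
    exact hs.symm
  rw [h', integral_map (by fun_prop) hf.aestronglyMeasurable]

namespace DependenceBounds

variable {Ω : Type*} {mΩ : MeasurableSpace Ω} {μ : Measure Ω} [IsProbabilityMeasure μ]
  {X : ℤ → Ω → ℝ} {F : Filtration ℤ mΩ} {δ B : ℝ} {c θ : ℕ → ℝ}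

theorem measurable_normSum (H : DependenceBounds μ X F δ B c θ) (n : ℕ) :
    Measurable (normSum X n) := by
  have h := (H.measurable_partialSum n n le_rfl).mono (F.le n) le_rfl
  have e : normSum X n = fun ω => partialSum X n ω / Real.sqrt n := funext (normSum_eq X n)
  rw [e]
  exact h.div_const _

theorem memLp_map_normSum (H : DependenceBounds μ X F δ B c θ) (n : ℕ) :
    MemLp id (ENNReal.ofReal (2 + δ)) (μ.map (normSum X n)) := by
  rw [memLp_map_measure_iff measurable_id.aestronglyMeasurable (H.measurable_normSum n).aemeasurable]
  have e : id ∘ normSum X n = fun ω => (Real.sqrt n)⁻¹ * partialSum X n ω := by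
    ext ω
    simp [normSum_eq, div_eq_inv_mul]
  rw [e]
  exact (H.memLp_partialSum n).const_mul _

/-- The rate of convergence for the Zolotarev distance. -/
theorem exists_zolotarev_bound (H : DependenceBounds μ X F δ B c θ) (hδ0 : 0 < δ) (hδ1 : δ ≤ 1) :
    ∃ C : ℝ, 0 ≤ C ∧ ∀ n : ℕ, 1 ≤ n →
      zolotarev (2 + δ) (μ.map (normSum X n)) (gaussianReal 0 (seriesVar c).toNNReal)
        ≤ ENNReal.ofReal (C * (n : ℝ) ^ (-(δ / 2))) := by
  obtain ⟨C, hC⟩ := H.exists_lindeberg_bound hδ0 hδ1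
  refine ⟨|C|, abs_nonneg C, fun n hn => iSup₂_le fun f hf => ENNReal.ofReal_le_ofReal ?_⟩
  obtain ⟨hj, -, -, h2⟩ := holderJet_of_mem_zolClass hδ0 hδ1 hf
  have hn0 : (0 : ℝ) < n := by exact_mod_cast hn
  set s := Real.sqrt n with hs
  have hs0 : 0 < s := Real.sqrt_pos.2 hn0
  have hjs := hj.rescale hδ0 hs0
  have key := hC n _ _ _ hn hjs (by simp [h2])
  rw [integral_gaussianReal_rescale _ (hjs.continuous hδ0)] at key
  rw [integral_map (H.measurable_normSum n).aemeasurable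
    (hj.continuous hδ0).aestronglyMeasurable]
  simp only [normSum_eq]
  rw [integral_const_mul, integral_const_mul, ← mul_sub, abs_mul,
    abs_of_pos (by positivity : 0 < s ^ (2 + δ))] at key
  have hsx : ∀ x : ℝ, s * x / s = x := fun x => by field_simp
  simp only [← hs, hsx] at key ⊢
  have hpow : (n : ℝ) ^ (-(δ / 2)) = n / s ^ (2 + δ) := by
    rw [hs, Real.sqrt_eq_rpow, ← Real.rpow_mul hn0.le]
    nth_rewrite 2 [← Real.rpow_one (n : ℝ)]
    rw [← Real.rpow_sub hn0]
    congr 1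
    ring
  rw [hpow, mul_div_assoc', le_div_iff₀ (by positivity), mul_comm]
  exact key.trans (mul_le_mul_of_nonneg_right (le_abs_self C) hn0.le)

/-- The rate of convergence for the Wasserstein distance. -/
theorem exists_wasserstein_bound (H : DependenceBounds μ X F δ B c θ) (hδ0 : 0 < δ)
    (hδ1 : δ ≤ 1) :
    ∃ C : ℝ, ∀ n : ℕ, 1 ≤ n →
      wasserstein (2 + δ) (μ.map (normSum X n)) (gaussianReal 0 (seriesVar c).toNNReal)
        ≤ ENNReal.ofReal (C * (n : ℝ) ^ (-(δ / (4 + 2 * δ)))) := by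
  obtain ⟨C, hC0, hC⟩ := H.exists_zolotarev_bound hδ0 hδ1
  refine ⟨(16000 * C) ^ (1 / (2 + δ)), fun n hn => ?_⟩
  have := Measure.isProbabilityMeasure_map (μ := μ) (H.measurable_normSum n).aemeasurable
  have h1 := wasserstein_le_zolotarev hδ0 hδ1 (μ.map (normSum X n))
    (gaussianReal 0 (seriesVar c).toNNReal) (H.memLp_map_normSum n)
    (memLp_id_gaussianReal' _ (by simp))
  have hn0 : (0 : ℝ) ≤ n := by positivity
  refine h1.trans ?_
  calc _ ≤ (16000 * ENNReal.ofReal (C * (n : ℝ) ^ (-(δ / 2)))) ^ (1 / (2 + δ)) := by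
        gcongr
        exact hC n hn
    _ = ENNReal.ofReal ((16000 * C * (n : ℝ) ^ (-(δ / 2))) ^ (1 / (2 + δ))) := by
        rw [show (16000 : ℝ≥0∞) = ENNReal.ofReal 16000 by simp,
          ← ENNReal.ofReal_mul (by norm_num), ENNReal.ofReal_rpow_of_nonneg (by positivity)
          (by positivity), mul_assoc]
    _ = _ := by
        congr 1
        rw [Real.mul_rpow (by positivity) (by positivity), ← Real.rpow_mul hn0]
        congr 2
        field_simp
        ring

/-- Lipschitz test functions suffice for weak convergence, and their integrals are compared through
the comonotone coupling, whose cost is controlled by ζ_{2+δ}. -/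
theorem tendstoInDistribution (H : DependenceBounds μ X F δ B c θ) (hδ0 : 0 < δ) (hδ1 : δ ≤ 1) :
    TendstoInDistribution (normSum X) atTop (id : ℝ → ℝ) (fun _ => μ)
      (gaussianReal 0 (seriesVar c).toNNReal) := by
  refine ⟨fun n => (H.measurable_normSum n).aemeasurable, aemeasurable_id, ?_⟩
  refine tendsto_iff_forall_lipschitz_integral_tendsto.2 ?_
  rintro f - ⟨L, hL⟩
  obtain ⟨C, hC0, hC⟩ := H.exists_zolotarev_bound hδ0 hδ1
  simp only [ProbabilityMeasure.coe_mk, Measure.map_id]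
  rw [tendsto_iff_norm_sub_tendsto_zero]
  have hlim : Tendsto (fun n : ℕ => (L : ℝ≥0∞)
      * (16000 * ENNReal.ofReal (C * (n : ℝ) ^ (-(δ / 2)))) ^ (1 / (2 + δ))) atTop (𝓝 0) := by
    have t1 : Tendsto (fun n : ℕ => (n : ℝ) ^ (-(δ / 2))) atTop (𝓝 0) :=
      (tendsto_rpow_neg_atTop (by positivity)).comp tendsto_natCast_atTop_atTop
    have t2 : Tendsto (fun n : ℕ => ENNReal.ofReal (C * (n : ℝ) ^ (-(δ / 2)))) atTop (𝓝 0) := by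
      have := ENNReal.tendsto_ofReal (t1.const_mul C)
      simpa using this
    have t3 := ENNReal.Tendsto.const_mul t2 (a := 16000) (Or.inr (by simp))
    rw [mul_zero] at t3
    have t4 := t3.ennrpow_const (1 / (2 + δ))
    rw [ENNReal.zero_rpow_of_pos (by positivity)] at t4
    have t5 := ENNReal.Tendsto.const_mul t4 (a := (L : ℝ≥0∞)) (Or.inr (by simp))
    rwa [mul_zero] at t5
  have hE : Tendsto (fun n : ℕ => ENNReal.ofReal ‖∫ x, f x ∂(μ.map (normSum X n))
      - ∫ x, f x ∂(gaussianReal 0 (seriesVar c).toNNReal)‖) atTop (𝓝 0) := by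
    refine tendsto_of_tendsto_of_tendsto_of_le_of_le' tendsto_const_nhds hlim
      (.of_forall fun _ => zero_le) ?_
    filter_upwards [eventually_ge_atTop 1] with n hn
    have := Measure.isProbabilityMeasure_map (μ := μ) (H.measurable_normSum n).aemeasurable
    refine (abs_integral_sub_le_zolotarev hδ0 hδ1 (μ.map (normSum X n))
      (gaussianReal 0 (seriesVar c).toNNReal) (H.memLp_map_normSum n)
      (memLp_id_gaussianReal' _ (by simp)) hL).trans ?_
    gcongr
    exact hC n hn
  have := (ENNReal.tendsto_toReal ENNReal.zero_ne_top).comp hE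
  simpa [Function.comp_def, ENNReal.toReal_ofReal] using this

theorem cov_eq (H : DependenceBounds μ X F δ B c θ) (hδ0 : 0 < δ) (k : ℤ) :
    cov[X 0, X k; μ] = c k.natAbs := by
  have h2 : (2 : ℝ≥0∞) ≤ ENNReal.ofReal (2 + δ) := by
    rw [show (2 : ℝ≥0∞) = ENNReal.ofReal 2 by simp]
    exact ENNReal.ofReal_le_ofReal (by linarith)
  rw [covariance_eq_sub ((H.memLp 0).mono_exponent h2) ((H.memLp k).mono_exponent h2),
    H.mean 0, zero_mul, sub_zero]
  rcases Int.natAbs_eq k with h | h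
  · exact H.cov 0 k k.natAbs (by omega)
  · rw [← H.cov k 0 k.natAbs (by omega)]
    refine integral_congr_ae (.of_forall fun ω => ?_)
    simp only [Pi.mul_apply]
    ring

theorem hasSum_cov (H : DependenceBounds μ X F δ B c θ) (hδ0 : 0 < δ) :
    HasSum (fun k : ℤ => cov[X 0, X k; μ]) (seriesVar c) := by
  have hs := H.summable_cov.hasSum
  have h1 : HasSum (fun n : ℕ => cov[X 0, X (n : ℤ); μ]) (c 0 + ∑' i, c (i + 1)) := by
    have : (fun n : ℕ => cov[X 0, X (n : ℤ); μ]) = c := by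
      ext n
      rw [H.cov_eq hδ0]
      simp
    rw [this]
    have := (hasSum_nat_add_iff (f := c) 1).1 hs
    simpa [add_comm] using this
  have h2 : HasSum (fun n : ℕ => cov[X 0, X (-((n : ℤ) + 1)); μ]) (∑' i, c (i + 1)) := by
    have : (fun n : ℕ => cov[X 0, X (-((n : ℤ) + 1)); μ]) = fun i => c (i + 1) := by
      ext n
      rw [H.cov_eq hδ0, show (-((n : ℤ) + 1)).natAbs = n + 1 by omega]
    rw [this]
    exact hs
  have e : seriesVar c = c 0 + ∑' i, c (i + 1) + ∑' i, c (i + 1) := by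
    rw [seriesVar]
    ring
  rw [e]
  exact HasSum.of_nat_of_neg_add_one h1 h2

end DependenceBounds

/-! ### Consequences of stationarity -/

theorem IsStationary.map_shift {Ω : Type*} {mΩ : MeasurableSpace Ω} {S : Type*}
    [MeasurableSpace S] {μ : Measure Ω} {Z : ℤ → Ω → S} (h : IsStationary μ Z) (m : ℤ) :
    μ.map (fun ω (i : ℤ) => Z (i + m) ω) = μ.map (fun ω (i : ℤ) => Z i ω) := by
  obtain ⟨hm, h1⟩ := h
  have hmeas : ∀ j : ℤ, Measurable fun ω (i : ℤ) => Z (i + j) ω := fun j =>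
    measurable_pi_lambda _ fun i => hm _
  have hstep : ∀ j : ℤ, μ.map (fun ω (i : ℤ) => Z (i + (j + 1)) ω)
      = μ.map (fun ω (i : ℤ) => Z (i + j) ω) := by
    intro j
    have hT : Measurable fun (x : ℤ → S) (i : ℤ) => x (i + j) :=
      measurable_pi_lambda _ fun i => measurable_pi_apply _
    have e1 : μ.map (fun ω (i : ℤ) => Z (i + (j + 1)) ω)
        = (μ.map (fun ω (i : ℤ) => Z (i + 1) ω)).map fun (x : ℤ → S) (i : ℤ) => x (i + j) := by
      rw [Measure.map_map hT (hmeas 1)]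
      congr 1
      ext ω i
      simp [add_assoc]
    have e2 : μ.map (fun ω (i : ℤ) => Z (i + j) ω)
        = (μ.map (fun ω (i : ℤ) => Z i ω)).map fun (x : ℤ → S) (i : ℤ) => x (i + j) := by
      rw [Measure.map_map hT (measurable_pi_lambda _ fun i => hm _)]
      rfl
    rw [e1, e2, h1]
  induction m with
  | zero => simp
  | succ i ih => rw [hstep, ih]
  | pred i ih =>
    rw [← ih, ← hstep (-(i : ℤ) - 1)]
    simp

/-- A centered sequence with finite moments of order `2 + δ`, adapted to `F`, such that the joint
laws of bounded past variables and of pairs of coordinates can be moved to time `0`. -/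
structure IsTransferable {Ω : Type*} {mΩ : MeasurableSpace Ω} (μ : Measure Ω) (X : ℤ → Ω → ℝ)
    (F : Filtration ℤ mΩ) (δ : ℝ) : Prop where
  adapted : ∀ i, Measurable[F i] (X i)
  transfer : ∀ (m : ℤ) (W : Ω → ℝ), Measurable[F m] W → (∀ ω, |W ω| ≤ 1) →
    ∃ W' : Ω → ℝ, Measurable[F 0] W' ∧ (∀ ω, |W' ω| ≤ 1) ∧ ∀ n q : ℤ,
      μ.map (fun ω => (W ω, X (n + m) ω, X (q + m) ω)) = μ.map (fun ω => (W' ω, X n ω, X q ω))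
  memLp_zero : MemLp (X 0) (ENNReal.ofReal (2 + δ)) μ
  mean_zero : ∫ ω, X 0 ω ∂μ = 0

/-- A variable measurable at time m is a function w of the past of Y up to m. Applying w to the past
up to 0 gives W', and shift invariance of the law of (X, Y) identifies the joint laws with X. -/
theorem IsStationaryAdapted.isTransferable {Ω : Type u} {mΩ : MeasurableSpace Ω} {μ : Measure Ω}
    {X : ℤ → Ω → ℝ} {F : Filtration ℤ mΩ} {δ : ℝ} (h : IsStationaryAdapted μ X F)
    (hmom : MemLp (X 0) (ENNReal.ofReal (2 + δ)) μ) (hcent : ∫ ω, X 0 ω ∂μ = 0) :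
    IsTransferable μ X F δ := by
  obtain ⟨had, E, mE, Y, hst, hF⟩ := h
  refine ⟨had, fun m W hW hb => ?_, hmom, hcent⟩
  set past : ℤ → Ω → (Set.Iic (0 : ℤ) → E) := fun m ω j => Y (j + m) ω with hpast
  have hcomap : ∀ m : ℤ, MeasurableSpace.comap (past m) MeasurableSpace.pi = F m := by
    intro m
    rw [hF m, MeasurableSpace.pi, MeasurableSpace.comap_iSup]
    simp only [MeasurableSpace.comap_comp]
    refine le_antisymm (iSup_le fun j => ?_) (iSup₂_le fun j hj => ?_)
    · refine le_iSup₂_of_le ((j : ℤ) + m) (by have : (j : ℤ) ≤ 0 := j.2; omega) le_rfl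
    · refine le_iSup_of_le ⟨j - m, by simp; omega⟩ (le_of_eq ?_)
      congr 1
      ext ω
      simp [hpast]
  have hY : ∀ i, Measurable (Y i) := fun i => (hst.1 i).snd
  have hX : ∀ i, Measurable (X i) := fun i => (hst.1 i).fst
  have hW2 : Measurable[MeasurableSpace.comap (past m) MeasurableSpace.pi] W := by
    rw [hcomap]; exact hW
  obtain ⟨w, hw, hwW⟩ := hW2.exists_eq_measurable_comp
  -- The bound on w is known only along the past at time m; clamping makes it valid along the past
  -- at time 0 without changing W.
  set w' : (Set.Iic (0 : ℤ) → E) → ℝ := fun y => max (-1) (min 1 (w y)) with hw'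
  have hw'm : Measurable w' := measurable_const.max (measurable_const.min hw)
  have hW' : W = fun ω => w' (past m ω) := by
    ext ω
    have h1 := abs_le.1 (hb ω)
    have h2 : W ω = w (past m ω) := congrFun hwW ω
    rw [h2] at h1 ⊢
    simp [hw', h1.1, h1.2]
  refine ⟨fun ω => w' (past 0 ω), ?_, fun ω => ?_, fun n q => ?_⟩
  · rw [← hcomap 0]
    exact hw'm.comp (comap_measurable _)
  · rw [abs_le]
    exact ⟨le_max_left _ _, max_le (by norm_num) (min_le_left _ _)⟩
  · set Φ : (ℤ → ℝ × E) → ℝ × ℝ × ℝ :=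
      fun x => (w' (fun j => (x j).2), (x n).1, (x q).1) with hΦ
    have hΦm : Measurable Φ := by
      refine (hw'm.comp (measurable_pi_lambda _ fun j => ?_)).prodMk
        (((measurable_pi_apply n).fst).prodMk ((measurable_pi_apply q).fst))
      exact (measurable_pi_apply (j : ℤ)).snd
    have hm1 : ∀ m : ℤ, Measurable fun ω (i : ℤ) => (X (i + m) ω, Y (i + m) ω) := fun m =>
      measurable_pi_lambda _ fun i => hst.1 _
    have hm2 : Measurable fun ω (i : ℤ) => (X i ω, Y i ω) :=
      measurable_pi_lambda _ fun i => hst.1 _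
    have e1 : (fun ω => (W ω, X (n + m) ω, X (q + m) ω))
        = Φ ∘ fun ω (i : ℤ) => (X (i + m) ω, Y (i + m) ω) := by
      rw [hW']
      rfl
    have e2 : (fun ω => (w' (past 0 ω), X n ω, X q ω))
        = Φ ∘ fun ω (i : ℤ) => (X i ω, Y i ω) := by
      ext ω : 1
      simp [hΦ, hpast]
    rw [e1, e2, ← Measure.map_map hΦm (hm1 m), ← Measure.map_map hΦm hm2, hst.map_shift m]

namespace IsTransferable

variable {Ω : Type*} {mΩ : MeasurableSpace Ω} {μ : Measure Ω} {X : ℤ → Ω → ℝ}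
  {F : Filtration ℤ mΩ} {δ : ℝ}

theorem measurable (h : IsTransferable μ X F δ) (i : ℤ) : Measurable (X i) :=
  (h.adapted i).mono (F.le i) le_rfl

theorem integral_pair (h : IsTransferable μ X F δ) {φ : ℝ × ℝ → ℝ} (hφ : Measurable φ)
    (n q m : ℤ) : ∫ ω, φ (X (n + m) ω, X (q + m) ω) ∂μ = ∫ ω, φ (X n ω, X q ω) ∂μ := by
  obtain ⟨W', hW', -, hlaw⟩ := h.transfer m (fun _ => 0) measurable_const (by simp)
  have hW'' : Measurable W' := hW'.mono (F.le 0) le_rfl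
  have hm1 : Measurable fun ω => ((0 : ℝ), X (n + m) ω, X (q + m) ω) :=
    measurable_const.prodMk ((h.measurable _).prodMk (h.measurable _))
  have hm2 : Measurable fun ω => (W' ω, X n ω, X q ω) :=
    hW''.prodMk ((h.measurable _).prodMk (h.measurable _))
  have hψ : Measurable fun z : ℝ × ℝ × ℝ => φ z.2 := hφ.comp measurable_snd
  have e1 := integral_map (μ := μ) hm1.aemeasurable (f := fun z : ℝ × ℝ × ℝ => φ z.2)
    hψ.aestronglyMeasurable
  have e2 := integral_map (μ := μ) hm2.aemeasurable (f := fun z : ℝ × ℝ × ℝ => φ z.2)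
    hψ.aestronglyMeasurable
  rw [← e1, hlaw, e2]

theorem integral_single (h : IsTransferable μ X F δ) {φ : ℝ → ℝ} (hφ : Measurable φ)
    (n : ℤ) : ∫ ω, φ (X n ω) ∂μ = ∫ ω, φ (X 0 ω) ∂μ := by
  have := h.integral_pair (φ := fun z => φ z.1) (hφ.comp measurable_fst) 0 0 n
  simpa using this

theorem map_eq (h : IsTransferable μ X F δ) (m : ℤ) : μ.map (X m) = μ.map (X 0) := by
  obtain ⟨W', hW', -, hlaw⟩ := h.transfer m (fun _ => 0) measurable_const (by simp)
  have hW'' : Measurable W' := hW'.mono (F.le 0) le_rfl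
  have hm1 : Measurable fun ω => ((0 : ℝ), X (0 + m) ω, X (0 + m) ω) :=
    measurable_const.prodMk ((h.measurable _).prodMk (h.measurable _))
  have hm2 : Measurable fun ω => (W' ω, X 0 ω, X 0 ω) :=
    hW''.prodMk ((h.measurable _).prodMk (h.measurable _))
  have hψ : Measurable fun z : ℝ × ℝ × ℝ => z.2.1 := by fun_prop
  have := congrArg (Measure.map fun z : ℝ × ℝ × ℝ => z.2.1) (hlaw 0 0)
  rw [Measure.map_map hψ hm1, Measure.map_map hψ hm2] at this
  simpa [Function.comp_def] using this

theorem memLp (h : IsTransferable μ X F δ) (m : ℤ) : MemLp (X m) (ENNReal.ofReal (2 + δ)) μ := by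
  have := h.memLp_zero
  rw [← Function.id_comp (X 0), ← memLp_map_measure_iff measurable_id.aestronglyMeasurable
    (h.measurable 0).aemeasurable, ← h.map_eq m, memLp_map_measure_iff
    measurable_id.aestronglyMeasurable (h.measurable m).aemeasurable] at this
  exact this

theorem mean (h : IsTransferable μ X F δ) (m : ℤ) : ∫ ω, X m ω ∂μ = 0 := by
  rw [← h.mean_zero]
  exact h.integral_single measurable_id m

end IsTransferable

/-! ### Truncation -/

/-- Truncation of a real number at level `M`. -/
def clip (M x : ℝ) : ℝ := max (-M) (min M x)

theorem measurable_clip (M : ℝ) : Measurable (clip M) :=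
  measurable_const.max (measurable_const.min measurable_id)

theorem abs_clip_le {M : ℝ} (hM : 0 ≤ M) (x : ℝ) : |clip M x| ≤ M :=
  abs_le.2 ⟨le_max_left _ _, max_le (by linarith) (min_le_left _ _)⟩

theorem clip_of_abs_le {M x : ℝ} (h : |x| ≤ M) : clip M x = x := by
  have := abs_le.1 h
  simp [clip, this.1, this.2]

theorem abs_sub_clip_le {M : ℝ} (hM : 0 ≤ M) (x : ℝ) : |x - clip M x| ≤ |x| := by
  unfold clip
  rcases le_total x M with h | h
  · rcases le_total (-M) x with h' | h'
    · rw [min_eq_right h, max_eq_right h']; simp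
    · rw [min_eq_right h, max_eq_left h', abs_of_nonpos (by linarith), abs_of_nonpos (by linarith)]
      linarith
  · rw [min_eq_left h, max_eq_right (by linarith), abs_of_nonneg (by linarith),
      abs_of_nonneg (by linarith)]
    linarith

/-- The function `|x| ^ q 1_{|x| > M}`. -/
noncomputable def tailPow (q M x : ℝ) : ℝ := if M < |x| then |x| ^ q else 0

theorem measurable_tailPow (q M : ℝ) : Measurable (tailPow q M) :=
  Measurable.ite (measurableSet_lt measurable_const (by fun_prop)) (by fun_prop) measurable_const

theorem tailPow_nonneg (q M x : ℝ) : 0 ≤ tailPow q M x := by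
  unfold tailPow
  split_ifs <;> positivity

theorem tailPow_le (q M x : ℝ) : tailPow q M x ≤ |x| ^ q := by
  unfold tailPow
  split_ifs
  · exact le_rfl
  · positivity

theorem tailPow_of_lt {q M x : ℝ} (h : M < |x|) : tailPow q M x = |x| ^ q := if_pos h

theorem tailPow_of_le {q M x : ℝ} (h : |x| ≤ M) : tailPow q M x = 0 := if_neg (not_lt.2 h)

theorem tailPow_anti {q M N x : ℝ} (h : M ≤ N) : tailPow q N x ≤ tailPow q M x := by
  by_cases hN : N < |x|
  · rw [tailPow_of_lt hN, tailPow_of_lt (h.trans_lt hN)]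
  · rw [tailPow_of_le (not_lt.1 hN)]
    exact tailPow_nonneg _ _ _

theorem abs_sub_clip_le_tailPow {M : ℝ} (hM : 0 ≤ M) (x : ℝ) : |x - clip M x| ≤ tailPow 1 M x := by
  by_cases h : M < |x|
  · rw [tailPow_of_lt h, Real.rpow_one]
    exact abs_sub_clip_le hM x
  · rw [clip_of_abs_le (not_lt.1 h), sub_self, abs_zero]
    exact tailPow_nonneg _ _ _

theorem rpow_mul_tailPow_le {M p q : ℝ} (hM : 0 ≤ M) (hp : 0 ≤ p) (hq : 0 ≤ q) (x : ℝ) :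
    M ^ p * tailPow q M x ≤ tailPow (p + q) M x := by
  by_cases h : M < |x|
  · rw [tailPow_of_lt h, tailPow_of_lt h, Real.rpow_add_of_nonneg (abs_nonneg _) hp hq]
    gcongr
  · rw [tailPow_of_le (not_lt.1 h), tailPow_of_le (not_lt.1 h), mul_zero]

theorem rpow_mul_mul_le_tailPow {δ M : ℝ} (hδ0 : 0 < δ) {x y z : ℝ}
    (h : M < |x| ∨ M < |y| ∨ M < |z|) :
    |x| ^ δ * (|y| * |z|)
      ≤ tailPow (2 + δ) M x + tailPow (2 + δ) M y + tailPow (2 + δ) M z := by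
  have key : ∀ w : ℝ, |x| ≤ |w| → |y| ≤ |w| → |z| ≤ |w| →
      |x| ^ δ * (|y| * |z|) ≤ tailPow (2 + δ) M w := by
    intro w h1 h2 h3
    have hw : M < |w| := by
      rcases h with h | h | h <;> linarith
    rw [tailPow_of_lt hw]
    calc |x| ^ δ * (|y| * |z|) ≤ |w| ^ δ * (|w| * |w|) := by gcongr
      _ = |w| ^ (2 + δ) := by
          rw [← sq, ← Real.rpow_natCast, ← Real.rpow_add_of_nonneg (abs_nonneg _) hδ0.le
            (by norm_num)]
          congr 1
          push_cast
          ring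
  have px := tailPow_nonneg (2 + δ) M x
  have py := tailPow_nonneg (2 + δ) M y
  have pz := tailPow_nonneg (2 + δ) M z
  rcases le_total |x| |y| with h1 | h1
  · rcases le_total |y| |z| with h2 | h2
    · linarith [key z (h1.trans h2) h2 le_rfl]
    · linarith [key y h1 le_rfl h2]
  · rcases le_total |x| |z| with h2 | h2
    · linarith [key z h2 (h1.trans h2) le_rfl]
    · linarith [key x le_rfl h1 h2]

/-- The centered truncation of a random variable. -/
noncomputable def ctrunc {Ω : Type*} {mΩ : MeasurableSpace Ω} (μ : Measure Ω) (M : ℝ) (U : Ω → ℝ)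
    (ω : Ω) : ℝ := clip M (U ω) - ∫ ω', clip M (U ω') ∂μ

/-- Weak dependence, across a time gap `k`, of the truncated variables at level `M`. -/
def TruncDep {Ω : Type*} {mΩ : MeasurableSpace Ω} (μ : Measure Ω) (X : ℤ → Ω → ℝ)
    (F : Filtration ℤ mΩ) (M κ : ℝ) (k : ℕ) : Prop :=
  (∀ W : Ω → ℝ, Measurable[F 0] W → (∀ ω, |W ω| ≤ 1) → |∫ ω, W ω * ctrunc μ M (X k) ω ∂μ| ≤ κ) ∧
  ∀ (W : Ω → ℝ) (l : ℕ), Measurable[F 0] W → (∀ ω, |W ω| ≤ 1) →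
    |∫ ω, W ω * (ctrunc μ M (X k) ω * ctrunc μ M (X (k + l)) ω
      - ∫ ω', ctrunc μ M (X k) ω' * ctrunc μ M (X (k + l)) ω' ∂μ) ∂μ| ≤ M * κ

theorem abs_integral_le_add {Ω : Type*} {mΩ : MeasurableSpace Ω} {μ : Measure Ω} {f h D : Ω → ℝ}
    (hf : AEStronglyMeasurable f μ) (hh : Integrable h μ) (hD : Integrable D μ)
    (hle : ∀ ω, |f ω - h ω| ≤ D ω) : |∫ ω, f ω ∂μ| ≤ |∫ ω, h ω ∂μ| + ∫ ω, D ω ∂μ := by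
  have hsub : Integrable (fun ω => f ω - h ω) μ := hD.mono' (hf.sub hh.1) (.of_forall hle)
  have e : ∫ ω, f ω ∂μ = ∫ ω, h ω ∂μ + ∫ ω, (f ω - h ω) ∂μ := by
    rw [← integral_add hh hsub]
    simp
  rw [e]
  refine (abs_add_le _ _).trans (add_le_add le_rfl ?_)
  exact abs_integral_le_integral_abs.trans (integral_mono_of_nonneg
    (.of_forall fun _ => abs_nonneg _) hD (.of_forall hle))

/-! ### From dependence of truncated variables to dependence of the variables -/

namespace IsTransferable

variable {Ω : Type*} {mΩ : MeasurableSpace Ω} {μ : Measure Ω}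
  {X : ℤ → Ω → ℝ} {F : Filtration ℤ mΩ} {δ M κ : ℝ} {k : ℕ}

theorem integral_clip (h : IsTransferable μ X F δ) (M : ℝ) (n : ℤ) :
    ∫ ω, clip M (X n ω) ∂μ = ∫ ω, clip M (X 0 ω) ∂μ := h.integral_single (measurable_clip M) n

theorem measurable_ctrunc (h : IsTransferable μ X F δ) (M : ℝ) (n : ℤ) :
    Measurable (ctrunc μ M (X n)) :=
  ((measurable_clip M).comp (h.measurable n)).sub measurable_const

theorem integral_tailPow (h : IsTransferable μ X F δ) (q M : ℝ) (n : ℤ) :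
    ∫ ω, tailPow q M (X n ω) ∂μ = ∫ ω, tailPow q M (X 0 ω) ∂μ :=
  h.integral_single (measurable_tailPow q M) n

variable [IsProbabilityMeasure μ]

theorem abs_integral_clip_le_level (hM : 0 ≤ M) (U : Ω → ℝ) : |∫ ω, clip M (U ω) ∂μ| ≤ M :=
  abs_integral_le_of_abs_le fun ω => abs_clip_le hM (U ω)

theorem abs_ctrunc_le (hM : 0 ≤ M) (U : Ω → ℝ) (ω : Ω) : |ctrunc μ M U ω| ≤ 2 * M := by
  have h1 := abs_clip_le hM (U ω)
  have h2 := abs_integral_clip_le_level (μ := μ) hM U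
  have h3 := abs_sub (clip M (U ω)) (∫ ω', clip M (U ω') ∂μ)
  unfold ctrunc
  linarith

theorem integrable_tailPow (h : IsTransferable μ X F δ) {q : ℝ} (hq0 : 0 ≤ q) (hq : q ≤ 2 + δ)
    (M : ℝ) (n : ℤ) : Integrable (fun ω => tailPow q M (X n ω)) μ := by
  refine (integrable_abs_rpow hq0 hq (h.memLp n)).mono'
    ((measurable_tailPow q M).comp (h.measurable n)).aestronglyMeasurable (.of_forall fun ω => ?_)
  rw [Real.norm_of_nonneg (tailPow_nonneg _ _ _)]
  exact tailPow_le _ _ _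

/-- Since X 0 is centered, the mean of its truncation is minus the mean of the discarded excess, so
recentering costs no more than a tail term. -/
theorem rpow_mul_abs_integral_clip_le (h : IsTransferable μ X F δ) (hM : 0 ≤ M) {q : ℝ}
    (hδ0 : 0 < δ) (hq : 0 ≤ q) (hq1 : q + 1 ≤ 2 + δ) :
    M ^ q * |∫ ω, clip M (X 0 ω) ∂μ| ≤ ∫ ω, tailPow (q + 1) M (X 0 ω) ∂μ := by
  have iX : Integrable (X 0) μ := integrable_of_memLp hδ0 (h.memLp 0)
  have iC : Integrable (fun ω => clip M (X 0 ω)) μ :=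
    Integrable.of_bound ((measurable_clip M).comp (h.measurable 0)).aestronglyMeasurable M
      (.of_forall fun ω => abs_clip_le hM _)
  have e : ∫ ω, clip M (X 0 ω) ∂μ = -∫ ω, (X 0 ω - clip M (X 0 ω)) ∂μ := by
    rw [integral_sub iX iC, h.mean_zero]
    ring
  rw [e, abs_neg]
  calc M ^ q * |∫ ω, (X 0 ω - clip M (X 0 ω)) ∂μ|
      ≤ M ^ q * ∫ ω, tailPow 1 M (X 0 ω) ∂μ := by
        gcongr
        exact abs_integral_le_integral_abs.trans (integral_mono_of_nonneg
          (.of_forall fun _ => abs_nonneg _) (h.integrable_tailPow zero_le_one (by linarith) M 0)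
          (.of_forall fun ω => abs_sub_clip_le_tailPow hM _))
    _ = ∫ ω, M ^ q * tailPow 1 M (X 0 ω) ∂μ := (integral_const_mul _ _).symm
    _ ≤ _ := integral_mono ((h.integrable_tailPow zero_le_one (by linarith) M 0).const_mul _)
          (h.integrable_tailPow (by linarith) hq1 M 0)
          fun ω => rpow_mul_tailPow_le hM hq zero_le_one _

theorem abs_sub_ctrunc_le (h : IsTransferable μ X F δ) (hM : 0 ≤ M) (n : ℤ) (ω : Ω) :
    |X n ω - ctrunc μ M (X n) ω| ≤ tailPow 1 M (X n ω) + |∫ ω', clip M (X 0 ω') ∂μ| := by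
  have e : X n ω - ctrunc μ M (X n) ω
      = (X n ω - clip M (X n ω)) + ∫ ω', clip M (X 0 ω') ∂μ := by
    rw [ctrunc, h.integral_clip]
    ring
  rw [e]
  exact (abs_add_le _ _).trans (add_le_add (abs_sub_clip_le_tailPow hM _) le_rfl)

/-- The first order dependence bound, at an arbitrary time and for an arbitrary bounded weight. -/
theorem truncDep_one (h : IsTransferable μ X F δ) (hT : TruncDep μ X F M κ k) {m n : ℤ}
    (hn : n = k + m) {W : Ω → ℝ} {b : ℝ} (hb : 0 ≤ b) (hW : Measurable[F m] W)
    (hWb : ∀ ω, |W ω| ≤ b) : |∫ ω, W ω * ctrunc μ M (X n) ω ∂μ| ≤ b * κ := by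
  rcases hb.eq_or_lt with rfl | hb
  · have : ∀ ω, W ω = 0 := fun ω => abs_nonpos_iff.1 (hWb ω)
    simp [this]
  obtain ⟨W', hW', hW'1, hlaw⟩ := h.transfer m (fun ω => W ω / b) (hW.div_const b) fun ω => by
    rw [abs_div, abs_of_pos hb]
    exact div_le_one_of_le₀ (hWb ω) hb.le
  have hWm : Measurable W := hW.mono (F.le m) le_rfl
  have hW'm : Measurable W' := hW'.mono (F.le 0) le_rfl
  set a := ∫ ω, clip M (X 0 ω) ∂μ
  have hψ : Measurable fun z : ℝ × ℝ × ℝ => z.1 * (clip M z.2.1 - a) := by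
    have := measurable_clip M
    fun_prop
  have hm1 : Measurable fun ω => (W ω / b, X (k + m) ω, X (k + m) ω) :=
    (hWm.div_const b).prodMk ((h.measurable _).prodMk (h.measurable _))
  have hm2 : Measurable fun ω => (W' ω, X k ω, X k ω) :=
    hW'm.prodMk ((h.measurable _).prodMk (h.measurable _))
  have e1 := integral_map (μ := μ) hm1.aemeasurable hψ.aestronglyMeasurable
  have e2 := integral_map (μ := μ) hm2.aemeasurable hψ.aestronglyMeasurable
  rw [hlaw, e2] at e1
  have h1 := hT.1 W' hW' hW'1
  simp only [ctrunc, h.integral_clip] at h1 ⊢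
  simp only at e1
  rw [e1] at h1
  have e3 : ∫ ω, W ω * (clip M (X n ω) - a) ∂μ
      = b * ∫ ω, W ω / b * (clip M (X (k + m) ω) - a) ∂μ := by
    rw [← integral_const_mul, hn]
    refine integral_congr_ae (.of_forall fun ω => ?_)
    simp only
    field_simp
  rw [e3, abs_mul, abs_of_pos hb]
  exact mul_le_mul_of_nonneg_left h1 hb.le

/-- The second order dependence bound, at an arbitrary time and for an arbitrary bounded weight. -/
theorem truncDep_two (h : IsTransferable μ X F δ) (hT : TruncDep μ X F M κ k) {m n q : ℤ} {l : ℕ}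
    (hn : n = k + m) (hq : q = k + l + m) {W : Ω → ℝ} {b : ℝ} (hb : 0 ≤ b) (hW : Measurable[F m] W)
    (hWb : ∀ ω, |W ω| ≤ b) :
    |∫ ω, W ω * (ctrunc μ M (X n) ω * ctrunc μ M (X q) ω
      - ∫ ω', ctrunc μ M (X n) ω' * ctrunc μ M (X q) ω' ∂μ) ∂μ| ≤ b * (M * κ) := by
  rcases hb.eq_or_lt with rfl | hb
  · have : ∀ ω, W ω = 0 := fun ω => abs_nonpos_iff.1 (hWb ω)
    simp [this]
  obtain ⟨W', hW', hW'1, hlaw⟩ := h.transfer m (fun ω => W ω / b) (hW.div_const b) fun ω => by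
    rw [abs_div, abs_of_pos hb]
    exact div_le_one_of_le₀ (hWb ω) hb.le
  have hWm : Measurable W := hW.mono (F.le m) le_rfl
  have hW'm : Measurable W' := hW'.mono (F.le 0) le_rfl
  set a := ∫ ω, clip M (X 0 ω) ∂μ
  have hpair := h.integral_pair (φ := fun z => (clip M z.1 - a) * (clip M z.2 - a))
    (by have := measurable_clip M; fun_prop) k (k + l) m
  rw [← hn, ← hq] at hpair
  simp only at hpair
  set e := ∫ ω, (clip M (X k ω) - a) * (clip M (X (k + l) ω) - a) ∂μ
  have hψ : Measurable fun z : ℝ × ℝ × ℝ => z.1 * ((clip M z.2.1 - a) * (clip M z.2.2 - a) - e) := by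
    have := measurable_clip M
    fun_prop
  have hm1 : Measurable fun ω => (W ω / b, X (k + m) ω, X (k + l + m) ω) :=
    (hWm.div_const b).prodMk ((h.measurable _).prodMk (h.measurable _))
  have hm2 : Measurable fun ω => (W' ω, X k ω, X (k + l) ω) :=
    hW'm.prodMk ((h.measurable _).prodMk (h.measurable _))
  have e1 := integral_map (μ := μ) hm1.aemeasurable hψ.aestronglyMeasurable
  have e2 := integral_map (μ := μ) hm2.aemeasurable hψ.aestronglyMeasurable
  rw [hlaw, e2] at e1
  have h1 := hT.2 W' l hW' hW'1
  simp only [ctrunc, h.integral_clip] at h1 ⊢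
  simp only at e1
  rw [e1] at h1
  rw [hpair]
  have e3 : ∫ ω, W ω * ((clip M (X n ω) - a) * (clip M (X q ω) - a) - e) ∂μ
      = b * ∫ ω, W ω / b * ((clip M (X (k + m) ω) - a) * (clip M (X (k + l + m) ω) - a) - e) ∂μ := by
    rw [← integral_const_mul, hn, hq]
    refine integral_congr_ae (.of_forall fun ω => ?_)
    simp only
    field_simp
  rw [e3, abs_mul, abs_of_pos hb]
  exact mul_le_mul_of_nonneg_left h1 hb.le

/-- Dependence bound for a weight of order `1 + δ`. -/
theorem abs_integral_mul_le (h : IsTransferable μ X F δ) (hδ0 : 0 < δ) (hM : 0 ≤ M)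
    (hT : TruncDep μ X F M κ k) {a m n : ℤ} (hn : n = k + m) {R : Ω → ℝ} (hR : Measurable[F m] R)
    (hRb : ∀ ω, |R ω| ≤ |X a ω| ^ δ * |X m ω|) :
    |∫ ω, R ω * X n ω ∂μ| ≤ M ^ (1 + δ) * κ + 5 * ∫ ω, tailPow (2 + δ) M (X 0 ω) ∂μ := by
  set T := ∫ ω, tailPow (2 + δ) M (X 0 ω) ∂μ with hTdef
  -- If X_a, X_m and X_n are all at most M in absolute value then |R| ≤ b and clipping R changes
  -- nothing; otherwise R X_n is bounded by three tails. Truncating and recentering X_n costs two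
  -- more, whence the 5.
  set b := M ^ (1 + δ) with hbdef
  have hb : 0 ≤ b := by positivity
  have hbM : b = M ^ δ * M := by rw [hbdef, add_comm, Real.rpow_add_one' hM (by linarith)]
  have hRm : Measurable R := hR.mono (F.le m) le_rfl
  set ε := b * |∫ ω', clip M (X 0 ω') ∂μ| with hε
  have hεT : ε ≤ T := by
    have := h.rpow_mul_abs_integral_clip_le hM hδ0 (q := 1 + δ) (by linarith) (by linarith)
    rwa [show 1 + δ + 1 = 2 + δ by ring] at this
  have hRc : Measurable[F m] fun ω => clip b (R ω) := (measurable_clip b).comp hR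
  have hRcm : Measurable fun ω => clip b (R ω) := (measurable_clip b).comp hRm
  have hmain := h.truncDep_one hT hn hb hRc fun ω => abs_clip_le hb _
  have it := fun i => h.integrable_tailPow (q := 2 + δ) (by linarith) le_rfl M i
  have hD : Integrable (fun ω => (tailPow (2 + δ) M (X a ω) + tailPow (2 + δ) M (X m ω)
      + tailPow (2 + δ) M (X n ω)) + (tailPow (2 + δ) M (X n ω) + ε)) μ :=
    (((it a).add (it m)).add (it n)).add ((it n).add (integrable_const ε))
  have hInt : Integrable (fun ω => clip b (R ω) * ctrunc μ M (X n) ω) μ := by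
    refine Integrable.of_bound (hRcm.mul (h.measurable_ctrunc M n)).aestronglyMeasurable
      (b * (2 * M)) (.of_forall fun ω => ?_)
    rw [Real.norm_eq_abs, abs_mul]
    exact mul_le_mul (abs_clip_le hb _) (abs_ctrunc_le hM _ _) (abs_nonneg _) hb
  have key := abs_integral_le_add (f := fun ω => R ω * X n ω)
    (hRm.mul (h.measurable n)).aestronglyMeasurable hInt hD fun ω => by
      have e : R ω * X n ω - clip b (R ω) * ctrunc μ M (X n) ω
          = (R ω - clip b (R ω)) * X n ω + clip b (R ω) * (X n ω - ctrunc μ M (X n) ω) := by ring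
      rw [e]
      refine (abs_add_le _ _).trans (add_le_add ?_ ?_)
      · by_cases hc : |R ω| ≤ b
        · rw [clip_of_abs_le hc, sub_self, zero_mul, abs_zero]
          have := tailPow_nonneg (2 + δ) M
          linarith [this (X a ω), this (X m ω), this (X n ω)]
        · rw [abs_mul]
          have hor : M < |X a ω| ∨ M < |X m ω| ∨ M < |X n ω| := by
            by_contra! hcon
            refine hc ((hRb ω).trans ?_)
            rw [hbM]
            exact mul_le_mul (Real.rpow_le_rpow (abs_nonneg _) hcon.1 hδ0.le) hcon.2.1
              (abs_nonneg _) (by positivity)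
          refine le_trans ?_ (rpow_mul_mul_le_tailPow hδ0 hor)
          rw [← mul_assoc]
          gcongr
          exact (abs_sub_clip_le hb _).trans (hRb ω)
      · rw [abs_mul]
        calc _ ≤ b * (tailPow 1 M (X n ω) + |∫ ω', clip M (X 0 ω') ∂μ|) :=
              mul_le_mul (abs_clip_le hb _) (h.abs_sub_ctrunc_le hM n ω) (abs_nonneg _) hb
          _ = b * tailPow 1 M (X n ω) + ε := by rw [mul_add]
          _ ≤ _ := by
              have := rpow_mul_tailPow_le hM (by linarith : 0 ≤ 1 + δ) zero_le_one (X n ω)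
              rw [show 1 + δ + 1 = 2 + δ by ring] at this
              linarith
  have hval : ∫ ω, ((tailPow (2 + δ) M (X a ω) + tailPow (2 + δ) M (X m ω)
      + tailPow (2 + δ) M (X n ω)) + (tailPow (2 + δ) M (X n ω) + ε)) ∂μ = 4 * T + ε := by
    have j1 : Integrable (fun ω => tailPow (2 + δ) M (X a ω) + tailPow (2 + δ) M (X m ω)) μ :=
      (it a).add (it m)
    have j2 : Integrable (fun ω => tailPow (2 + δ) M (X a ω) + tailPow (2 + δ) M (X m ω)
      + tailPow (2 + δ) M (X n ω)) μ := j1.add (it n)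
    have j3 : Integrable (fun ω => tailPow (2 + δ) M (X n ω) + ε) μ :=
      (it n).add (integrable_const ε)
    rw [integral_add j2 j3, integral_add j1 (it n), integral_add (it a) (it m),
      integral_add (it n) (integrable_const ε)]
    simp only [h.integral_tailPow (2 + δ) M a, h.integral_tailPow (2 + δ) M m,
      h.integral_tailPow (2 + δ) M n, integral_const]
    simp
    ring
  rw [hval] at key
  linarith

end IsTransferable

namespace IsTransferable

variable {Ω : Type*} {mΩ : MeasurableSpace Ω} {μ : Measure Ω} [IsProbabilityMeasure μ]
  {X : ℤ → Ω → ℝ} {F : Filtration ℤ mΩ} {δ M κ : ℝ} {k : ℕ}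

theorem integral_tailPow_anti (h : IsTransferable μ X F δ) {q N : ℝ} (hq0 : 0 ≤ q)
    (hq : q ≤ 2 + δ) (hMN : M ≤ N) :
    ∫ ω, tailPow q N (X 0 ω) ∂μ ≤ ∫ ω, tailPow q M (X 0 ω) ∂μ :=
  integral_mono (h.integrable_tailPow hq0 hq N 0) (h.integrable_tailPow hq0 hq M 0)
    fun _ => tailPow_anti hMN

theorem integral_tailPow_nonneg (q M : ℝ) : 0 ≤ ∫ ω, tailPow q M (X 0 ω) ∂μ :=
  integral_nonneg fun _ => tailPow_nonneg _ _ _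

/-- Either `X 0` vanishes almost surely or it has a nontrivial tail at a positive level. -/
theorem ae_eq_zero_or_exists_tail (h : IsTransferable μ X F δ) (hδ0 : 0 < δ) :
    (∀ᵐ ω ∂μ, X 0 ω = 0) ∨ ∃ ε > 0, 0 < ∫ ω, tailPow (2 + δ) ε (X 0 ω) ∂μ := by
  by_cases hc : ∃ ε > 0, 0 < ∫ ω, tailPow (2 + δ) ε (X 0 ω) ∂μ
  · exact Or.inr hc
  left
  push Not at hc
  have hn : ∀ n : ℕ, ∀ᵐ ω ∂μ, tailPow (2 + δ) (1 / ((n : ℝ) + 1)) (X 0 ω) = 0 := by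
    intro n
    have h0 := le_antisymm (hc (1 / ((n : ℝ) + 1)) (by positivity))
      (integral_tailPow_nonneg (2 + δ) (1 / ((n : ℝ) + 1)))
    exact (integral_eq_zero_iff_of_nonneg (fun _ => tailPow_nonneg _ _ _)
      (h.integrable_tailPow (by linarith) le_rfl _ 0)).1 h0
  filter_upwards [ae_all_iff.2 hn] with ω hω
  by_contra hne
  obtain ⟨n, hn'⟩ := exists_nat_one_div_lt (abs_pos.2 hne)
  have := hω n
  rw [tailPow_of_lt hn'] at this
  have hpos : 0 < |X 0 ω| ^ (2 + δ) := Real.rpow_pos_of_pos (abs_pos.2 hne) _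
  linarith

/-- Brings lower order tails to order 2 + δ, even at small levels. Above a fixed ε, the missing
power of |X_0| is at least ε^{2+δ-q}; below ε, the right-hand tail is bounded away from 0 and the
left one is bounded. -/
theorem exists_tailPow_le (h : IsTransferable μ X F δ) (hδ0 : 0 < δ) {q : ℝ} (hq0 : 0 ≤ q)
    (hq : q ≤ 2 + δ) : ∃ K : ℝ, 0 ≤ K ∧ ∀ M, 0 ≤ M →
      ∫ ω, tailPow q M (X 0 ω) ∂μ ≤ K * ∫ ω, tailPow (2 + δ) M (X 0 ω) ∂μ := by
  rcases h.ae_eq_zero_or_exists_tail hδ0 with h0 | ⟨ε, hε, hpos⟩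
  · refine ⟨0, le_rfl, fun M hM => ?_⟩
    rw [zero_mul]
    refine le_of_eq (integral_eq_zero_of_ae ?_)
    filter_upwards [h0] with ω hω
    rw [hω, tailPow_of_le (by simpa using hM)]
    rfl
  · set Tε := ∫ ω, tailPow (2 + δ) ε (X 0 ω) ∂μ
    set A := ∫ ω, |X 0 ω| ^ q ∂μ
    have hA : 0 ≤ A := integral_nonneg fun _ => by positivity
    have hεq : 0 < ε ^ (2 + δ - q) := by positivity
    refine ⟨1 / ε ^ (2 + δ - q) + A / Tε, by positivity, fun M hM => ?_⟩
    have hTM := integral_tailPow_nonneg (μ := μ) (X := X) (2 + δ) M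
    rcases le_or_gt ε M with hle | hlt
    · have h1 : ε ^ (2 + δ - q) * ∫ ω, tailPow q M (X 0 ω) ∂μ
          ≤ ∫ ω, tailPow (2 + δ) M (X 0 ω) ∂μ := by
        rw [← integral_const_mul]
        refine integral_mono ((h.integrable_tailPow hq0 hq M 0).const_mul _)
          (h.integrable_tailPow (by linarith) le_rfl M 0) fun ω => ?_
        have h2 := rpow_mul_tailPow_le hM (by linarith : 0 ≤ 2 + δ - q) hq0 (X 0 ω)
        rw [sub_add_cancel] at h2
        refine le_trans ?_ h2
        have := tailPow_nonneg q M (X 0 ω)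
        have h3 : ε ^ (2 + δ - q) ≤ M ^ (2 + δ - q) :=
          Real.rpow_le_rpow hε.le hle (by linarith)
        exact mul_le_mul_of_nonneg_right h3 this
      rw [add_mul]
      have h4 : 0 ≤ A / Tε * ∫ ω, tailPow (2 + δ) M (X 0 ω) ∂μ := by positivity
      have h5 : ∫ ω, tailPow q M (X 0 ω) ∂μ
          ≤ 1 / ε ^ (2 + δ - q) * ∫ ω, tailPow (2 + δ) M (X 0 ω) ∂μ := by
        rw [one_div, ← div_eq_inv_mul, le_div_iff₀ hεq, mul_comm]
        exact h1
      linarith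
    · have h1 : ∫ ω, tailPow q M (X 0 ω) ∂μ ≤ A :=
        integral_mono (h.integrable_tailPow hq0 hq M 0) (integrable_abs_rpow hq0 hq (h.memLp 0))
          fun ω => tailPow_le _ _ _
      have h2 : Tε ≤ ∫ ω, tailPow (2 + δ) M (X 0 ω) ∂μ :=
        h.integral_tailPow_anti (by linarith) le_rfl hlt.le
      have h3 : A = A / Tε * Tε := by field_simp
      have h4 : A / Tε * Tε ≤ A / Tε * ∫ ω, tailPow (2 + δ) M (X 0 ω) ∂μ := by gcongr
      rw [add_mul]
      have h5 : 0 ≤ 1 / ε ^ (2 + δ - q) * ∫ ω, tailPow (2 + δ) M (X 0 ω) ∂μ := by positivity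
      linarith

theorem abs_integral_mul_le_sq (h : IsTransferable μ X F δ) (hδ0 : 0 < δ) (n q : ℤ) :
    |∫ ω, X n ω * X q ω ∂μ| ≤ 2 * ∫ ω, X 0 ω ^ 2 ∂μ := by
  have i2 : ∀ i, Integrable (fun ω => X i ω ^ 2) μ := fun i => by
    simpa only [sq] using integrable_mul_of_memLp hδ0 (h.memLp i) (h.memLp i)
  have e : ∀ i, ∫ ω, X i ω ^ 2 ∂μ = ∫ ω, X 0 ω ^ 2 ∂μ := fun i =>
    h.integral_single (φ := fun x => x ^ 2) (by fun_prop) i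
  calc |∫ ω, X n ω * X q ω ∂μ| ≤ ∫ ω, (X n ω ^ 2 + X q ω ^ 2) ∂μ := by
        refine abs_integral_le_integral_abs.trans (integral_mono_of_nonneg
          (.of_forall fun _ => abs_nonneg _) ((i2 n).add (i2 q)) (.of_forall fun ω => ?_))
        simp only
        rw [abs_le]
        constructor <;> nlinarith [sq_nonneg (X n ω + X q ω), sq_nonneg (X n ω - X q ω)]
    _ = 2 * ∫ ω, X 0 ω ^ 2 ∂μ := by
        rw [integral_add (i2 n) (i2 q), e n, e q]
        ring

/-- Bound for the covariances. -/
theorem exists_abs_cov_le (h : IsTransferable μ X F δ) (hδ0 : 0 < δ) :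
    ∃ C : ℝ, 0 ≤ C ∧ ∀ (M κ : ℝ) (k : ℕ) (m n : ℤ), 0 ≤ M → 0 ≤ κ → TruncDep μ X F M κ k →
      n = k + m → |∫ ω, X m ω * X n ω ∂μ|
        ≤ C * (M ^ (1 + δ) * κ + ∫ ω, tailPow (2 + δ) M (X 0 ω) ∂μ) := by
  rcases h.ae_eq_zero_or_exists_tail hδ0 with h0 | ⟨ε, hε, hpos⟩
  · refine ⟨0, le_rfl, fun M κ k m n hM hκ hT hn => ?_⟩
    have hsq : ∫ ω, X 0 ω ^ 2 ∂μ = 0 := by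
      refine integral_eq_zero_of_ae ?_
      filter_upwards [h0] with ω hω
      simp [hω]
    have := h.abs_integral_mul_le_sq hδ0 m n
    rw [hsq] at this
    linarith
  obtain ⟨K, hK, hKT⟩ := h.exists_tailPow_le hδ0 (q := 1) zero_le_one (by linarith)
  set Tε := ∫ ω, tailPow (2 + δ) ε (X 0 ω) ∂μ
  set V := 2 * ∫ ω, X 0 ω ^ 2 ∂μ
  have hV : 0 ≤ V := mul_nonneg (by norm_num) (integral_nonneg fun _ => sq_nonneg _)
  refine ⟨(6 + 2 * ε ^ (1 + δ) * K) / ε ^ δ + V / Tε, by positivity,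
    fun M κ k m n hM hκ hT hn => ?_⟩
  set T := ∫ ω, tailPow (2 + δ) M (X 0 ω) ∂μ with hTdef
  have hT0 : 0 ≤ T := integral_tailPow_nonneg _ _
  have hb0 : 0 ≤ M ^ (1 + δ) * κ := by positivity
  -- For M < ε the tail T is at least Tε > 0 and absorbs the trivial bound V on the covariance.
  rcases le_or_gt ε M with hle | hlt
  swap
  · have h1 := h.abs_integral_mul_le_sq hδ0 m n
    have h2 : Tε ≤ T := h.integral_tailPow_anti (by linarith) le_rfl hlt.le
    have h3 : V = V / Tε * Tε := by field_simp
    have h4 : V / Tε * Tε ≤ V / Tε * (M ^ (1 + δ) * κ + T) := by gcongr; linarith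
    have h5 : 0 ≤ (6 + 2 * ε ^ (1 + δ) * K) / ε ^ δ * (M ^ (1 + δ) * κ + T) := by positivity
    rw [add_mul]
    linarith
  have hεδ : 0 < ε ^ δ := by positivity
  -- The earlier factor X m is split at ε. The small part W is a bounded weight, for which κ ≤
  -- (M/ε)^{1+δ} κ. The large part is at most |X m|^{1+δ}/ε^δ and falls under the bound for weights
  -- of order 1 + δ.
  set W : Ω → ℝ := fun ω => if ε < |X m ω| then 0 else X m ω with hW
  have hset : MeasurableSet[F m] {ω | ε < |X m ω|} := by
    have := h.adapted m
    exact measurableSet_lt measurable_const (measurable_abs.comp this)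
  have hWm : Measurable[F m] W := Measurable.ite hset measurable_const (h.adapted m)
  have hWb : ∀ ω, |W ω| ≤ ε := by
    intro ω
    simp only [hW]
    split_ifs with hc
    · simpa using hε.le
    · exact not_lt.1 hc
  have hWm' : Measurable W := hWm.mono (F.le m) le_rfl
  set R : Ω → ℝ := fun ω => ε ^ δ * (X m ω - W ω) with hR
  have hRm : Measurable[F m] R := ((h.adapted m).sub hWm).const_mul _
  have hRb : ∀ ω, |R ω| ≤ |X m ω| ^ δ * |X m ω| := by
    intro ω
    simp only [hR, hW]
    rw [abs_mul, abs_of_pos hεδ]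
    split_ifs with hc
    · rw [sub_zero]
      gcongr
    · rw [sub_self, abs_zero, mul_zero]
      positivity
  have b1 := h.abs_integral_mul_le hδ0 hM hT hn hRm hRb
  rw [← hTdef] at b1
  have it1 := h.integrable_tailPow (q := 1) zero_le_one (by linarith) M n
  have hInt : Integrable (fun ω => W ω * ctrunc μ M (X n) ω) μ := by
    refine Integrable.of_bound (hWm'.mul (h.measurable_ctrunc M n)).aestronglyMeasurable
      (ε * (2 * M)) (.of_forall fun ω => ?_)
    rw [Real.norm_eq_abs, abs_mul]
    exact mul_le_mul (hWb ω) (abs_ctrunc_le hM _ _) (abs_nonneg _) hε.le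
  have b2 := abs_integral_le_add (f := fun ω => W ω * X n ω)
    (hWm'.mul (h.measurable n)).aestronglyMeasurable hInt
    ((it1.add (integrable_const |∫ ω', clip M (X 0 ω') ∂μ|)).const_mul ε) fun ω => by
      rw [← mul_sub, abs_mul]
      exact mul_le_mul (hWb ω) (h.abs_sub_ctrunc_le hM n ω) (abs_nonneg _) hε.le
  have b3 := h.truncDep_one hT hn hε.le hWm hWb
  have b4 := h.rpow_mul_abs_integral_clip_le hM hδ0 (q := 0) le_rfl (by linarith)
  rw [Real.rpow_zero, one_mul, zero_add] at b4
  have b5 := hKT M hM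
  simp only [Pi.add_apply] at b2
  rw [integral_const_mul, integral_add it1 (integrable_const _), h.integral_tailPow] at b2
  simp only [integral_const, probReal_univ, one_smul] at b2
  have b6 : |∫ ω, W ω * X n ω ∂μ| ≤ ε * κ + ε * (2 * (K * T)) := by
    have := mul_le_mul_of_nonneg_left (add_le_add b5 (b4.trans b5)) hε.le
    rw [two_mul]
    linarith
  have iW : Integrable (fun ω => W ω * X n ω) μ :=
    ((integrable_of_memLp hδ0 (h.memLp n)).abs.const_mul ε).mono'
      (hWm'.mul (h.measurable n)).aestronglyMeasurable (.of_forall fun ω => by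
        rw [Real.norm_eq_abs, abs_mul]
        gcongr
        exact hWb ω)
  have iX := integrable_mul_of_memLp hδ0 (h.memLp m) (h.memLp n)
  have e : ∫ ω, R ω * X n ω ∂μ
      = ε ^ δ * (∫ ω, X m ω * X n ω ∂μ - ∫ ω, W ω * X n ω ∂μ) := by
    rw [← integral_sub iX iW, ← integral_const_mul]
    refine integral_congr_ae (.of_forall fun ω => ?_)
    simp only [hR]
    ring
  rw [e, abs_mul, abs_of_pos hεδ] at b1
  have b7 := mul_le_mul_of_nonneg_left b6 hεδ.le
  have e1 : ε ^ (1 + δ) = ε ^ δ * ε := by rw [add_comm, Real.rpow_add_one' hε.le (by linarith)]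
  have b8 : ε ^ (1 + δ) * κ ≤ M ^ (1 + δ) * κ := by gcongr
  rw [e1] at b8
  have b9 := abs_sub_abs_le_abs_sub (∫ ω, X m ω * X n ω ∂μ) (∫ ω, W ω * X n ω ∂μ)
  have b10 := mul_le_mul_of_nonneg_left b9 hεδ.le
  have hfin : ε ^ δ * |∫ ω, X m ω * X n ω ∂μ|
      ≤ (6 + 2 * ε ^ (1 + δ) * K) * (M ^ (1 + δ) * κ + T) := by
    rw [e1]
    have p1 : 0 ≤ 2 * (ε ^ δ * ε) * K * (M ^ (1 + δ) * κ) := by positivity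
    nlinarith
  rw [add_mul]
  have h5 : 0 ≤ V / Tε * (M ^ (1 + δ) * κ + T) := by positivity
  have h6 : |∫ ω, X m ω * X n ω ∂μ|
      ≤ (6 + 2 * ε ^ (1 + δ) * K) / ε ^ δ * (M ^ (1 + δ) * κ + T) := by
    rw [div_mul_eq_mul_div, le_div_iff₀ hεδ, mul_comm]
    exact hfin
  linarith

/-- Pointwise control of the error made when a product is replaced by the product of the centered
truncations. -/
theorem rpow_mul_abs_mul_sub_le (h : IsTransferable μ X F δ) (hδ0 : 0 < δ) (hM : 0 ≤ M)
    (n q : ℤ) (ω : Ω) :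
    M ^ δ * |X n ω * X q ω - ctrunc μ M (X n) ω * ctrunc μ M (X q) ω|
      ≤ tailPow (2 + δ) M (X n ω) + 4 * tailPow (2 + δ) M (X q ω)
        + 3 * ∫ ω', tailPow (2 + δ) M (X 0 ω') ∂μ := by
  set T := ∫ ω', tailPow (2 + δ) M (X 0 ω') ∂μ
  set a := |∫ ω', clip M (X 0 ω') ∂μ| with ha
  have ha0 : 0 ≤ a := abs_nonneg _
  have haM : a ≤ M := abs_integral_clip_le_level hM _
  have e1 : M ^ (1 + δ) = M ^ δ * M := by rw [add_comm, Real.rpow_add_one' hM (by linarith)]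
  have hεT : M ^ (1 + δ) * a ≤ T := by
    have := h.rpow_mul_abs_integral_clip_le hM hδ0 (q := 1 + δ) (by linarith) (by linarith)
    rwa [show 1 + δ + 1 = 2 + δ by ring] at this
  have hq1 : M ^ (1 + δ) * tailPow 1 M (X q ω) ≤ tailPow (2 + δ) M (X q ω) := by
    have := rpow_mul_tailPow_le hM (by linarith : 0 ≤ 1 + δ) zero_le_one (X q ω)
    rwa [show 1 + δ + 1 = 2 + δ by ring] at this
  have hn := h.abs_sub_ctrunc_le hM n ω
  have hq := h.abs_sub_ctrunc_le hM q ω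
  rw [← ha] at hn hq
  have hMδ : 0 ≤ M ^ δ := by positivity
  have hXq : |X q ω| ≤ M + tailPow 1 M (X q ω) := by
    by_cases hc : M < |X q ω|
    · rw [tailPow_of_lt hc, Real.rpow_one]; linarith
    · rw [tailPow_of_le (not_lt.1 hc)]; linarith [not_lt.1 hc]
  have p1 : M ^ δ * (tailPow 1 M (X n ω) * |X q ω|)
      ≤ tailPow (2 + δ) M (X n ω) + tailPow (2 + δ) M (X q ω) := by
    by_cases hc : M < |X n ω|
    · rw [tailPow_of_lt hc, Real.rpow_one]
      rcases le_total |X n ω| |X q ω| with hle | hle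
      · have hc' := hc.trans_le hle
        have key : M ^ δ * (|X n ω| * |X q ω|) ≤ |X q ω| ^ δ * (|X q ω| * |X q ω|) := by gcongr
        have e2 : |X q ω| ^ δ * (|X q ω| * |X q ω|) = tailPow (2 + δ) M (X q ω) := by
          rw [tailPow_of_lt hc', ← sq, ← Real.rpow_natCast,
            ← Real.rpow_add_of_nonneg (abs_nonneg _) hδ0.le (by norm_num)]
          congr 1; push_cast; ring
        linarith [tailPow_nonneg (2 + δ) M (X n ω)]
      · have key : M ^ δ * (|X n ω| * |X q ω|) ≤ |X n ω| ^ δ * (|X n ω| * |X n ω|) := by gcongr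
        have e2 : |X n ω| ^ δ * (|X n ω| * |X n ω|) = tailPow (2 + δ) M (X n ω) := by
          rw [tailPow_of_lt hc, ← sq, ← Real.rpow_natCast,
            ← Real.rpow_add_of_nonneg (abs_nonneg _) hδ0.le (by norm_num)]
          congr 1; push_cast; ring
        linarith [tailPow_nonneg (2 + δ) M (X q ω)]
    · rw [tailPow_of_le (not_lt.1 hc), zero_mul, mul_zero]
      exact add_nonneg (tailPow_nonneg _ _ _) (tailPow_nonneg _ _ _)
  have p2 : M ^ δ * (a * |X q ω|) ≤ T + tailPow (2 + δ) M (X q ω) := by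
    calc M ^ δ * (a * |X q ω|) ≤ M ^ δ * (a * (M + tailPow 1 M (X q ω))) := by gcongr
      _ = M ^ (1 + δ) * a + M ^ δ * (a * tailPow 1 M (X q ω)) := by rw [e1]; ring
      _ ≤ M ^ (1 + δ) * a + M ^ δ * (M * tailPow 1 M (X q ω)) := by
          have := tailPow_nonneg 1 M (X q ω)
          gcongr
      _ = M ^ (1 + δ) * a + M ^ (1 + δ) * tailPow 1 M (X q ω) := by rw [e1]; ring
      _ ≤ _ := add_le_add hεT hq1
  have p3 : M ^ δ * (2 * M * (tailPow 1 M (X q ω) + a))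
      ≤ 2 * tailPow (2 + δ) M (X q ω) + 2 * T := by
    calc _ = 2 * (M ^ (1 + δ) * tailPow 1 M (X q ω)) + 2 * (M ^ (1 + δ) * a) := by rw [e1]; ring
      _ ≤ _ := by linarith
  have e : X n ω * X q ω - ctrunc μ M (X n) ω * ctrunc μ M (X q) ω
      = (X n ω - ctrunc μ M (X n) ω) * X q ω
        + ctrunc μ M (X n) ω * (X q ω - ctrunc μ M (X q) ω) := by ring
  calc M ^ δ * |X n ω * X q ω - ctrunc μ M (X n) ω * ctrunc μ M (X q) ω|
      ≤ M ^ δ * ((tailPow 1 M (X n ω) + a) * |X q ω|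
        + 2 * M * (tailPow 1 M (X q ω) + a)) := by
        rw [e]
        refine mul_le_mul_of_nonneg_left ((abs_add_le _ _).trans ?_) hMδ
        rw [abs_mul, abs_mul]
        refine add_le_add (mul_le_mul_of_nonneg_right hn (abs_nonneg _)) ?_
        exact mul_le_mul (abs_ctrunc_le hM _ _) hq (abs_nonneg _) (by positivity)
    _ = M ^ δ * (tailPow 1 M (X n ω) * |X q ω|) + M ^ δ * (a * |X q ω|)
        + M ^ δ * (2 * M * (tailPow 1 M (X q ω) + a)) := by ring
    _ ≤ _ := by linarith

/-- Dependence bound for products of two future variables. -/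
theorem exists_abs_integral_mul_cov_le (h : IsTransferable μ X F δ) (hδ0 : 0 < δ) :
    ∃ C : ℝ, 0 ≤ C ∧ ∀ (M κ : ℝ) (k l : ℕ) (m n q : ℤ) (R : Ω → ℝ), 0 ≤ M →
      TruncDep μ X F M κ k → n = k + m → q = k + l + m → Measurable[F m] R →
      (∀ ω, |R ω| ≤ |X m ω| ^ δ) →
      |∫ ω, R ω * (X n ω * X q ω - ∫ ω', X n ω' * X q ω' ∂μ) ∂μ|
        ≤ M ^ (1 + δ) * κ + C * ∫ ω, tailPow (2 + δ) M (X 0 ω) ∂μ := by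
  obtain ⟨K, hK, hKT⟩ := h.exists_tailPow_le hδ0 (q := δ) hδ0.le (by linarith)
  set V := 2 * ∫ ω, X 0 ω ^ 2 ∂μ with hV
  have hV0 : 0 ≤ V := mul_nonneg (by norm_num) (integral_nonneg fun _ => sq_nonneg _)
  -- Clipping R costs 3T, replacing the product by its truncated version 8T and replacing its mean
  -- another 8T; K * V accounts for the clipped part of R against the covariance.
  refine ⟨19 + K * V, by positivity, fun M κ k l m n q R hM hT hn hq hR hRb => ?_⟩
  set T := ∫ ω, tailPow (2 + δ) M (X 0 ω) ∂μ with hTdef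
  have hT0 : 0 ≤ T := integral_tailPow_nonneg _ _
  set b := M ^ δ with hb
  have hb0 : 0 ≤ b := by positivity
  have hRm : Measurable R := hR.mono (F.le m) le_rfl
  have hRc : Measurable[F m] fun ω => clip b (R ω) := (measurable_clip b).comp hR
  have hRcm : Measurable fun ω => clip b (R ω) := (measurable_clip b).comp hRm
  have hmain := h.truncDep_two hT hn hq hb0 hRc fun ω => abs_clip_le hb0 _
  have iXX := integrable_mul_of_memLp hδ0 (h.memLp n) (h.memLp q)
  have hmn := h.measurable_ctrunc M n
  have hmq := h.measurable_ctrunc M q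
  have icc : Integrable (fun ω => ctrunc μ M (X n) ω * ctrunc μ M (X q) ω) μ := by
    refine Integrable.of_bound (hmn.mul hmq).aestronglyMeasurable ((2 * M) * (2 * M))
      (.of_forall fun ω => ?_)
    rw [Real.norm_eq_abs, abs_mul]
    exact mul_le_mul (abs_ctrunc_le hM _ _) (abs_ctrunc_le hM _ _) (abs_nonneg _) (by positivity)
  have hcV := h.abs_integral_mul_le_sq hδ0 n q
  set c := ∫ ω', X n ω' * X q ω' ∂μ with hc
  set e := ∫ ω', ctrunc μ M (X n) ω' * ctrunc μ M (X q) ω' ∂μ with he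
  have it := fun i => h.integrable_tailPow (q := 2 + δ) (by linarith) le_rfl M i
  have itδ := h.integrable_tailPow (q := δ) hδ0.le (by linarith) M m
  have j1 : Integrable (fun ω => tailPow (2 + δ) M (X n ω) + 4 * tailPow (2 + δ) M (X q ω)) μ :=
    (it n).add ((it q).const_mul 4)
  have hD1 : Integrable (fun ω => tailPow (2 + δ) M (X n ω) + 4 * tailPow (2 + δ) M (X q ω)
      + 3 * T) μ := j1.add (integrable_const _)
  have vD1 : ∫ ω, (tailPow (2 + δ) M (X n ω) + 4 * tailPow (2 + δ) M (X q ω) + 3 * T) ∂μ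
      = 8 * T := by
    rw [integral_add j1 (integrable_const _), integral_add (it n) ((it q).const_mul 4),
      integral_const_mul, h.integral_tailPow, h.integral_tailPow (2 + δ) M q, ← hTdef]
    simp only [integral_const, probReal_univ, one_smul]
    ring
  have hce : b * |c - e| ≤ 8 * T := by
    rw [hc, he, ← integral_sub iXX icc, ← vD1]
    calc b * |∫ ω, (X n ω * X q ω - ctrunc μ M (X n) ω * ctrunc μ M (X q) ω) ∂μ|
        ≤ b * ∫ ω, |X n ω * X q ω - ctrunc μ M (X n) ω * ctrunc μ M (X q) ω| ∂μ := by
          gcongr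
          exact abs_integral_le_integral_abs
      _ = ∫ ω, b * |X n ω * X q ω - ctrunc μ M (X n) ω * ctrunc μ M (X q) ω| ∂μ :=
          (integral_const_mul _ _).symm
      _ ≤ _ := integral_mono_of_nonneg (.of_forall fun _ => by positivity) hD1
          (.of_forall fun ω => h.rpow_mul_abs_mul_sub_le hδ0 hM n q ω)
  have j2 : Integrable (fun ω => tailPow (2 + δ) M (X m ω) + tailPow (2 + δ) M (X n ω)) μ :=
    (it m).add (it n)
  have j3 : Integrable (fun ω => tailPow (2 + δ) M (X m ω) + tailPow (2 + δ) M (X n ω)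
    + tailPow (2 + δ) M (X q ω)) μ := j2.add (it q)
  have j4 : Integrable (fun ω => tailPow (2 + δ) M (X m ω) + tailPow (2 + δ) M (X n ω)
    + tailPow (2 + δ) M (X q ω) + (tailPow (2 + δ) M (X n ω)
      + 4 * tailPow (2 + δ) M (X q ω) + 3 * T)) μ := j3.add hD1
  have j5 : Integrable (fun ω => tailPow δ M (X m ω) * V + 8 * T) μ :=
    (itδ.mul_const V).add (integrable_const _)
  have hInt : Integrable (fun ω => clip b (R ω)
      * (ctrunc μ M (X n) ω * ctrunc μ M (X q) ω - e)) μ := by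
    refine (icc.sub (integrable_const e)).bdd_mul (c := b) hRcm.aestronglyMeasurable
      (.of_forall fun ω => ?_)
    exact abs_clip_le hb0 _
  have key := abs_integral_le_add (f := fun ω => R ω * (X n ω * X q ω - c))
    (hRm.mul (((h.measurable n).mul (h.measurable q)).sub measurable_const)).aestronglyMeasurable
    hInt (j4.add j5) fun ω => by
      have hdiff : |R ω - clip b (R ω)| ≤ tailPow δ M (X m ω) := by
        by_cases hcase : M < |X m ω|
        · rw [tailPow_of_lt hcase]
          exact (abs_sub_clip_le hb0 _).trans (hRb ω)
        · have : |R ω| ≤ b :=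
            (hRb ω).trans (Real.rpow_le_rpow (abs_nonneg _) (not_lt.1 hcase) hδ0.le)
          rw [clip_of_abs_le this, sub_self, abs_zero]
          exact tailPow_nonneg _ _ _
      have hsplit : R ω * (X n ω * X q ω - c)
          - clip b (R ω) * (ctrunc μ M (X n) ω * ctrunc μ M (X q) ω - e)
          = (R ω - clip b (R ω)) * (X n ω * X q ω)
            + clip b (R ω) * (X n ω * X q ω - ctrunc μ M (X n) ω * ctrunc μ M (X q) ω)
            + (-((R ω - clip b (R ω)) * c) + -(clip b (R ω) * (c - e))) := by ring
      simp only [Pi.add_apply]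
      rw [hsplit]
      refine (abs_add_le _ _).trans (add_le_add ((abs_add_le _ _).trans (add_le_add ?_ ?_))
        ((abs_add_le _ _).trans (add_le_add ?_ ?_)))
      · rw [abs_mul, abs_mul]
        by_cases hcase : M < |X m ω|
        · rw [tailPow_of_lt hcase] at hdiff
          exact (mul_le_mul_of_nonneg_right hdiff (by positivity)).trans
            (rpow_mul_mul_le_tailPow hδ0 (Or.inl hcase))
        · rw [tailPow_of_le (not_lt.1 hcase)] at hdiff
          rw [le_antisymm hdiff (abs_nonneg _), zero_mul]
          have := tailPow_nonneg (2 + δ) M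
          linarith [this (X m ω), this (X n ω), this (X q ω)]
      · rw [abs_mul]
        exact (mul_le_mul_of_nonneg_right (abs_clip_le hb0 _) (abs_nonneg _)).trans
          (h.rpow_mul_abs_mul_sub_le hδ0 hM n q ω)
      · rw [abs_neg, abs_mul]
        exact mul_le_mul hdiff hcV (abs_nonneg _) (tailPow_nonneg _ _ _)
      · rw [abs_neg, abs_mul]
        exact (mul_le_mul_of_nonneg_right (abs_clip_le hb0 _) (abs_nonneg _)).trans hce
  have hval := integral_add j4 j5
  have hval4 := integral_add j3 hD1
  have hval3 := integral_add j2 (it q)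
  have hval2 := integral_add (it m) (it n)
  have hval5 := integral_add (itδ.mul_const V) (integrable_const (8 * T))
  rw [integral_mul_const, h.integral_tailPow δ M m] at hval5
  simp only [integral_const, probReal_univ, one_smul] at hval5
  rw [h.integral_tailPow (2 + δ) M m, h.integral_tailPow (2 + δ) M n] at hval2
  rw [h.integral_tailPow (2 + δ) M q] at hval3
  rw [vD1] at hval4
  simp only [Pi.add_apply] at key
  rw [hval, hval4, hval3, hval2, hval5, ← hTdef] at key
  have hKV := mul_le_mul_of_nonneg_right (hKT M hM) hV0
  rw [← hTdef] at hKV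
  have e1 : M ^ (1 + δ) = b * M := by rw [hb, add_comm, Real.rpow_add_one' hM (by linarith)]
  rw [e1, mul_assoc]
  linarith

/-- Summable truncated dependence yields the bounds needed for the Lindeberg method. -/
theorem exists_dependenceBounds (h : IsTransferable μ X F δ) (hδ0 : 0 < δ) {t : ℕ → ℝ}
    (hdep : ∀ k, ∀ η > 0, ∃ M κ : ℝ, 0 ≤ M ∧ 0 ≤ κ ∧ TruncDep μ X F M κ (k + 1) ∧
      M ^ (1 + δ) * κ + ∫ ω, tailPow (2 + δ) M (X 0 ω) ∂μ ≤ t k + η)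
    (hsum : Summable fun k : ℕ => ((k : ℝ) + 1) * t k) :
    ∃ (B : ℝ) (c θ : ℕ → ℝ), DependenceBounds μ X F δ B c θ := by
  obtain ⟨C₁, hC₁, hcov⟩ := h.exists_abs_cov_le hδ0
  obtain ⟨C₂, hC₂, hfut⟩ := h.exists_abs_integral_mul_cov_le hδ0
  set A := ∫ ω, |X 0 ω| ^ δ ∂μ with hA
  have hA0 : 0 ≤ A := integral_nonneg fun _ => by positivity
  -- One constant for all fields: 6 covers the numerical factors, C₁ the covariances, C₂ the
  -- products of two future variables, and C₁ * A the subtraction of c (k + 1) E R in `past`.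
  set C := 6 + C₁ + C₂ + C₁ * A with hC
  have hC0 : 0 < C := by positivity
  set c : ℕ → ℝ := fun j => ∫ ω, X 0 ω * X j ω ∂μ with hc
  have hcc : ∀ (m n : ℤ) (k : ℕ), n = m + k → ∫ ω, X m ω * X n ω ∂μ = c k := by
    intro m n k hn
    have := h.integral_pair (φ := fun z => z.1 * z.2) (by fun_prop) 0 k m
    rw [zero_add, add_comm (k : ℤ) m, ← hn] at this
    exact this
  -- The value t k need not be attained at any truncation level, so it is approached up to an
  -- arbitrary η.
  have hlim : ∀ (k : ℕ) (x : ℝ), (∀ M κ : ℝ, 0 ≤ M → 0 ≤ κ → TruncDep μ X F M κ (k + 1) →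
      x ≤ C * (M ^ (1 + δ) * κ + ∫ ω, tailPow (2 + δ) M (X 0 ω) ∂μ)) → x ≤ C * t k := by
    intro k x hx
    refine le_of_forall_pos_le_add fun ε hε => ?_
    obtain ⟨M, κ, hM, hκ, hT, hle⟩ := hdep k (ε / C) (by positivity)
    calc x ≤ C * (M ^ (1 + δ) * κ + ∫ ω, tailPow (2 + δ) M (X 0 ω) ∂μ) := hx M κ hM hκ hT
      _ ≤ C * (t k + ε / C) := by gcongr
      _ = C * t k + ε := by field_simp
  refine ⟨∫ ω, |X 0 ω| ^ (2 + δ) ∂μ, c, fun k => C * t k,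
    h.adapted, h.memLp, fun i => le_of_eq ?_, h.mean, hcc, ?_, ?_, ?_, ?_, ?_⟩
  · exact h.integral_single (φ := fun x => |x| ^ (2 + δ)) (by fun_prop) i
  · intro m n k R hn hR hRb
    refine hlim k _ fun M κ hM hκ hT => ?_
    have hb := h.abs_integral_mul_le hδ0 hM hT (a := m) (m := m) (n := n)
      (by rw [hn]; push_cast; ring) hR fun ω => by
        have := hRb ω
        rwa [add_comm 1 δ, Real.rpow_add_one' (abs_nonneg _) (by linarith)] at this
    have hT0 := integral_tailPow_nonneg (μ := μ) (X := X) (2 + δ) M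
    have hb0 : 0 ≤ M ^ (1 + δ) * κ := by positivity
    have : 0 ≤ C₁ * A := by positivity
    nlinarith
  · intro a m n k R ham hn hR hRb
    refine hlim k _ fun M κ hM hκ hT => ?_
    have hn' : n = ((k + 1 : ℕ) : ℤ) + m := by rw [hn]; push_cast; ring
    have hRm : Measurable R := hR.mono (F.le m) le_rfl
    have hb := h.abs_integral_mul_le hδ0 hM hT (a := a) (m := m) (n := n) hn'
      (R := fun ω => R ω * X m ω) (hR.mul (h.adapted m)) fun ω => by
        rw [abs_mul]
        gcongr
        exact hRb ω
    have hcv := hcov M κ (k + 1) m n hM hκ hT hn'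
    rw [hcc m n (k + 1) (by rw [hn]; push_cast; ring)] at hcv
    have iA : Integrable (fun ω => |X a ω| ^ δ) μ :=
      integrable_abs_rpow hδ0.le (by linarith) (h.memLp a)
    have iR : Integrable R μ := iA.mono' hRm.aestronglyMeasurable (.of_forall hRb)
    have iRX : Integrable (fun ω => R ω * (X m ω * X n ω)) μ :=
      integrable_mul_mul_of_abs_le_rpow hδ0 hRm.aestronglyMeasurable (h.memLp a) hRb
        (h.memLp m) (h.memLp n)
    have hRA : |∫ ω, R ω ∂μ| ≤ A := by
      rw [hA, ← h.integral_single (φ := fun x => |x| ^ δ) (by fun_prop) a]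
      exact abs_integral_le_integral_abs.trans (integral_mono_of_nonneg
        (.of_forall fun _ => abs_nonneg _) iA (.of_forall hRb))
    have e : ∫ ω, R ω * (X m ω * X n ω - c (k + 1)) ∂μ
        = ∫ ω, R ω * X m ω * X n ω ∂μ - c (k + 1) * ∫ ω, R ω ∂μ := by
      have iRX' : Integrable (fun ω => R ω * X m ω * X n ω) μ := by
        simpa only [mul_assoc] using iRX
      rw [← integral_const_mul, ← integral_sub iRX' (iR.const_mul _)]
      refine integral_congr_ae (.of_forall fun ω => ?_)
      simp only
      ring
    rw [e]
    have hT0 := integral_tailPow_nonneg (μ := μ) (X := X) (2 + δ) M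
    have hb0 : 0 ≤ M ^ (1 + δ) * κ := by positivity
    set S := M ^ (1 + δ) * κ + ∫ ω, tailPow (2 + δ) M (X 0 ω) ∂μ with hS
    have hS0 : 0 ≤ S := by positivity
    have h2 : |c (k + 1) * ∫ ω, R ω ∂μ| ≤ C₁ * S * A := by
      rw [abs_mul]
      exact mul_le_mul hcv hRA (abs_nonneg _) (by positivity)
    have h3 := abs_sub (∫ ω, R ω * X m ω * X n ω ∂μ) (c (k + 1) * ∫ ω, R ω ∂μ)
    have h4 : C * S = 6 * S + C₁ * S + C₂ * S + C₁ * S * A := by rw [hC]; ring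
    have h5 : 0 ≤ C₁ * S := by positivity
    have h6 : 0 ≤ C₂ * S := by positivity
    linarith
  · intro m n q k j R hn hq hR hRb
    refine hlim k _ fun M κ hM hκ hT => ?_
    have hb := hfut M κ (k + 1) j m n q R hM hT (by rw [hn]; push_cast; ring)
      (by rw [hq, hn]; push_cast; ring) hR hRb
    rw [hcc n q j hq] at hb
    have hT0 := integral_tailPow_nonneg (μ := μ) (X := X) (2 + δ) M
    have hb0 : 0 ≤ M ^ (1 + δ) * κ := by positivity
    set T := ∫ ω, tailPow (2 + δ) M (X 0 ω) ∂μ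
    set S := M ^ (1 + δ) * κ
    have h4 : C * (S + T) = 6 * (S + T) + C₁ * (S + T) + C₂ * S + C₂ * T + C₁ * (S + T) * A := by
      rw [hC]; ring
    have h5 : 0 ≤ C₁ * (S + T) := by positivity
    have h6 : 0 ≤ C₂ * S := by positivity
    have h7 : 0 ≤ C₁ * (S + T) * A := by positivity
    linarith
  · intro k
    refine hlim k _ fun M κ hM hκ hT => ?_
    have hcv := hcov M κ (k + 1) 0 (k + 1 : ℕ) hM hκ hT (by simp)
    have hT0 := integral_tailPow_nonneg (μ := μ) (X := X) (2 + δ) M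
    have hb0 : 0 ≤ M ^ (1 + δ) * κ := by positivity
    refine hcv.trans (mul_le_mul_of_nonneg_right ?_ (by positivity))
    have : 0 ≤ C₁ * A := by positivity
    linarith
  · refine (hsum.mul_left C).congr fun k => ?_
    ring

end IsTransferable

/-! ### Tail quantile functions -/

theorem volume_pos_ofReal_lt (p : ℝ≥0∞) : volume {u : ℝ | 0 < u ∧ ENNReal.ofReal u < p} = p := by
  induction p with
  | top =>
    have : {u : ℝ | 0 < u ∧ ENNReal.ofReal u < ∞} = Set.Ioi 0 := by ext u; simp
    rw [this, Real.volume_Ioi]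
  | coe p =>
    have : {u : ℝ | 0 < u ∧ ENNReal.ofReal u < p} = Set.Ioo 0 (p : ℝ) := by
      ext u
      simp only [Set.mem_ofPred_eq, Set.mem_Ioo]
      refine and_congr_right fun hu => ?_
      rw [← ENNReal.ofReal_coe_nnreal, ENNReal.ofReal_lt_ofReal_iff_of_nonneg hu.le]
    rw [this, Real.volume_Ioo, sub_zero, ENNReal.ofReal_coe_nnreal]

theorem lintegral_eq_lintegral_meas_ofReal_lt {α : Type*} {mα : MeasurableSpace α}
    (μ : Measure α) [SFinite μ] {f : α → ℝ≥0∞} (hf : Measurable f) :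
    ∫⁻ x, f x ∂μ = ∫⁻ s in Set.Ioi (0 : ℝ), μ {x | ENNReal.ofReal s < f x} := by
  have hm : MeasurableSet {p : α × ℝ | ENNReal.ofReal p.2 < f p.1} :=
    measurableSet_lt (by fun_prop) (by fun_prop)
  calc ∫⁻ x, f x ∂μ
      = ∫⁻ x, (∫⁻ s in Set.Ioi (0 : ℝ),
          {p : α × ℝ | ENNReal.ofReal p.2 < f p.1}.indicator 1 (x, s)) ∂μ := by
        refine lintegral_congr fun x => ?_
        have e : ∀ s : ℝ, {p : α × ℝ | ENNReal.ofReal p.2 < f p.1}.indicator (1 : α × ℝ → ℝ≥0∞)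
            (x, s) = {s : ℝ | ENNReal.ofReal s < f x}.indicator 1 s := fun s => rfl
        have hx : MeasurableSet {s : ℝ | ENNReal.ofReal s < f x} :=
          measurableSet_lt (by fun_prop) measurable_const
        simp_rw [e]
        rw [lintegral_indicator_one hx, Measure.restrict_apply hx]
        conv_lhs => rw [← volume_pos_ofReal_lt (f x)]
        congr 1
        ext s
        simp [and_comm]
    _ = ∫⁻ s in Set.Ioi (0 : ℝ), (∫⁻ x,
          {p : α × ℝ | ENNReal.ofReal p.2 < f p.1}.indicator 1 (x, s) ∂μ) :=
        lintegral_lintegral_swap (measurable_one.indicator hm).aemeasurable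
    _ = _ := by
        refine lintegral_congr fun s => ?_
        have e : ∀ x, {p : α × ℝ | ENNReal.ofReal p.2 < f p.1}.indicator (1 : α × ℝ → ℝ≥0∞)
            (x, s) = {x | ENNReal.ofReal s < f x}.indicator 1 x := fun x => rfl
        simp_rw [e]
        exact lintegral_indicator_one (measurableSet_lt measurable_const hf)

theorem lintegral_rpow_le_of_meas_lt_le {α β : Type*} {mα : MeasurableSpace α}
    {mβ : MeasurableSpace β} {μ : Measure α} {ν : Measure β} [SFinite μ] [SFinite ν]
    {f : α → ℝ≥0∞} {g : β → ℝ≥0∞} (hf : Measurable f) (hg : Measurable g) {q : ℝ} (hq : 0 < q)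
    (h : ∀ s : ℝ≥0∞, μ {x | s < f x} ≤ ν {y | s < g y}) :
    ∫⁻ x, f x ^ q ∂μ ≤ ∫⁻ y, g y ^ q ∂ν := by
  rw [lintegral_eq_lintegral_meas_ofReal_lt μ (hf.pow_const q),
    lintegral_eq_lintegral_meas_ofReal_lt ν (hg.pow_const q)]
  refine lintegral_mono fun s => ?_
  simp_rw [← ENNReal.rpow_inv_lt_iff hq]
  exact h _

/-- The function g dominates the upper quantile of f. On an event of mass at most a, the part of f
above s has mass at most both a and μ(f > s), hence at most the length of {u ≤ a : g u > s}; the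
layer-cake formula concludes. -/
theorem lintegral_tail_rpow_le {α : Type*} {mα : MeasurableSpace α} {μ : Measure α} [SFinite μ]
    {f : α → ℝ≥0∞} {g : ℝ → ℝ≥0∞} (hf : Measurable f) (hg : Antitone g)
    (hfg : ∀ u > 0, μ {x | g u < f x} ≤ ENNReal.ofReal u) {q : ℝ} (hq : 0 < q) {N a : ℝ≥0∞}
    (hN : μ {x | N < f x} ≤ a) :
    ∫⁻ x in {x | N < f x}, f x ^ q ∂μ
      ≤ ∫⁻ u in {u : ℝ | 0 < u ∧ ENNReal.ofReal u ≤ a}, g u ^ q := by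
  refine lintegral_rpow_le_of_meas_lt_le hf hg.measurable hq fun s => ?_
  have hs : MeasurableSet {u : ℝ | s < g u} := measurableSet_lt measurable_const hg.measurable
  rw [Measure.restrict_apply (measurableSet_lt measurable_const hf), Measure.restrict_apply hs]
  rw [← volume_pos_ofReal_lt (μ _)]
  refine measure_mono fun u ⟨hu, hlt⟩ => ⟨?_, hu, ?_⟩
  · by_contra hle
    have hle : g u ≤ s := not_lt.1 hle
    refine absurd (hfg u hu) (not_le.2 (hlt.trans_le (measure_mono fun x hx => ?_)))
    exact hle.trans_lt hx.1
  · exact hlt.le.trans ((measure_mono Set.inter_subset_right).trans hN)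

section Quantile

variable {Ω : Type u} {mΩ : MeasurableSpace Ω} {μ : Measure Ω} {U : Ω → ℝ}

theorem antitone_tailQuantile : Antitone (tailQuantile μ U) := fun _ _ h =>
  sInf_le_sInf fun _ ht => le_trans ht (ENNReal.ofReal_le_ofReal h)

theorem measure_tailQuantile_lt_le (u : ℝ) :
    μ {ω | tailQuantile μ U u < ‖U ω‖ₑ} ≤ ENNReal.ofReal u := by
  obtain ⟨t, ht, hlim, hmem⟩ := exists_seq_tendsto_sInf
    (S := {t : ℝ≥0∞ | μ {ω | t < ‖U ω‖ₑ} ≤ ENNReal.ofReal u}) ⟨∞, by simp⟩ (OrderBot.bddBelow _)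
  have hsub : {ω | tailQuantile μ U u < ‖U ω‖ₑ} ⊆ ⋃ n, {ω | t n < ‖U ω‖ₑ} := fun ω hω => by
    obtain ⟨n, hn⟩ := (hlim.eventually (gt_mem_nhds hω)).exists
    exact Set.mem_iUnion.2 ⟨n, hn⟩
  have hmono : Monotone fun n => {ω | t n < ‖U ω‖ₑ} := fun m n hmn ω hω =>
    (ht hmn).trans_lt hω
  refine (measure_mono hsub).trans ?_
  rw [hmono.measure_iUnion]
  exact iSup_le hmem

theorem bddAbove_invIntQuantile (v : ℝ) : BddAbove {x : ℝ | x ∈ Set.Icc (0 : ℝ) 1 ∧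
    ∫⁻ u in Set.Ioc 0 x, tailQuantile μ U u ≤ ENNReal.ofReal v} := ⟨1, fun _ hx => hx.1.2⟩

theorem nonempty_invIntQuantile (v : ℝ) : {x : ℝ | x ∈ Set.Icc (0 : ℝ) 1 ∧
    ∫⁻ u in Set.Ioc 0 x, tailQuantile μ U u ≤ ENNReal.ofReal v}.Nonempty := ⟨0, by simp⟩

theorem monotone_invIntQuantile : Monotone (invIntQuantile μ U) := fun _ _ h =>
  csSup_le_csSup (bddAbove_invIntQuantile _) (nonempty_invIntQuantile _)
    fun _ hx => ⟨hx.1, hx.2.trans (ENNReal.ofReal_le_ofReal h)⟩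

theorem lintegral_tailQuantile_invIntQuantile_le (v : ℝ) :
    ∫⁻ u in Set.Ioc 0 (invIntQuantile μ U v), tailQuantile μ U u ≤ ENNReal.ofReal v := by
  obtain ⟨x, hx, hlim, hmem⟩ := exists_seq_tendsto_sSup (nonempty_invIntQuantile (μ := μ) (U := U) v)
    (bddAbove_invIntQuantile v)
  rw [← Measure.restrict_congr_set Ioo_ae_eq_Ioc]
  have hsub : Set.Ioo 0 (invIntQuantile μ U v) ⊆ ⋃ n, Set.Ioc 0 (x n) := fun u hu => by
    obtain ⟨n, hn⟩ := (hlim.eventually (lt_mem_nhds hu.2)).exists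
    exact Set.mem_iUnion.2 ⟨n, hu.1, hn.le⟩
  refine (lintegral_mono_set hsub).trans ?_
  rw [setLIntegral_iUnion_of_directed _
    (Monotone.directed_le fun m n h => Set.Ioc_subset_Ioc_right (hx h))]
  exact iSup_le fun n => (hmem n).2

/-- The integral of |U| over {|U| > Q(x)} is at most that of Q over (0, x], and x = G(v) keeps the
latter below v. So Q ∘ G bounds the quantile of |U| under the reweighted measure |U|·μ. -/
theorem withDensity_tailQuantile_invIntQuantile_lt_le [IsFiniteMeasure μ] (hU : Measurable U)
    (v : ℝ) :
    μ.withDensity (fun ω => ‖U ω‖ₑ)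
      {ω | tailQuantile μ U (invIntQuantile μ U v) < ‖U ω‖ₑ} ≤ ENNReal.ofReal v := by
  have h0 : 0 ≤ invIntQuantile μ U v := le_csSup (bddAbove_invIntQuantile v) (by simp)
  rw [withDensity_apply _ (measurableSet_lt measurable_const hU.enorm)]
  have h := lintegral_tail_rpow_le hU.enorm antitone_tailQuantile
    (fun u _ => measure_tailQuantile_lt_le (μ := μ) u) one_pos
    (measure_tailQuantile_lt_le (μ := μ) (U := U) (invIntQuantile μ U v))
  simp only [ENNReal.rpow_one] at h
  refine h.trans ((lintegral_mono_set fun u hu => ?_).trans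
    (lintegral_tailQuantile_invIntQuantile_le v))
  exact ⟨hu.1, (ENNReal.ofReal_le_ofReal_iff h0).1 hu.2⟩

theorem rpow_mul_le_setLIntegral {g : ℝ → ℝ≥0∞} (hg : Antitone g) {a : ℝ≥0∞} (ha : a ≠ ∞) {q : ℝ}
    (hq : 0 < q) :
    g a.toReal ^ q * a ≤ ∫⁻ u in {u : ℝ | 0 < u ∧ ENNReal.ofReal u ≤ a}, g u ^ q := by
  have hset : MeasurableSet {u : ℝ | 0 < u ∧ ENNReal.ofReal u ≤ a} :=
    (measurableSet_lt measurable_const measurable_id).inter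
      (measurableSet_le ENNReal.measurable_ofReal measurable_const)
  calc g a.toReal ^ q * a ≤ g a.toReal ^ q * volume {u : ℝ | 0 < u ∧ ENNReal.ofReal u ≤ a} := by
        gcongr
        conv_lhs => rw [← volume_pos_ofReal_lt a]
        exact measure_mono fun u hu => ⟨hu.1, hu.2.le⟩
    _ = ∫⁻ _ in {u : ℝ | 0 < u ∧ ENNReal.ofReal u ≤ a}, g a.toReal ^ q := by
        rw [setLIntegral_const]
    _ ≤ _ := setLIntegral_mono' hset fun u hu => by
        gcongr
        exact hg ((ENNReal.ofReal_le_iff_le_toReal ha).1 hu.2)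

/-- The level is g(a). Monotonicity gives g(a)^q a ≤ ∫_0^a g^q, and {f > g(a)} has mass at most a.
If a = ∞ the level 0 is used: `toReal` then makes the first bound trivial, and truncation at 0
leaves nothing whose dependence has to be measured. -/
theorem exists_truncation_level [SFinite μ] {f : Ω → ℝ≥0∞} {g : ℝ → ℝ≥0∞} (hf : Measurable f)
    (hg : Antitone g) (hfg : ∀ u > 0, μ {x | g u < f x} ≤ ENNReal.ofReal u) {q : ℝ} (hq : 0 < q)
    {a : ℝ≥0∞} (ha : a ≠ 0)
    (hI : ∫⁻ u in {u : ℝ | 0 < u ∧ ENNReal.ofReal u ≤ a}, g u ^ q ≠ ∞) :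
    ∃ M : ℝ≥0, (a = ∞ → M = 0) ∧
      (M : ℝ≥0∞) ^ q * ENNReal.ofReal a.toReal
        ≤ ∫⁻ u in {u : ℝ | 0 < u ∧ ENNReal.ofReal u ≤ a}, g u ^ q ∧
      ∫⁻ x in {x | (M : ℝ≥0∞) < f x}, f x ^ q ∂μ
        ≤ ∫⁻ u in {u : ℝ | 0 < u ∧ ENNReal.ofReal u ≤ a}, g u ^ q := by
  by_cases hat : a = ∞
  · exact ⟨0, fun _ => rfl, by simp [hat],
      lintegral_tail_rpow_le hf hg hfg hq (hat ▸ le_top)⟩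
  have hle := rpow_mul_le_setLIntegral hg hat hq
  have hfin : g a.toReal ≠ ∞ := fun h => by
    rw [h, ENNReal.top_rpow_of_pos hq, ENNReal.top_mul ha] at hle
    exact hI (top_le_iff.1 hle)
  refine ⟨(g a.toReal).toNNReal, fun h => absurd h hat, ?_, ?_⟩
  · rwa [ENNReal.coe_toNNReal hfin, ENNReal.ofReal_toReal hat]
  · refine lintegral_tail_rpow_le hf hg hfg hq ?_
    rw [ENNReal.coe_toNNReal hfin]
    exact (hfg _ (ENNReal.toReal_pos ha hat)).trans ENNReal.ofReal_toReal_le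

end Quantile

/-! ### Truncated dependence from the α and τ coefficients -/

section

variable {Ω : Type u} {m mΩ : MeasurableSpace Ω} {μ : Measure Ω} [IsProbabilityMeasure μ]
  {W f : Ω → ℝ}

theorem abs_integral_mul_le_eLpNorm_condExp (hm : m ≤ mΩ) (hW : Measurable[m] W)
    (hW1 : ∀ ω, |W ω| ≤ 1) (hf : Integrable f μ) :
    ENNReal.ofReal |∫ ω, W ω * f ω ∂μ| ≤ eLpNorm (μ[f | m]) 1 μ := by
  have hWf : Integrable (W * f) μ := hf.bdd_mul (hW.mono hm le_rfl).aestronglyMeasurable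
    (.of_forall fun ω => hW1 ω)
  have e : ∫ ω, W ω * f ω ∂μ = ∫ ω, W ω * (μ[f | m]) ω ∂μ := by
    rw [show ∫ ω, W ω * f ω ∂μ = ∫ ω, (W * f) ω ∂μ from rfl, ← integral_condExp hm]
    exact integral_congr_ae
      (condExp_mul_of_stronglyMeasurable_left hW.stronglyMeasurable hWf hf)
  rw [e, ← Real.enorm_eq_ofReal_abs, eLpNorm_one_eq_lintegral_enorm]
  refine (enorm_integral_le_lintegral_enorm _).trans (lintegral_mono fun ω => ?_)
  rw [enorm_mul]
  refine mul_le_of_le_one_left (zero_le) ?_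
  rw [Real.enorm_eq_ofReal_abs]
  exact ENNReal.ofReal_le_one.2 (hW1 ω)

/-- By Fubini, a covariance bound for each function K(·, s) passes to their mixture, multiplied by
the mass of ν. It is applied to indicators mixed over (-M, M], or over its square. -/
theorem abs_integral_mul_sub_le_of_kernel {S : Type*} [MeasurableSpace S] {ν : Measure S}
    [IsFiniteMeasure ν] {K : Ω × S → ℝ} (hK : Measurable K) {C : ℝ} (hKC : ∀ p, |K p| ≤ C)
    (hW : Measurable W) (hW1 : ∀ ω, |W ω| ≤ 1) {a : ℝ}
    (ha : ∀ s, |∫ ω, W ω * (K (ω, s) - ∫ ω', K (ω', s) ∂μ) ∂μ| ≤ a) :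
    |∫ ω, W ω * (∫ s, K (ω, s) ∂ν - ∫ ω', ∫ s, K (ω', s) ∂ν ∂μ) ∂μ| ≤ a * ν.real Set.univ := by
  have hKi : Integrable K (μ.prod ν) :=
    .of_bound hK.aestronglyMeasurable C (.of_forall fun p => hKC p)
  have hcm : Measurable fun s => ∫ ω', K (ω', s) ∂μ :=
    (hK.stronglyMeasurable.integral_prod_left' (μ := μ)).measurable
  have hc : ∀ s, |∫ ω', K (ω', s) ∂μ| ≤ C := fun s => abs_integral_le_of_abs_le fun ω => hKC _
  have hci : Integrable (fun s => ∫ ω', K (ω', s) ∂μ) ν :=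
    .of_bound hcm.aestronglyMeasurable C (.of_forall hc)
  have hbig : Integrable (fun p : Ω × S => W p.1 * (K p - ∫ ω', K (ω', p.2) ∂μ)) (μ.prod ν) := by
    refine .of_bound ((hW.comp measurable_fst).mul (hK.sub
      (hcm.comp measurable_snd))).aestronglyMeasurable (2 * C) (.of_forall fun p => ?_)
    rw [Real.norm_eq_abs, abs_mul]
    have h1 := abs_sub (K p) (∫ ω', K (ω', p.2) ∂μ)
    have h2 := hKC p
    have h3 := hc p.2
    calc |W p.1| * |K p - ∫ ω', K (ω', p.2) ∂μ| ≤ 1 * |K p - ∫ ω', K (ω', p.2) ∂μ| := by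
          gcongr; exact hW1 _
      _ ≤ 2 * C := by linarith
  have e : ∫ ω, W ω * (∫ s, K (ω, s) ∂ν - ∫ ω', ∫ s, K (ω', s) ∂ν ∂μ) ∂μ
      = ∫ s, ∫ ω, W ω * (K (ω, s) - ∫ ω', K (ω', s) ∂μ) ∂μ ∂ν := by
    rw [integral_integral_swap (f := fun ω' s => K (ω', s)) hKi]
    rw [← integral_integral_swap
      (f := fun ω s => W ω * (K (ω, s) - ∫ ω', K (ω', s) ∂μ)) hbig]
    refine integral_congr_ae (.of_forall fun ω => ?_)
    have hKω : Integrable (fun s => K (ω, s)) ν :=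
      .of_bound (hK.comp measurable_prodMk_left).aestronglyMeasurable C (.of_forall fun s => hKC _)
    simp only
    rw [integral_const_mul, integral_sub hKω hci]
  rw [e]
  rw [← Real.norm_eq_abs]
  exact norm_integral_le_of_norm_le_const (.of_forall fun s => (Real.norm_eq_abs _).trans_le (ha s))

theorem integral_indicator_le_eq {M : ℝ} (hM : 0 ≤ M) (x : ℝ) :
    ∫ s in Set.Ioc (-M) M, (Set.Ici x).indicator (fun _ => (1 : ℝ)) s = M - clip M x := by
  have hae : (Set.Ici x).indicator (fun _ => (1 : ℝ))
      =ᵐ[volume.restrict (Set.Ioc (-M) M)] (Set.Ioi x).indicator (fun _ => (1 : ℝ)) :=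
    ae_restrict_of_ae (indicator_ae_eq_of_ae_eq_set Ioi_ae_eq_Ici.symm)
  rw [integral_congr_ae hae, integral_indicator measurableSet_Ioi,
    Measure.restrict_restrict measurableSet_Ioi, setIntegral_const, Set.inter_comm,
    Set.Ioc_inter_Ioi, Real.volume_real_Ioc, smul_eq_mul, mul_one]
  unfold clip
  rcases le_total x M with h | h
  · rw [min_eq_right h, max_eq_left, max_comm]
    linarith [max_le (a := -M) (b := x) (c := M) (by linarith) h, max_comm x (-M)]
  · rw [min_eq_left h, max_eq_right (a := -M) (b := M) (by linarith), sub_self, max_eq_right]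
    linarith [le_max_right (-M) x]

theorem measurable_uncurry_indicator_le {U : Ω → ℝ} (hU : Measurable U) :
    Measurable fun p : Ω × ℝ => {ω' | U ω' ≤ p.2}.indicator (fun _ => (1 : ℝ)) p.1 := by
  have hs : MeasurableSet {p : Ω × ℝ | U p.1 ≤ p.2} := measurableSet_le (by fun_prop) (by fun_prop)
  exact (measurable_const (a := (1 : ℝ))).indicator hs

theorem measurable_uncurry_centeredInd {U : Ω → ℝ} (hU : Measurable U) :
    Measurable fun p : Ω × ℝ => centeredInd μ U p.2 p.1 := by
  refine (measurable_uncurry_indicator_le hU).sub ?_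
  have : Monotone fun s => μ.real {ω' | U ω' ≤ s} := fun s t h =>
    measureReal_mono fun ω hω => le_trans hω h
  exact this.measurable.comp measurable_snd

theorem abs_indicator_one_le (A : Set Ω) (ω : Ω) : |A.indicator (fun _ => (1 : ℝ)) ω| ≤ 1 := by
  by_cases h : ω ∈ A <;> simp [h]

theorem abs_centeredInd_le (U : Ω → ℝ) (x : ℝ) (ω : Ω) : |centeredInd μ U x ω| ≤ 1 := by
  have h1 : μ.real {ω' | U ω' ≤ x} ≤ 1 := measureReal_le_one
  have h0 : 0 ≤ μ.real {ω' | U ω' ≤ x} := measureReal_nonneg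
  unfold centeredInd
  by_cases h : ω ∈ {ω' | U ω' ≤ x}
  · rw [Set.indicator_of_mem h, abs_le]; constructor <;> linarith
  · rw [Set.indicator_of_notMem h, abs_le]; constructor <;> linarith

theorem setIntegral_indicator_le {M : ℝ} (hM : 0 ≤ M) (U : Ω → ℝ) (ω : Ω) :
    ∫ s in Set.Ioc (-M) M, {ω' | U ω' ≤ s}.indicator (fun _ => (1 : ℝ)) ω = M - clip M (U ω) :=
  integral_indicator_le_eq hM (U ω)

theorem integral_const_sub_clip {M : ℝ} (hM : 0 ≤ M) {U : Ω → ℝ} (hU : Measurable U) :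
    ∫ ω, (M - clip M (U ω)) ∂μ = M - ∫ ω, clip M (U ω) ∂μ := by
  have hi : Integrable (fun ω => clip M (U ω)) μ :=
    .of_bound ((measurable_clip M).comp hU).aestronglyMeasurable M
      (.of_forall fun ω => abs_clip_le hM _)
  rw [integral_sub (integrable_const _) hi]
  simp

theorem ctrunc_eq_neg_setIntegral {M : ℝ} (hM : 0 ≤ M) {U : Ω → ℝ} (hU : Measurable U) (ω : Ω) :
    ctrunc μ M U ω = -∫ s in Set.Ioc (-M) M, centeredInd μ U s ω := by
  have hmeas := measurable_uncurry_indicator_le hU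
  have hInt : ∀ ω, Integrable (fun s => {ω' | U ω' ≤ s}.indicator (fun _ => (1 : ℝ)) ω)
      (volume.restrict (Set.Ioc (-M) M)) := fun ω =>
    .of_bound (hmeas.comp measurable_prodMk_left).aestronglyMeasurable 1
      (.of_forall fun s => abs_indicator_one_le _ _)
  have hprod : Integrable (fun p : Ω × ℝ => {ω' | U ω' ≤ p.2}.indicator (fun _ => (1 : ℝ)) p.1)
      (μ.prod (volume.restrict (Set.Ioc (-M) M))) :=
    .of_bound hmeas.aestronglyMeasurable 1 (.of_forall fun s => abs_indicator_one_le _ _)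
  have hr : ∀ s, μ.real {ω' | U ω' ≤ s} = ∫ ω, {ω' | U ω' ≤ s}.indicator (fun _ => (1 : ℝ)) ω ∂μ :=
    fun s => (integral_indicator_one (measurableSet_le hU measurable_const)).symm
  have hri : Integrable (fun s => μ.real {ω' | U ω' ≤ s}) (volume.restrict (Set.Ioc (-M) M)) := by
    simp_rw [hr]
    exact hprod.integral_prod_right
  have hswap := integral_integral_swap
    (f := fun ω s => {ω' | U ω' ≤ s}.indicator (fun _ => (1 : ℝ)) ω) hprod
  simp_rw [setIntegral_indicator_le hM, ← hr] at hswap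
  rw [integral_const_sub_clip hM hU] at hswap
  unfold centeredInd ctrunc
  rw [integral_sub (hInt ω) hri, setIntegral_indicator_le hM, ← hswap]
  ring

theorem truncDep_zero {X : ℤ → Ω → ℝ} {F : Filtration ℤ mΩ} {κ : ℝ} (hκ : 0 ≤ κ) (k : ℕ) :
    TruncDep μ X F 0 κ k := by
  have h : ∀ (U : Ω → ℝ) ω, ctrunc μ 0 U ω = 0 := fun U ω => by simp [ctrunc, clip]
  constructor
  · intro W _ _
    simpa [h] using hκ
  · intro W l _ _
    simp [h]

variable {X : ℤ → Ω → ℝ} {F : Filtration ℤ mΩ}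

/-- The centered truncation is minus the integral of the centered indicators over (-M, M]. This
gives 2Mα for one variable and (2M)²α for two; the factor 4M is chosen so that the second is exactly
M κ. -/
theorem truncDep_of_alphaTwo (hX : ∀ i, Measurable (X i)) {M : ℝ} (hM : 0 ≤ M) {k : ℕ}
    (hfin : alphaTwo μ X F k ≠ ∞) :
    TruncDep μ X F M (4 * M * (alphaTwo μ X F k).toReal) k := by
  have hvol : (volume.restrict (Set.Ioc (-M) M)).real Set.univ = 2 * M := by
    rw [measureReal_restrict_apply_univ, Real.volume_real_Ioc, max_eq_left] <;> linarith
  have ha0 : 0 ≤ (alphaTwo μ X F k).toReal := ENNReal.toReal_nonneg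
  constructor
  · intro W hW hW1
    have hWm : Measurable W := hW.mono (F.le 0) le_rfl
    have h1 : ∀ s, |∫ ω, W ω * ({ω' | X k ω' ≤ s}.indicator (fun _ => (1 : ℝ)) ω
        - ∫ ω, {ω' | X k ω' ≤ s}.indicator (fun _ => (1 : ℝ)) ω ∂μ) ∂μ|
        ≤ (alphaTwo μ X F k).toReal := by
      intro s
      have hr : ∫ ω, {ω' | X k ω' ≤ s}.indicator (fun _ => (1 : ℝ)) ω ∂μ
          = μ.real {ω' | X k ω' ≤ s} :=
        integral_indicator_one (measurableSet_le (hX k) measurable_const)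
      rw [← ENNReal.ofReal_le_iff_le_toReal hfin, hr]
      refine (abs_integral_mul_le_eLpNorm_condExp (f := centeredInd μ (X k) s) (F.le 0) hW hW1
        ?_).trans ((le_iSup (fun x : ℝ => eLpNorm (μ[centeredInd μ (X k) x | F 0]) 1 μ) s).trans
        (le_max_left _ _))
      exact .of_bound ((measurable_uncurry_centeredInd (hX k)).comp
        measurable_prodMk_right).aestronglyMeasurable 1 (.of_forall fun ω => abs_centeredInd_le _ _ _)
    have h2 := abs_integral_mul_sub_le_of_kernel (μ := μ) (ν := volume.restrict (Set.Ioc (-M) M))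
      (measurable_uncurry_indicator_le (hX k)) (fun _ => abs_indicator_one_le _ _) hWm hW1 h1
    simp_rw [setIntegral_indicator_le hM] at h2
    rw [integral_const_sub_clip hM (hX k), hvol] at h2
    have e : ∫ ω, W ω * ctrunc μ M (X k) ω ∂μ
        = -∫ ω, W ω * (M - clip M (X k ω) - (M - ∫ ω, clip M (X k ω) ∂μ)) ∂μ := by
      rw [← integral_neg]
      refine integral_congr_ae (.of_forall fun ω => ?_)
      simp only [ctrunc]
      ring
    rw [e, abs_neg]
    nlinarith
  · intro W l hW hW1
    have hWm : Measurable W := hW.mono (F.le 0) le_rfl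
    set K : Ω × ℝ × ℝ → ℝ := fun p =>
      centeredInd μ (X k) p.2.1 p.1 * centeredInd μ (X (k + l)) p.2.2 p.1 with hK
    have hKm : Measurable K :=
      ((measurable_uncurry_centeredInd (hX k)).comp
        (measurable_fst.prodMk measurable_snd.fst)).mul
      ((measurable_uncurry_centeredInd (hX (k + l))).comp
        (measurable_fst.prodMk measurable_snd.snd))
    have hKC : ∀ p, |K p| ≤ 1 := fun p => by
      rw [hK, abs_mul]
      exact mul_le_one₀ (abs_centeredInd_le _ _ _) (abs_nonneg _) (abs_centeredInd_le _ _ _)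
    have hKi : ∀ s, Integrable (fun ω => K (ω, s)) μ := fun s =>
      .of_bound (hKm.comp measurable_prodMk_right).aestronglyMeasurable 1
        (.of_forall fun ω => hKC _)
    have h1 : ∀ s, |∫ ω, W ω * (K (ω, s) - ∫ ω', K (ω', s) ∂μ) ∂μ|
        ≤ (alphaTwo μ X F k).toReal := by
      intro s
      rw [← ENNReal.ofReal_le_iff_le_toReal hfin]
      refine (abs_integral_mul_le_eLpNorm_condExp (F.le 0) hW hW1
        ((hKi s).sub (integrable_const _))).trans ?_
      have hae : μ[fun ω => K (ω, s) - ∫ ω', K (ω', s) ∂μ | F 0]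
          =ᵐ[μ] fun ω => (μ[fun ω => K (ω, s) | F 0]) ω - ∫ ω', K (ω', s) ∂μ := by
        refine (condExp_sub (hKi s) (integrable_const (∫ ω', K (ω', s) ∂μ)) (F 0)).trans ?_
        rw [condExp_const (F.le 0)]
        rfl
      rw [show ((fun ω => K (ω, s)) - fun _ => ∫ ω', K (ω', s) ∂μ)
        = fun ω => K (ω, s) - ∫ ω', K (ω', s) ∂μ from rfl, eLpNorm_congr_ae hae]
      refine le_trans ?_ (le_max_right _ _)
      refine le_trans ?_ (le_iSup (fun l : ℕ => alphaPair (F 0) μ (X k) (X (k + l))) l)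
      exact le_iSup₂ (f := fun x y => eLpNorm (fun ω =>
        (μ[fun ω' => centeredInd μ (X k) x ω' * centeredInd μ (X (k + l)) y ω' | F 0]) ω
        - ∫ ω', centeredInd μ (X k) x ω' * centeredInd μ (X (k + l)) y ω' ∂μ) 1 μ) s.1 s.2
    have h2 := abs_integral_mul_sub_le_of_kernel (μ := μ)
      (ν := (volume.restrict (Set.Ioc (-M) M)).prod (volume.restrict (Set.Ioc (-M) M)))
      hKm hKC hWm hW1 h1
    have hprod : ∀ ω, ∫ s, K (ω, s) ∂((volume.restrict (Set.Ioc (-M) M)).prod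
        (volume.restrict (Set.Ioc (-M) M))) = ctrunc μ M (X k) ω * ctrunc μ M (X (k + l)) ω := by
      intro ω
      rw [ctrunc_eq_neg_setIntegral hM (hX k), ctrunc_eq_neg_setIntegral hM (hX (k + l)),
        neg_mul_neg]
      exact integral_prod_mul (fun s => centeredInd μ (X k) s ω)
        (fun s => centeredInd μ (X (k + l)) s ω)
    simp_rw [hprod] at h2
    rw [← Set.univ_prod_univ, measureReal_prod_prod, hvol] at h2
    linarith

theorem abs_integral_mul_comp_sub_le {S : Type*} [MeasurableSpace S] [StandardBorelSpace S]
    [Nonempty S] (hm : m ≤ mΩ) {Z : Ω → S} (hZ : Measurable Z) {h : S → ℝ} (hh : Measurable h)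
    {C : ℝ} (hC : ∀ z, |h z| ≤ C) (hW : Measurable[m] W) (hW1 : ∀ ω, |W ω| ≤ 1)
    {D : Ω → ℝ≥0∞}
    (hD : ∀ ω, ENNReal.ofReal |∫ z, h z ∂(condLaw m μ Z ω) - ∫ z, h z ∂(μ.map Z)| ≤ D ω) :
    ENNReal.ofReal |∫ ω, W ω * (h (Z ω) - ∫ ω', h (Z ω') ∂μ) ∂μ| ≤ ∫⁻ ω, D ω ∂μ := by
  have hi : Integrable (fun ω => h (Z ω)) μ :=
    .of_bound (hh.comp hZ).aestronglyMeasurable C (.of_forall fun ω => hC _)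
  refine (abs_integral_mul_le_eLpNorm_condExp hm hW hW1 (hi.sub (integrable_const _))).trans ?_
  have h1 := condExp_ae_eq_integral_condDistrib (μ := μ) (mβ := m) (X := (id : Ω → Ω))
    (measurable_id'' hm) hZ.aemeasurable hh.stronglyMeasurable hi
  rw [MeasurableSpace.comap_id] at h1
  have hae : μ[fun ω => h (Z ω) - ∫ ω', h (Z ω') ∂μ | m]
      =ᵐ[μ] fun ω => ∫ z, h z ∂(condLaw m μ Z ω) - ∫ z, h z ∂(μ.map Z) := by
    refine (condExp_sub hi (integrable_const (∫ ω', h (Z ω') ∂μ)) m).trans ?_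
    rw [condExp_const hm]
    filter_upwards [h1] with ω hω
    rw [Pi.sub_apply, hω, integral_map hZ.aemeasurable hh.aestronglyMeasurable]
    rfl
  rw [show ((fun ω => h (Z ω)) - fun _ => ∫ ω', h (Z ω') ∂μ)
    = fun ω => h (Z ω) - ∫ ω', h (Z ω') ∂μ from rfl, eLpNorm_congr_ae hae,
    eLpNorm_one_eq_lintegral_enorm]
  refine lintegral_mono fun ω => ?_
  rw [Real.enorm_eq_ofReal_abs]
  exact hD ω

theorem abs_clip_sub_clip_le (M x y : ℝ) : |clip M x - clip M y| ≤ |x - y| :=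
  (abs_max_sub_max_le_max _ _ _ _).trans (max_le (by simp)
    ((abs_min_sub_min_le_max _ _ _ _).trans (max_le (by simp) le_rfl)))

/-- Truncation is 1-Lipschitz. The product of two centered truncations, each bounded by 2M, is
4M-Lipschitz for the norm ½(|u| + |v|), and undoing the factor ½ in `tauPair` doubles this to 8M τ =
M κ. -/
theorem truncDep_of_tauTwo (hX : ∀ i, Measurable (X i)) {M : ℝ} (hM : 0 < M) {k : ℕ}
    (hfin : tauTwo μ X F k ≠ ∞) :
    TruncDep μ X F M (8 * (tauTwo μ X F k).toReal) k := by
  have ha0 : 0 ≤ (tauTwo μ X F k).toReal := ENNReal.toReal_nonneg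
  constructor
  · intro W hW hW1
    have h1 : |∫ ω, W ω * ctrunc μ M (X k) ω ∂μ| ≤ (tauTwo μ X F k).toReal := by
      rw [← ENNReal.ofReal_le_iff_le_toReal hfin]
      refine (abs_integral_mul_comp_sub_le (F.le 0) (hX k) (measurable_clip M)
        (fun _ => abs_clip_le hM.le _) hW hW1 (D := fun ω => ⨆ (f : ℝ → ℝ)
        (_ : ∀ x y, |f x - f y| ≤ |x - y|), ENNReal.ofReal (∫ x, f x ∂(condLaw (F 0) μ (X k) ω)
          - ∫ x, f x ∂(μ.map (X k)))) fun ω => ?_).trans (le_max_left _ _)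
      rcases abs_cases (∫ x, clip M x ∂(condLaw (F 0) μ (X k) ω)
          - ∫ x, clip M x ∂(μ.map (X k))) with ⟨h, -⟩ | ⟨h, -⟩ <;> rw [h]
      · exact le_iSup₂ (f := fun (f : ℝ → ℝ) (_ : ∀ x y, |f x - f y| ≤ |x - y|) =>
          ENNReal.ofReal (∫ x, f x ∂(condLaw (F 0) μ (X k) ω) - ∫ x, f x ∂(μ.map (X k))))
          (clip M) (abs_clip_sub_clip_le M)
      · refine le_trans (le_of_eq ?_) (le_iSup₂ (f := fun (f : ℝ → ℝ)
          (_ : ∀ x y, |f x - f y| ≤ |x - y|) =>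
          ENNReal.ofReal (∫ x, f x ∂(condLaw (F 0) μ (X k) ω) - ∫ x, f x ∂(μ.map (X k))))
          (fun x => -clip M x) fun x y => ?_)
        · rw [integral_neg, integral_neg]
          congr 1
          ring
        · rw [← abs_neg]
          refine le_trans (le_of_eq ?_) (abs_clip_sub_clip_le M x y)
          congr 1
          ring
    linarith
  · intro W l hW hW1
    set c₁ := ∫ ω, clip M (X k ω) ∂μ with hc₁
    set c₂ := ∫ ω, clip M (X (k + l) ω) ∂μ with hc₂
    have hb₁ : ∀ x, |clip M x - c₁| ≤ 2 * M := fun x => by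
      have h1 := abs_clip_le hM.le x
      have h2 : |c₁| ≤ M := abs_integral_le_of_abs_le fun ω => abs_clip_le hM.le _
      have h3 := abs_sub (clip M x) c₁
      linarith
    have hb₂ : ∀ x, |clip M x - c₂| ≤ 2 * M := fun x => by
      have h1 := abs_clip_le hM.le x
      have h2 : |c₂| ≤ M := abs_integral_le_of_abs_le fun ω => abs_clip_le hM.le _
      have h3 := abs_sub (clip M x) c₂
      linarith
    set h : ℝ × ℝ → ℝ := fun p => (clip M p.1 - c₁) * (clip M p.2 - c₂) with hh
    have hhm : Measurable h :=
      (((measurable_clip M).comp measurable_fst).sub_const _).mul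
        (((measurable_clip M).comp measurable_snd).sub_const _)
    have hhC : ∀ p, |h p| ≤ 2 * M * (2 * M) := fun p => by
      rw [hh, abs_mul]
      exact mul_le_mul (hb₁ _) (hb₂ _) (abs_nonneg _) (by positivity)
    have hlip : ∀ p q, |h p - h q| ≤ 4 * M * ((1 / 2) * (|p.1 - q.1| + |p.2 - q.2|)) := by
      intro p q
      have e : h p - h q = (clip M p.1 - clip M q.1) * (clip M p.2 - c₂)
          + (clip M q.1 - c₁) * (clip M p.2 - clip M q.2) := by
        simp only [hh]; ring
      have h1 : |(clip M p.1 - clip M q.1) * (clip M p.2 - c₂)| ≤ |p.1 - q.1| * (2 * M) := by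
        rw [abs_mul]
        exact mul_le_mul (abs_clip_sub_clip_le _ _ _) (hb₂ _) (abs_nonneg _) (abs_nonneg _)
      have h2 : |(clip M q.1 - c₁) * (clip M p.2 - clip M q.2)| ≤ 2 * M * |p.2 - q.2| := by
        rw [abs_mul]
        exact mul_le_mul (hb₁ _) (abs_clip_sub_clip_le _ _ _) (abs_nonneg _) (by positivity)
      rw [e]
      refine (abs_add_le _ _).trans ?_
      linarith
    set Z : Ω → ℝ × ℝ := fun ω => (X k ω, X (k + l) ω) with hZ
    have hZm : Measurable Z := (hX k).prodMk (hX (k + l))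
    set Φ : Ω → ℝ≥0∞ := fun ω => ⨆ (f : ℝ × ℝ → ℝ)
      (_ : ∀ p q, |f p - f q| ≤ (1 / 2) * (|p.1 - q.1| + |p.2 - q.2|)),
      ENNReal.ofReal (∫ p, f p ∂(condLaw (F 0) μ Z ω) - ∫ p, f p ∂(μ.map Z)) with hΦ
    have hτ : ∫⁻ ω, Φ ω ∂μ ≤ 2 * tauTwo μ X F k := by
      have h1 : (∫⁻ ω, Φ ω ∂μ) / 2 ≤ tauTwo μ X F k :=
        (le_iSup (fun l : ℕ => tauPair (F 0) μ (X k) (X (k + l))) l).trans (le_max_right _ _)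
      rwa [ENNReal.div_le_iff (by simp) (by simp), mul_comm] at h1
    have hscale : ∀ (ε : ℝ), |ε| = 1 → ∀ ω,
        ENNReal.ofReal (ε * (∫ z, h z ∂(condLaw (F 0) μ Z ω) - ∫ z, h z ∂(μ.map Z)))
          ≤ ENNReal.ofReal (4 * M) * Φ ω := by
      intro ε hε ω
      have h4 : (0 : ℝ) < 4 * M := by positivity
      refine le_trans (le_of_eq ?_) (mul_le_mul_right (le_iSup₂ (f := fun (f : ℝ × ℝ → ℝ)
        (_ : ∀ p q, |f p - f q| ≤ (1 / 2) * (|p.1 - q.1| + |p.2 - q.2|)) =>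
        ENNReal.ofReal (∫ p, f p ∂(condLaw (F 0) μ Z ω) - ∫ p, f p ∂(μ.map Z)))
        (fun p => ε / (4 * M) * h p) fun p q => ?_) _)
      · rw [integral_const_mul, integral_const_mul, ← ENNReal.ofReal_mul h4.le]
        congr 1
        field_simp
      · rw [← mul_sub, abs_mul, abs_div, hε, abs_of_pos h4, div_mul_eq_mul_div, one_mul,
          div_le_iff₀' h4]
        exact hlip p q
    have h1 : ENNReal.ofReal |∫ ω, W ω * (h (Z ω) - ∫ ω', h (Z ω') ∂μ) ∂μ|
        ≤ ENNReal.ofReal (M * (8 * (tauTwo μ X F k).toReal)) := by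
      refine (abs_integral_mul_comp_sub_le (F.le 0) hZm hhm hhC hW hW1
        (D := fun ω => ENNReal.ofReal (4 * M) * Φ ω) fun ω => ?_).trans ?_
      · rcases abs_cases (∫ z, h z ∂(condLaw (F 0) μ Z ω) - ∫ z, h z ∂(μ.map Z)) with
          ⟨h, -⟩ | ⟨h, -⟩ <;> rw [h]
        · simpa using hscale 1 (by simp) ω
        · simpa using hscale (-1) (by simp) ω
      · rw [lintegral_const_mul' _ _ ENNReal.ofReal_ne_top]
        calc ENNReal.ofReal (4 * M) * ∫⁻ ω, Φ ω ∂μ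
            ≤ ENNReal.ofReal (4 * M) * (2 * tauTwo μ X F k) := by gcongr
          _ = ENNReal.ofReal (M * (8 * (tauTwo μ X F k).toReal)) := by
            rw [show M * (8 * (tauTwo μ X F k).toReal) = 4 * M * (2 * (tauTwo μ X F k).toReal) by
              ring, ENNReal.ofReal_mul (p := 4 * M) (by positivity),
              ENNReal.ofReal_mul (p := 2) zero_le_two,
              ENNReal.ofReal_toReal hfin, ENNReal.ofReal_ofNat]
    exact (ENNReal.ofReal_le_ofReal_iff (by positivity)).1 h1

end

/-- The weight vanishes at k = 0, so nothing is known about f 0; hence the shift by one, which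
matches the convention that θ k measures a gap k + 1. -/
theorem summable_toReal_of_tsum_natCast_mul_lt_top {f : ℕ → ℝ≥0∞}
    (hf : ∑' k : ℕ, (k : ℝ≥0∞) * f k < ∞) (C : ℝ) :
    (∀ k, f (k + 1) ≠ ∞) ∧ Summable fun k : ℕ => ((k : ℝ) + 1) * (C * (f (k + 1)).toReal) := by
  constructor
  · intro k hk
    have h1 := (ENNReal.le_tsum (k + 1)).trans_lt hf
    rw [hk, ENNReal.mul_top (by exact_mod_cast k.succ_ne_zero)] at h1
    exact lt_irrefl _ h1
  · have h1 := (summable_nat_add_iff 1).2 (ENNReal.summable_toReal hf.ne)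
    refine (h1.mul_left C).congr fun k => ?_
    rw [ENNReal.toReal_mul, ENNReal.toReal_natCast]
    push_cast
    ring

/-! ### Choice of the truncation level under the α and τ conditions -/

namespace IsTransferable

variable {Ω : Type u} {mΩ : MeasurableSpace Ω} {μ : Measure Ω} [IsProbabilityMeasure μ]
  {X : ℤ → Ω → ℝ} {F : Filtration ℤ mΩ} {δ : ℝ}

theorem exists_integral_tailPow_lt (h : IsTransferable μ X F δ) (hδ0 : 0 < δ) {η : ℝ}
    (hη : 0 < η) : ∃ M : ℝ, 0 ≤ M ∧ ∫ ω, tailPow (2 + δ) M (X 0 ω) ∂μ ≤ η := by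
  have hlim : Tendsto (fun n : ℕ => ∫ ω, tailPow (2 + δ) n (X 0 ω) ∂μ) atTop
      (𝓝 (∫ _, (0 : ℝ) ∂μ)) := by
    refine tendsto_integral_of_dominated_convergence (fun ω => tailPow (2 + δ) 0 (X 0 ω))
      (fun n => (h.integrable_tailPow (by linarith) le_rfl n 0).1)
      (h.integrable_tailPow (by linarith) le_rfl 0 0) (fun n => .of_forall fun ω => ?_)
      (.of_forall fun ω => ?_)
    · rw [Real.norm_of_nonneg (tailPow_nonneg _ _ _)]
      exact tailPow_anti n.cast_nonneg
    · refine tendsto_const_nhds.congr' ?_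
      obtain ⟨N, hN⟩ := exists_nat_ge |X 0 ω|
      filter_upwards [eventually_ge_atTop N] with n hn
      rw [tailPow_of_le (hN.trans (by exact_mod_cast hn))]
  rw [integral_zero] at hlim
  obtain ⟨n, hn⟩ := (hlim.eventually (gt_mem_nhds hη)).exists
  exact ⟨n, n.cast_nonneg, hn.le⟩

theorem ofReal_integral_tailPow (h : IsTransferable μ X F δ) (hδ0 : 0 < δ) (M : ℝ≥0) :
    ENNReal.ofReal (∫ ω, tailPow (2 + δ) M (X 0 ω) ∂μ)
      = ∫⁻ ω in {ω | (M : ℝ≥0∞) < ‖X 0 ω‖ₑ}, ‖X 0 ω‖ₑ ^ (2 + δ) ∂μ := by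
  rw [ofReal_integral_eq_lintegral_ofReal (h.integrable_tailPow (by linarith) le_rfl _ 0)
    (.of_forall fun _ => tailPow_nonneg _ _ _),
    ← lintegral_indicator (measurableSet_lt measurable_const (h.measurable 0).enorm)]
  refine lintegral_congr fun ω => ?_
  have hiff : ω ∈ {ω | (M : ℝ≥0∞) < ‖X 0 ω‖ₑ} ↔ (M : ℝ) < |X 0 ω| := by
    rw [Set.mem_ofPred_eq, Real.enorm_eq_ofReal_abs, ← ENNReal.ofReal_coe_nnreal,
      ENNReal.ofReal_lt_ofReal_iff_of_nonneg M.coe_nonneg]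
  by_cases hM : (M : ℝ) < |X 0 ω|
  · rw [tailPow_of_lt hM, Set.indicator_of_mem (hiff.2 hM), Real.enorm_eq_ofReal_abs,
      ENNReal.ofReal_rpow_of_nonneg (abs_nonneg _) (by linarith)]
  · rw [tailPow_of_le (not_lt.1 hM), Set.indicator_of_notMem (fun hc => hM (hiff.1 hc)),
      ENNReal.ofReal_zero]

/-- A truncation level that balances the dependence coefficient `a` and the tail of `X 0`, from a
quantile bound with respect to a reweighted measure `ν`. -/
theorem exists_level (h : IsTransferable μ X F δ) (hδ0 : 0 < δ) {ν : Measure Ω} [SFinite ν]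
    {g : ℝ → ℝ≥0∞} (hg : Antitone g)
    (hν : ∀ u > 0, ν {ω | g u < ‖X 0 ω‖ₑ} ≤ ENNReal.ofReal u) {q : ℝ} (hq : 0 < q)
    (hνμ : ∀ M : ℝ≥0, ∫⁻ ω in {ω | (M : ℝ≥0∞) < ‖X 0 ω‖ₑ}, ‖X 0 ω‖ₑ ^ (2 + δ) ∂μ
      = ∫⁻ ω in {ω | (M : ℝ≥0∞) < ‖X 0 ω‖ₑ}, ‖X 0 ω‖ₑ ^ q ∂ν) {a : ℝ≥0∞}
    (hI : ∫⁻ u in {u : ℝ | 0 < u ∧ ENNReal.ofReal u ≤ a}, g u ^ q ≠ ∞) {η : ℝ} (hη : 0 < η) :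
    ∃ M : ℝ, 0 ≤ M ∧ (a = ∞ → M = 0) ∧
      M ^ q * a.toReal
        ≤ (∫⁻ u in {u : ℝ | 0 < u ∧ ENNReal.ofReal u ≤ a}, g u ^ q).toReal ∧
      ∫ ω, tailPow (2 + δ) M (X 0 ω) ∂μ
        ≤ (∫⁻ u in {u : ℝ | 0 < u ∧ ENNReal.ofReal u ≤ a}, g u ^ q).toReal + η := by
  rcases eq_or_ne a 0 with rfl | ha
  -- With a = 0 the level g 0 may be infinite, so a large finite level is taken instead; this is the
  -- case that needs η.
  · obtain ⟨M, hM, hT⟩ := h.exists_integral_tailPow_lt hδ0 hη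
    refine ⟨M, hM, by simp, by simp, hT.trans ?_⟩
    linarith [ENNReal.toReal_nonneg (a := ∫⁻ u in {u : ℝ | 0 < u ∧ ENNReal.ofReal u ≤ 0}, g u ^ q)]
  obtain ⟨M, hM, hle, hT⟩ := exists_truncation_level (h.measurable 0).enorm hg hν hq ha hI
  refine ⟨M, M.coe_nonneg, fun hc => by simp [hM hc], ?_, ?_⟩
  · rw [← ENNReal.ofReal_le_iff_le_toReal hI, ENNReal.ofReal_mul (by positivity),
      ← ENNReal.ofReal_rpow_of_nonneg M.coe_nonneg hq.le, ENNReal.ofReal_coe_nnreal]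
    exact hle
  · rw [← hνμ, ← h.ofReal_integral_tailPow hδ0, ENNReal.ofReal_le_iff_le_toReal hI] at hT
    linarith

theorem exists_dependenceBounds_of_alphaCondition (h : IsTransferable μ X F δ) (hδ0 : 0 < δ)
    (hc : AlphaCondition μ X F δ) : ∃ (B : ℝ) (c θ : ℕ → ℝ), DependenceBounds μ X F δ B c θ := by
  -- With κ = 4Mα, M^{1+δ} κ = 4 M^{2+δ} α contributes four times the integral, and the tail of X 0
  -- once.
  obtain ⟨hfin, hsum⟩ := summable_toReal_of_tsum_natCast_mul_lt_top hc 5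
  refine h.exists_dependenceBounds hδ0 (fun k η hη => ?_) hsum
  obtain ⟨M, hM, htop, h1, h2⟩ := h.exists_level hδ0 antitone_tailQuantile
    (fun u _ => measure_tailQuantile_lt_le (μ := μ) u) (by linarith : 0 < 2 + δ) (fun _ => rfl)
    (hfin k) hη
  have ha0 := ENNReal.toReal_nonneg (a := alphaTwo μ X F (k + 1))
  refine ⟨M, 4 * M * (alphaTwo μ X F (k + 1)).toReal, hM, by positivity, ?_, ?_⟩
  · by_cases ht : alphaTwo μ X F (k + 1) = ∞
    · rw [htop ht]
      exact truncDep_zero (by positivity) _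
    · exact truncDep_of_alphaTwo h.measurable hM ht
  · have e : M ^ (1 + δ) * (4 * M * (alphaTwo μ X F (k + 1)).toReal)
        = 4 * (M ^ (2 + δ) * (alphaTwo μ X F (k + 1)).toReal) := by
      rw [show 2 + δ = 1 + δ + 1 by ring, Real.rpow_add_one' hM (by linarith)]
      ring
    rw [e]
    linarith

theorem exists_dependenceBounds_of_tauCondition (h : IsTransferable μ X F δ) (hδ0 : 0 < δ)
    (hc : TauCondition μ X F δ) : ∃ (B : ℝ) (c θ : ℕ → ℝ), DependenceBounds μ X F δ B c θ := by
  -- With κ = 8τ = 16 (τ/2), M^{1+δ} κ contributes sixteen times the integral up to τ/2, and the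
  -- tail once.
  obtain ⟨hfin, hsum⟩ := summable_toReal_of_tsum_natCast_mul_lt_top hc 17
  refine h.exists_dependenceBounds hδ0 (fun k η hη => ?_) hsum
  have hX := (h.measurable 0).enorm
  -- One factor |X 0| is moved into the measure, which leaves the exponent 1 + δ and makes Q ∘ G the
  -- relevant quantile bound.
  have hdens : ∀ M : ℝ≥0, ∫⁻ ω in {ω | (M : ℝ≥0∞) < ‖X 0 ω‖ₑ}, ‖X 0 ω‖ₑ ^ (2 + δ) ∂μ
      = ∫⁻ ω in {ω | (M : ℝ≥0∞) < ‖X 0 ω‖ₑ}, ‖X 0 ω‖ₑ ^ (1 + δ)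
        ∂(μ.withDensity fun ω => ‖X 0 ω‖ₑ) := fun M => by
    rw [setLIntegral_withDensity_eq_setLIntegral_mul _ hX (hX.pow_const _)
      (measurableSet_lt measurable_const hX)]
    refine lintegral_congr fun ω => ?_
    rw [Pi.mul_apply, show 2 + δ = 1 + (1 + δ) by ring,
      ENNReal.rpow_add_of_nonneg _ _ zero_le_one (by linarith), ENNReal.rpow_one]
  obtain ⟨M, hM, htop, h1, h2⟩ := h.exists_level hδ0
    (antitone_tailQuantile.comp_monotone monotone_invIntQuantile)
    (fun u _ => withDensity_tailQuantile_invIntQuantile_lt_le (h.measurable 0) u)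
    (by linarith : 0 < 1 + δ) hdens (hfin k) hη
  have ha0 := ENNReal.toReal_nonneg (a := tauTwo μ X F (k + 1))
  have e2 : (tauTwo μ X F (k + 1) / 2).toReal = (tauTwo μ X F (k + 1)).toReal / 2 := by
    rw [ENNReal.toReal_div, ENNReal.toReal_ofNat]
  refine ⟨M, 8 * (tauTwo μ X F (k + 1)).toReal, hM, by positivity, ?_, ?_⟩
  · rcases hM.eq_or_lt with rfl | hM0
    · exact truncDep_zero (by positivity) _
    · refine truncDep_of_tauTwo h.measurable hM0 fun ht => hM0.ne' (htop ?_)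
      rw [ht, ENNReal.top_div_of_ne_top (by simp)]
  · rw [e2] at h1
    simp only [Function.comp_apply] at h1 h2
    linarith

end IsTransferable

end CLTRate

/-! ### Assembly of the theorem -/

theorem mainTheorem4 {Ω : Type*} {mΩ : MeasurableSpace Ω} (μ : Measure Ω) [IsProbabilityMeasure μ]
    (X : ℤ → Ω → ℝ) (F : Filtration ℤ mΩ)
    (hstat : CLTRate.IsStationaryAdapted μ X F)
    (δ : ℝ) (hδ0 : 0 < δ) (hδ1 : δ ≤ 1)
    (hmom : MemLp (X 0) (ENNReal.ofReal (2 + δ)) μ)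
    (hcent : ∫ ω, X 0 ω ∂μ = 0)
    (hanti : AntitoneOn (CLTRate.gammaTwo μ X F δ) (Set.Ici 1))
    (hlim : Tendsto (CLTRate.gammaTwo μ X F δ) atTop (𝓝 0))
    (hcond : CLTRate.AlphaCondition μ X F δ ∨ CLTRate.TauCondition μ X F δ) :
    Summable (fun k : ℤ => cov[X 0, X k; μ]) ∧
    0 ≤ CLTRate.asympVar μ X ∧
    TendstoInDistribution (CLTRate.normSum X) atTop (id : ℝ → ℝ) (fun _ => μ)
      (gaussianReal 0 (CLTRate.asympVar μ X).toNNReal) ∧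
    (∃ C : ℝ, ∀ n : ℕ, 1 ≤ n →
      CLTRate.zolotarev (2 + δ) (μ.map (CLTRate.normSum X n))
          (gaussianReal 0 (CLTRate.asympVar μ X).toNNReal)
        ≤ ENNReal.ofReal (C * (n : ℝ) ^ (-(δ / 2)))) ∧
    (∃ C : ℝ, ∀ n : ℕ, 1 ≤ n →
      CLTRate.wasserstein (2 + δ) (μ.map (CLTRate.normSum X n))
          (gaussianReal 0 (CLTRate.asympVar μ X).toNNReal)
        ≤ ENNReal.ofReal (C * (n : ℝ) ^ (-(δ / (4 + 2 * δ))))) := by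
  have h := hstat.isTransferable hmom hcent
  obtain ⟨B, c, θ, H⟩ : ∃ (B : ℝ) (c θ : ℕ → ℝ), CLTRate.DependenceBounds μ X F δ B c θ :=
    hcond.elim (h.exists_dependenceBounds_of_alphaCondition hδ0)
      (h.exists_dependenceBounds_of_tauCondition hδ0)
  have hsum := H.hasSum_cov hδ0
  have hvar : CLTRate.asympVar μ X = CLTRate.seriesVar c := hsum.tsum_eq
  rw [hvar]
  obtain ⟨C, -, hC⟩ := H.exists_zolotarev_bound hδ0 hδ1
  exact ⟨hsum.summable, H.seriesVar_nonneg hδ0, H.tendstoInDistribution hδ0 hδ1, ⟨C, hC⟩,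
    H.exists_wasserstein_bound hδ0 hδ1⟩
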